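/- Consider the class $\mathscr C$ of $(1+2)$-dimensional cubic Schrödinger equations \[ i\psi_t+\psi_{11}+\psi_{22}+|\psi|^2\psi+V(t,x)\psi=0, \qquad x=(x_1,x_2), \] where $V$ is an arbitrary smooth complex-valued potential on an open subset of $\mathbb R\times\mathbb R^2$. Point transformations are diffeomorphisms between open subsets of the space of $(t,x,\psi)\in\mathbb R\times\mathbb R^2\times\mathbb C$ (smooth over $\mathbb R$, i.e. dependence on $\psi^*$ is allowed). For potentials $V,\tilde V$ let $\mathrm T(V,\tilde V)$ be the set of admissible transformations, i.e. of point transformations whose second prolongation maps the equation with potential $V$ to the equation with potential $\tilde V$ (as submanifolds of the jet space), and let $G_V=\mathrm T(V,V)$. The equivalence group $G^\sim_{\mathscr C}$ is the pseudogroup consisting of the local diffeomorphisms $\Phi$ of the space of $(t,x,\psi,V)$ which, locally near each point of their domain, project to point transformations of $(t,x,\psi)$, map every potential $V$ to a potential $\Phi V$, and satisfy $\Phi|_{(t,x,\psi)}\in\mathrm T(V,\Phi V)$ for every $V$ (restricted to where $\Phi$ can be applied to $V$). Theorem. (1) The class $\mathscr C$ is strongly normalized. That is, for all $V,\tilde V$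 and $\varphi\in\mathrm T(V,\tilde V)$ there is $\Phi\in G^\sim_{\mathscr C}$ with $\tilde V=\Phi V$ and $\varphi=\Phi|_{(t,x,\psi)}$; and the projection of $G^\sim_{\mathscr C}$ to the space of $(t,x,\psi)$ is the pseudogroup generated by all the point symmetry pseudogroups $G_V$. (2) The equivalence group $G^\sim_{\mathscr C}$ is formed by the transformations \[ \tilde t=T, \qquad \tilde x=|T_t|^{1/2}Ox+X, \] \[ \tilde\psi=|T_t|^{-1/2}\exp\Bigl(\frac i8\frac{T_{tt}}{|T_t|}x_ax_a+\frac i2\frac{\varepsilon_T X^b_t}{|T_t|^{1/2}}O^{ba}x_a+i\Psi\Bigr)\hat\psi, \] \[ \tilde V=\frac{\hat V}{|T_t|}+\frac{2T_{ttt}T_t-3T_{tt}^2}{16\varepsilon_TT_t^3}x_ax_a+\frac{\varepsilon_T}{2|T_t|^{1/2}}\Bigl(\frac{X^b_t}{T_t}\Bigr)_{t}O^{ba}x_a+\frac{\Psi_t}{T_t}-\frac{X^a_tX^a_t}{4T_t^2}, \] with summation over repeated indices $a,b\in\{1,2\}$. Here $T$, $X=(X^1,X^2)$ and $\Psi$ are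 arbitrary smooth real-valued functions of $t$ on an open interval, $T_t\neq0$, $\varepsilon_T=\operatorname{sign}T_t$, $O=(O^{ab})$ is an arbitrary constant orthogonal $2\times2$ matrix, and $\hat\beta=\beta$ if $T_t>0$, $\hat\beta=\beta^*$ if $T_t<0$. Precisely, a local diffeomorphism $\Phi$ of the space of $(t,x,\psi,V)$ belongs to $G^\sim_{\mathscr C}$ if and only if it has this form near each point of its domain; if the domain of $\Phi$ is convex, $\Phi$ belongs to $G^\sim_{\mathscr C}$ if and only if it has this form, with a single choice of $T,O,X,\Psi$, on the whole domain. -/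

import Mathlib

open Complex Topology
open scoped ContDiff

noncomputable section

namespace CubicNLS

/-- The space of the independent variables `(t, x)`, `x = (x₁, x₂)`. -/
abbrev BaseSpace : Type := ℝ × (Fin 2 → ℝ)

/-- The space of the variables `((t, x), ψ)`; complex conjugates and smoothness over `ℝ` are allowed,
so this is the space of `(t, x, ψ, ψ*)`. -/
abbrev VarSpace : Type := BaseSpace × ℂ

/-- The space of the variables and the arbitrary element, `(((t, x), ψ), V)`. -/
abbrev ExtSpace : Type := VarSpace × ℂ

/-- The partial derivative with respect to `t`. -/
def dt (f : BaseSpace → ℂ) (z : BaseSpace) : ℂ := fderiv ℝ f z (1, 0)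

/-- The partial derivative with respect to `x_a`. -/
def dx (a : Fin 2) (f : BaseSpace → ℂ) (z : BaseSpace) : ℂ := fderiv ℝ f z (0, Pi.single a 1)

/-- The arbitrary elements: smooth complex-valued potentials `V(t, x)`, defined on an open set
(values of `toFun` outside `domain` play no role). -/
structure Potential where
  domain : Set BaseSpace
  toFun : BaseSpace → ℂ
  isOpen_domain : IsOpen domain
  smooth : ContDiffOn ℝ ∞ toFun domain

/-- The left-hand side `i ψ_t + ψ_11 + ψ_22 + |ψ|² ψ + V ψ`, evaluated at `z = (t, x)`. -/
def lhs (V : Potential) (f : BaseSpace → ℂ) (z : BaseSpace) : ℂ :=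
  I * dt f z + ∑ a, dx a (dx a f) z + ((‖f z‖ ^ 2 : ℝ) : ℂ) * f z + V.toFun z * f z

/-- A (locally defined) point transformation: a diffeomorphism between open subsets. -/
def IsPointTransformation {E : Type} [NormedAddCommGroup E] [NormedSpace ℝ E]
    (e : OpenPartialHomeomorph E E) : Prop :=
  ContDiffOn ℝ ∞ e e.source ∧ ContDiffOn ℝ ∞ e.symm e.target

/-- The point transformation `e` maps the graph of `f` near `z` to the graph of `g` near `w`,
and the point over `z` to the point over `w`.  Equivalently, the prolongations of `e` to the jet
spaces send the jets of `f` at `z` to the jets of `g` at `w`. -/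
def MapsGraph (e : OpenPartialHomeomorph VarSpace VarSpace)
    (f g : BaseSpace → ℂ) (z w : BaseSpace) : Prop :=
  (z, f z) ∈ e.source ∧ e (z, f z) = (w, g w) ∧
    ∀ᶠ z' in 𝓝 z, (e (z', f z')).2 = g (e (z', f z')).1

/-- The set `T(V, V')` of admissible transformations: the point transformations which map the
equation with potential `V`, as a submanifold of the second-order jet space, to the equation with
potential `V'`.  A 2-jet is given by a smooth function `f` (which need not be a solution) and a
point `z`; it lies on the submanifold if the equation holds for `f` at the point `z`. -/
def admissible (V V' : Potential) : Set (OpenPartialHomeomorph VarSpace VarSpace) :=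
  {e | IsPointTransformation e ∧
    (∀ p ∈ e.source, p.1 ∈ V.domain ∧ (e p).1 ∈ V'.domain) ∧
    ∀ (f g : BaseSpace → ℂ) (z w : BaseSpace),
      ContDiffAt ℝ ∞ f z → ContDiffAt ℝ ∞ g w → MapsGraph e f g z w →
        (lhs V f z = 0 ↔ lhs V' g w = 0)}

/-- The maximal point symmetry pseudogroup `G_V` of the equation with potential `V`. -/
def pointSymmetries (V : Potential) : Set (OpenPartialHomeomorph VarSpace VarSpace) :=
  admissible V V

/-- `Φ` is projectable on the space of `(t, x, ψ)` and `e` is its restriction to this space. -/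
def ProjectsTo (Φ : OpenPartialHomeomorph ExtSpace ExtSpace)
    (e : OpenPartialHomeomorph VarSpace VarSpace) : Prop :=
  e.source = Prod.fst '' Φ.source ∧ ∀ q ∈ Φ.source, (Φ q).1 = e q.1

/-- The points `(t, x, ψ)` at which `Φ` can be applied to the potential `V`. -/
def applyDomain (Φ : OpenPartialHomeomorph ExtSpace ExtSpace) (V : Potential) : Set VarSpace :=
  {p | p.1 ∈ V.domain ∧ (p, V.toFun p.1) ∈ Φ.source}

/-- `V' = Φ V`: wherever `Φ` can be applied to `V`, it maps the graph of `V` to that of `V'`. -/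
def MapsPotential (Φ : OpenPartialHomeomorph ExtSpace ExtSpace) (V V' : Potential) : Prop :=
  ∀ p ∈ applyDomain Φ V,
    (Φ (p, V.toFun p.1)).1.1 ∈ V'.domain ∧
      (Φ (p, V.toFun p.1)).2 = V'.toFun (Φ (p, V.toFun p.1)).1.1

/-- `Φ` is a point transformation in the space of `(t, x, ψ, V)`, projectable on the space of
`(t, x, ψ)`, such that for every potential `V` the image `Φ V` is a potential and the restriction
of `Φ` to `(t, x, ψ)` is an admissible transformation from the equation with `V` to the one with
`Φ V`. -/
def IsEquivalenceTransformation (Φ : OpenPartialHomeomorph ExtSpace ExtSpace) : Prop :=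
  IsPointTransformation Φ ∧
    ∃ e : OpenPartialHomeomorph VarSpace VarSpace, ProjectsTo Φ e ∧
      ∀ V : Potential, ∃ V' : Potential, MapsPotential Φ V V' ∧
        e.restr (applyDomain Φ V) ∈ admissible V V'

/-- The (usual) equivalence group of the class, a pseudogroup of locally defined transformations:
membership is a local property. -/
def equivalenceGroup : Set (OpenPartialHomeomorph ExtSpace ExtSpace) :=
  {Φ | ∀ q ∈ Φ.source, ∃ s : Set ExtSpace, IsOpen s ∧ q ∈ s ∧
    IsEquivalenceTransformation (Φ.restr s)}

/-- The class is normalized: every admissible transformation is induced by a transformation from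
the equivalence group. -/
def IsNormalized : Prop :=
  ∀ (V V' : Potential), ∀ e ∈ admissible V V', ∃ Φ ∈ equivalenceGroup,
    ProjectsTo Φ e ∧ e.source ⊆ applyDomain Φ V ∧ MapsPotential Φ V V'

/-- The restriction of the equivalence group to the space of `(t, x, ψ)`. -/
def projectedEquivalenceGroup : Set (OpenPartialHomeomorph VarSpace VarSpace) :=
  {e | ∃ Φ ∈ equivalenceGroup, ProjectsTo Φ e}

/-- The pseudogroup generated by the point symmetry pseudogroups `G_V` of all the equations from
the class. -/
def generatedBySymmetries : StructureGroupoid VarSpace :=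
  sInf {G | ∀ V : Potential, ∀ e ∈ pointSymmetries V, e ∈ G}

/-- The class is strongly normalized. -/
def IsStronglyNormalized : Prop :=
  IsNormalized ∧
    projectedEquivalenceGroup = {e | e ∈ generatedBySymmetries}

/-- `β̂ = β` if `T_t > 0` and `β̂ = β*` if `T_t < 0`; here `c` is the value of `T_t`. -/
def hat (c : ℝ) (β : ℂ) : ℂ := if 0 < c then β else (starRingEnd ℂ) β

/-- The component `x̃ = |T_t|^{1/2} O x + X`. -/
def newX (T : ℝ → ℝ) (O : Matrix (Fin 2) (Fin 2) ℝ) (X : Fin 2 → ℝ → ℝ)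
    (t : ℝ) (x : Fin 2 → ℝ) : Fin 2 → ℝ :=
  fun b => Real.sqrt |deriv T t| * (∑ a, O b a * x a) + X b t

/-- The phase
`(1/8) (T_tt / |T_t|) x_a x_a + (1/2) (ε X^b_t / |T_t|^{1/2}) O^{ba} x_a + Ψ`, `ε = sign T_t`. -/
def phase (T : ℝ → ℝ) (O : Matrix (Fin 2) (Fin 2) ℝ) (X : Fin 2 → ℝ → ℝ) (Ψ : ℝ → ℝ)
    (t : ℝ) (x : Fin 2 → ℝ) : ℝ :=
  1 / 8 * (iteratedDeriv 2 T t / |deriv T t|) * (∑ a, x a * x a)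
    + 1 / 2 * (∑ a, ∑ b, Real.sign (deriv T t) * deriv (X b) t / Real.sqrt |deriv T t|
        * O b a * x a)
    + Ψ t

/-- The component `ψ̃`. -/
def newPsi (T : ℝ → ℝ) (O : Matrix (Fin 2) (Fin 2) ℝ) (X : Fin 2 → ℝ → ℝ) (Ψ : ℝ → ℝ)
    (t : ℝ) (x : Fin 2 → ℝ) (ψ : ℂ) : ℂ :=
  ((1 / Real.sqrt |deriv T t| : ℝ) : ℂ) * Complex.exp (I * (phase T O X Ψ t x : ℂ))
    * hat (deriv T t) ψ

/-- The component `Ṽ`. -/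
def newV (T : ℝ → ℝ) (O : Matrix (Fin 2) (Fin 2) ℝ) (X : Fin 2 → ℝ → ℝ) (Ψ : ℝ → ℝ)
    (t : ℝ) (x : Fin 2 → ℝ) (v : ℂ) : ℂ :=
  hat (deriv T t) v / ((|deriv T t| : ℝ) : ℂ)
    + (((2 * iteratedDeriv 3 T t * deriv T t - 3 * iteratedDeriv 2 T t ^ 2)
          / (16 * Real.sign (deriv T t) * deriv T t ^ 3) * (∑ a, x a * x a)
        + Real.sign (deriv T t) / (2 * Real.sqrt |deriv T t|)
          * (∑ a, ∑ b, deriv (fun s => deriv (X b) s / deriv T s) t * O b a * x a)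
        + deriv Ψ t / deriv T t
        - (∑ a, deriv (X a) t * deriv (X a) t) / (4 * deriv T t ^ 2) : ℝ) : ℂ)

/-- `Φ` has the explicit form on its whole domain, with smooth real-valued functions `T`, `X`, `Ψ`
of `t` on an open interval `J`, `T_t ≠ 0`, and a constant orthogonal matrix `O`. -/
def HasExplicitForm (Φ : OpenPartialHomeomorph ExtSpace ExtSpace) : Prop :=
  ∃ (J : Set ℝ) (T : ℝ → ℝ) (O : Matrix (Fin 2) (Fin 2) ℝ) (X : Fin 2 → ℝ → ℝ) (Ψ : ℝ → ℝ),
    IsOpen J ∧ J.OrdConnected ∧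
    ContDiffOn ℝ ∞ T J ∧ (∀ a, ContDiffOn ℝ ∞ (X a) J) ∧ ContDiffOn ℝ ∞ Ψ J ∧
    (∀ t ∈ J, deriv T t ≠ 0) ∧ O ∈ Matrix.orthogonalGroup (Fin 2) ℝ ∧
    ∀ (t : ℝ) (x : Fin 2 → ℝ) (ψ v : ℂ), (((t, x), ψ), v) ∈ Φ.source →
      t ∈ J ∧ Φ (((t, x), ψ), v) = (((T t, newX T O X t x), newPsi T O X Ψ t x ψ),
        newV T O X Ψ t x v)

end CubicNLS

end

namespace CubicNLS

section SecondDerivative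

variable {E F G : Type*} [NormedAddCommGroup E] [NormedSpace ℝ E] [NormedAddCommGroup F]
  [NormedSpace ℝ F] [NormedAddCommGroup G] [NormedSpace ℝ G]

/-- The second derivative as a bilinear map. -/
noncomputable def D2 (f : E → F) (z : E) : E →L[ℝ] E →L[ℝ] F := fderiv ℝ (fderiv ℝ f) z

theorem contDiffAt_fderiv {f : E → F} {z : E} (hf : ContDiffAt ℝ ∞ f z) :
    ContDiffAt ℝ ∞ (fderiv ℝ f) z :=
  hf.fderiv_right (m := ∞) (by norm_num)

theorem contDiffAt_differentiableAt {f : E → F} {z : E} (hf : ContDiffAt ℝ ∞ f z) :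
    DifferentiableAt ℝ f z := hf.differentiableAt (by norm_num)

theorem eventually_contDiffAt {f : E → F} {z : E} (hf : ContDiffAt ℝ ∞ f z) (n : ℕ) :
    ∀ᶠ y in 𝓝 z, ContDiffAt ℝ n f y :=
  (hf.of_le (by exact_mod_cast le_top : (n : WithTop ℕ∞) ≤ ∞)).eventually (by simp)

theorem eventually_differentiableAt {f : E → F} {z : E} (hf : ContDiffAt ℝ ∞ f z) :
    ∀ᶠ y in 𝓝 z, DifferentiableAt ℝ f y :=
  (eventually_contDiffAt hf 1).mono fun _ h => h.differentiableAt (by norm_num)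

theorem fderiv_comp_at {g : F → G} {c : E → F} {z : E} (hg : ContDiffAt ℝ ∞ g (c z))
    (hc : ContDiffAt ℝ ∞ c z) (u : E) :
    fderiv ℝ (fun y => g (c y)) z u = fderiv ℝ g (c z) (fderiv ℝ c z u) := by
  rw [fderiv_fun_comp z (contDiffAt_differentiableAt hg) (contDiffAt_differentiableAt hc)]
  rfl

theorem D2_comp {g : F → G} {c : E → F} {z : E} (hg : ContDiffAt ℝ ∞ g (c z))
    (hc : ContDiffAt ℝ ∞ c z) (u v : E) :
    D2 (fun y => g (c y)) z u v
      = D2 g (c z) (fderiv ℝ c z u) (fderiv ℝ c z v) + fderiv ℝ g (c z) (D2 c z u v) := by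
  have h1 : fderiv ℝ (fun y => g (c y)) =ᶠ[𝓝 z]
      fun y => (fderiv ℝ g (c y)).comp (fderiv ℝ c y) := by
    filter_upwards [hc.continuousAt.eventually (eventually_differentiableAt hg),
      eventually_differentiableAt hc] with y h1 h2
    exact fderiv_fun_comp y h1 h2
  have hgd := (contDiffAt_differentiableAt (contDiffAt_fderiv hg)).hasFDerivAt
  have hcd := (contDiffAt_differentiableAt (contDiffAt_fderiv hc)).hasFDerivAt
  have hc1 := (contDiffAt_differentiableAt hc).hasFDerivAt
  have h2 := (hgd.comp z hc1).clm_comp hcd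
  have h3 := h2.congr_of_eventuallyEq h1
  simp only [D2]
  rw [h3.fderiv]
  simp [add_comm]

theorem D2_symm {f : E → F} {z : E} (hf : ContDiffAt ℝ ∞ f z) (u v : E) :
    D2 f z u v = D2 f z v u := by
  have := hf.isSymmSndFDerivAt (n := ∞) (by simpa using (WithTop.coe_le_coe.2 le_top : ((2 : ℕ∞) : WithTop ℕ∞) ≤ ∞))
  exact this u v

theorem D2_congr {f g : E → F} {z : E} (h : f =ᶠ[𝓝 z] g) : D2 f z = D2 g z :=
  h.fderiv.fderiv_eq

/-- Second directional derivatives as iterated first ones. -/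
theorem fderiv_fderiv_apply {f : E → F} {z : E} (hf : ContDiffAt ℝ ∞ f z) (u v : E) :
    fderiv ℝ (fun y => fderiv ℝ f y v) z u = D2 f z u v := by
  have h := contDiffAt_differentiableAt (contDiffAt_fderiv hf)
  rw [fderiv_clm_apply h (differentiableAt_const v)]
  simp [D2]

theorem D2_add {f g : E → F} {z : E} (hf : ContDiffAt ℝ ∞ f z) (hg : ContDiffAt ℝ ∞ g z) :
    D2 (fun y => f y + g y) z = D2 f z + D2 g z := by
  have h1 : fderiv ℝ (fun y => f y + g y) =ᶠ[𝓝 z] fun y => fderiv ℝ f y + fderiv ℝ g y := by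
    filter_upwards [eventually_differentiableAt hf, eventually_differentiableAt hg] with y h1 h2
    exact fderiv_fun_add h1 h2
  rw [D2, h1.fderiv_eq, fderiv_fun_add (contDiffAt_differentiableAt (contDiffAt_fderiv hf))
    (contDiffAt_differentiableAt (contDiffAt_fderiv hg))]
  rfl

theorem D2_sub {f g : E → F} {z : E} (hf : ContDiffAt ℝ ∞ f z) (hg : ContDiffAt ℝ ∞ g z) :
    D2 (fun y => f y - g y) z = D2 f z - D2 g z := by
  have h1 : fderiv ℝ (fun y => f y - g y) =ᶠ[𝓝 z] fun y => fderiv ℝ f y - fderiv ℝ g y := by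
    filter_upwards [eventually_differentiableAt hf, eventually_differentiableAt hg] with y h1 h2
    exact fderiv_fun_sub h1 h2
  rw [D2, h1.fderiv_eq, fderiv_fun_sub (contDiffAt_differentiableAt (contDiffAt_fderiv hf))
    (contDiffAt_differentiableAt (contDiffAt_fderiv hg))]
  rfl

theorem D2_mul {f g : E → ℂ} {z : E} (hf : ContDiffAt ℝ ∞ f z) (hg : ContDiffAt ℝ ∞ g z)
    (u v : E) :
    D2 (fun y => f y * g y) z u v = D2 f z u v * g z + f z * D2 g z u v
      + fderiv ℝ f z u * fderiv ℝ g z v + fderiv ℝ f z v * fderiv ℝ g z u := by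
  rw [← fderiv_fderiv_apply (hf.mul hg)]
  have h1 : (fun y => fderiv ℝ (fun y => f y * g y) y v) =ᶠ[𝓝 z]
      fun y => f y * fderiv ℝ g y v + g y * fderiv ℝ f y v := by
    filter_upwards [eventually_differentiableAt hf, eventually_differentiableAt hg] with y h1 h2
    rw [fderiv_fun_mul h1 h2]
    simp
  have hfd := contDiffAt_differentiableAt hf
  have hgd := contDiffAt_differentiableAt hg
  have hf1 : DifferentiableAt ℝ (fun y => fderiv ℝ f y v) z :=
    (contDiffAt_differentiableAt (contDiffAt_fderiv hf)).clm_apply (differentiableAt_const v)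
  have hg1 : DifferentiableAt ℝ (fun y => fderiv ℝ g y v) z :=
    (contDiffAt_differentiableAt (contDiffAt_fderiv hg)).clm_apply (differentiableAt_const v)
  rw [h1.fderiv_eq, fderiv_fun_add (hfd.fun_mul hg1) (hgd.fun_mul hf1), fderiv_fun_mul hfd hg1,
    fderiv_fun_mul hgd hf1]
  simp only [add_apply, smul_apply, smul_eq_mul,
    fderiv_fderiv_apply hf, fderiv_fderiv_apply hg]
  ring

/-- A quadratic function with prescribed `2`-jet. -/
noncomputable def quad (z : E) (c : F) (Q : E →L[ℝ] F) (σ : E →L[ℝ] E →L[ℝ] F) (y : E) : F :=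
  c + Q (y - z) + σ (y - z) (y - z)

variable (z : E) (c : F) (Q : E →L[ℝ] F) (σ : E →L[ℝ] E →L[ℝ] F)

theorem quad_self : quad z c Q σ z = c := by simp [quad]

theorem contDiff_quad : ContDiff ℝ ∞ (quad z c Q σ) := by
  unfold quad
  fun_prop

theorem fderiv_quad (y : E) : fderiv ℝ (quad z c Q σ) y = Q + σ (y - z) + σ.flip (y - z) := by
  have h0 : HasFDerivAt (fun y : E => y - z) (ContinuousLinearMap.id ℝ E) y :=
    (hasFDerivAt_id y).sub_const z
  have h1 := ((Q.hasFDerivAt (x := y - z)).comp y h0).const_add c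
  have h2 := ((σ.hasFDerivAt (x := y - z)).comp y h0).clm_apply h0
  have h3 := h1.add h2
  have : quad z c Q σ = ((fun y => c + (⇑Q ∘ fun y => y - z) y)
      + fun y => (⇑σ ∘ fun y => y - z) y (y - z)) := by
    ext y; simp [quad]
  rw [this]
  rw [h3.fderiv]
  ext v
  simp [add_assoc]

theorem fderiv_quad_self : fderiv ℝ (quad z c Q σ) z = Q := by simp [fderiv_quad]

theorem D2_quad (y u v : E) : D2 (quad z c Q σ) y u v = σ u v + σ v u := by
  have h : fderiv ℝ (quad z c Q σ) = quad z Q (σ + σ.flip) 0 := by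
    ext y v
    rw [fderiv_quad]; simp [quad, add_assoc]
  rw [D2, h, fderiv_quad]
  simp

end SecondDerivative

/-- The basis vector in the direction of `t`. -/
def tb : BaseSpace := (1, 0)

/-- The basis vector in the direction of `x_a`. -/
def eb (a : Fin 2) : BaseSpace := (0, Pi.single a 1)

theorem baseSpace_decomp (u : BaseSpace) : u = u.1 • tb + u.2 0 • eb 0 + u.2 1 • eb 1 := by
  ext a
  · simp [tb, eb]
  · fin_cases a <;> simp [tb, eb]

theorem lhs_eq (V : Potential) {f : BaseSpace → ℂ} {z : BaseSpace} (hf : ContDiffAt ℝ ∞ f z) :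
    lhs V f z = I * fderiv ℝ f z tb + (D2 f z (eb 0) (eb 0) + D2 f z (eb 1) (eb 1))
      + ((‖f z‖ ^ 2 : ℝ) : ℂ) * f z + V.toFun z * f z := by
  have h : ∀ a, dx a (dx a f) z = D2 f z (eb a) (eb a) := fun a =>
    fderiv_fderiv_apply hf (eb a) (eb a)
  simp [lhs, dt, h, tb, Fin.sum_univ_two]

/-- Every surjective linear map `E × F → E` restricts to an injective map on the graph of some
linear map `E → F`. -/
theorem exists_graph_injective {E F : Type*} [NormedAddCommGroup E] [NormedSpace ℝ E]
    [FiniteDimensional ℝ E] [NormedAddCommGroup F] [NormedSpace ℝ F]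
    (L : E × F →L[ℝ] E) (hL : Function.Surjective L) :
    ∃ Q : E →L[ℝ] F, Function.Injective (fun u => L (u, Q u)) := by
  set A : E →ₗ[ℝ] E := (L.comp (ContinuousLinearMap.inl ℝ E F)).toLinearMap with hA
  set B : F →ₗ[ℝ] E := (L.comp (ContinuousLinearMap.inr ℝ E F)).toLinearMap with hB
  have hLAB : ∀ u h, L (u, h) = A u + B h := by
    intro u h
    rw [hA, hB]
    simp only [ContinuousLinearMap.coe_coe, ContinuousLinearMap.comp_apply,
      ContinuousLinearMap.inl_apply, ContinuousLinearMap.inr_apply, ← map_add]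
    simp
  obtain ⟨N', hN'⟩ := (LinearMap.ker A).exists_isCompl
  let R := LinearMap.range A
  have hsurj : Function.Surjective (R.mkQ ∘ₗ B) := by
    intro y
    obtain ⟨y, rfl⟩ := R.mkQ_surjective y
    obtain ⟨⟨u, h⟩, huh⟩ := hL y
    refine ⟨h, ?_⟩
    rw [LinearMap.comp_apply, ← huh, hLAB, map_add]
    have : R.mkQ (A u) = 0 := by
      rw [Submodule.mkQ_apply, Submodule.Quotient.mk_eq_zero]; exact ⟨u, rfl⟩
    rw [this, zero_add]
  obtain ⟨S, hS⟩ := (R.mkQ ∘ₗ B).exists_rightInverse_of_surjective (LinearMap.range_eq_top.2 hsurj)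
  have hdim : Module.finrank ℝ (LinearMap.ker A) = Module.finrank ℝ (E ⧸ R) := by
    have h1 := LinearMap.finrank_range_add_finrank_ker A
    have h2 := R.finrank_quotient_add_finrank
    simp only [R] at h2 ⊢
    omega
  let j := LinearEquiv.ofFinrankEq _ _ hdim
  let P := (LinearMap.ker A).projectionOnto N' hN'
  let Q : E →ₗ[ℝ] F := S ∘ₗ j.toLinearMap ∘ₗ P
  refine ⟨LinearMap.toContinuousLinearMap Q, ?_⟩
  have : Function.Injective (A + B ∘ₗ Q) := by
    rw [← LinearMap.ker_eq_bot, LinearMap.ker_eq_bot']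
    intro u hu
    have h1 : R.mkQ (B (Q u)) = 0 := by
      have : B (Q u) = A (-u) := by
        rw [map_neg, eq_neg_iff_add_eq_zero, add_comm]; exact hu
      rw [this, Submodule.mkQ_apply, Submodule.Quotient.mk_eq_zero]; exact ⟨_, rfl⟩
    have h2 : j (P u) = 0 := by
      have := LinearMap.congr_fun hS (j (P u))
      simp only [LinearMap.comp_apply, LinearMap.id_apply] at this
      rw [← this]; exact h1
    have h3 : P u = 0 := by simpa using h2
    have h4 : A u = 0 := by
      have : Q u = 0 := by simp [Q, h3]
      simpa [this] using hu
    have h5 : P u = ⟨u, h4⟩ := Submodule.projectionOnto_apply_left hN' ⟨u, h4⟩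
    rw [h3] at h5
    exact (congrArg Subtype.val h5).symm
  intro u v huv
  apply this
  simpa [hLAB] using huv

/-- The inverse function theorem in the form used here. -/
theorem exists_smooth_inverse {E : Type*} [NormedAddCommGroup E] [NormedSpace ℝ E]
    [FiniteDimensional ℝ E] {A : E → E} {z : E} (hA : ContDiffAt ℝ ∞ A z)
    (hinj : Function.Injective (fderiv ℝ A z)) :
    ∃ n : E → E, ContDiffAt ℝ ∞ n (A z) ∧ n (A z) = z ∧ (∀ᶠ w in 𝓝 (A z), A (n w) = w) ∧
      ∀ᶠ y in 𝓝 z, n (A y) = y := by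
  have : CompleteSpace E := FiniteDimensional.complete ℝ E
  let L : E ≃L[ℝ] E :=
    (LinearEquiv.ofInjectiveEndo (fderiv ℝ A z).toLinearMap hinj).toContinuousLinearEquiv
  have hL : HasFDerivAt A (L : E →L[ℝ] E) z := by
    convert (contDiffAt_differentiableAt hA).hasFDerivAt using 1
    exact ContinuousLinearMap.ext fun u => rfl
  let e := hA.toOpenPartialHomeomorph A hL (by norm_num)
  have hz : z ∈ e.source := hA.mem_toOpenPartialHomeomorph_source hL (by norm_num)
  have hcoe : ∀ y, e y = A y := fun _ => rfl
  refine ⟨e.symm, ?_, e.left_inv hz, ?_, ?_⟩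
  · exact hA.to_localInverse hL (by norm_num)
  · exact e.eventually_right_inverse' hz
  · exact e.eventually_left_inverse hz

theorem contDiffAt_graph {E F : Type*} [NormedAddCommGroup E] [NormedSpace ℝ E]
    [NormedAddCommGroup F] [NormedSpace ℝ F] {f : E → F} {z : E} (hf : ContDiffAt ℝ ∞ f z) :
    ContDiffAt ℝ ∞ (fun y => (y, f y)) z := contDiffAt_id.prodMk hf

theorem hasFDerivAt_graph {E F : Type*} [NormedAddCommGroup E] [NormedSpace ℝ E]
    [NormedAddCommGroup F] [NormedSpace ℝ F] {f : E → F} {z : E} (hf : DifferentiableAt ℝ f z) :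
    HasFDerivAt (fun y => (y, f y)) ((ContinuousLinearMap.id ℝ E).prod (fderiv ℝ f z)) z :=
  (hasFDerivAt_id z).prodMk hf.hasFDerivAt

theorem D2_graph {E F : Type*} [NormedAddCommGroup E] [NormedSpace ℝ E] [NormedAddCommGroup F]
    [NormedSpace ℝ F] {f : E → F} {z : E} (hf : ContDiffAt ℝ ∞ f z) (u v : E) :
    D2 (fun y => (y, f y)) z u v = (0, D2 f z u v) := by
  rw [← fderiv_fderiv_apply (contDiffAt_graph hf)]
  have h1 : (fun y => fderiv ℝ (fun y => (y, f y)) y v) =ᶠ[𝓝 z] fun y => (v, fderiv ℝ f y v) := by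
    filter_upwards [eventually_differentiableAt hf] with y h
    rw [(hasFDerivAt_graph h).fderiv]
    rfl
  have h2 : HasFDerivAt (fun y => fderiv ℝ f y v) (fderiv ℝ (fun y => fderiv ℝ f y v) z) z :=
    ((contDiffAt_differentiableAt (contDiffAt_fderiv hf)).clm_apply
      (differentiableAt_const v)).hasFDerivAt
  rw [h1.fderiv_eq, ((hasFDerivAt_const v z).prodMk h2).fderiv, ← fderiv_fderiv_apply hf]
  rfl

theorem fderiv_graph {E F : Type*} [NormedAddCommGroup E] [NormedSpace ℝ E] [NormedAddCommGroup F]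
    [NormedSpace ℝ F] {f : E → F} {z : E} (hf : ContDiffAt ℝ ∞ f z) (u : E) :
    fderiv ℝ (fun y => (y, f y)) z u = (u, fderiv ℝ f z u) := by
  rw [(hasFDerivAt_graph (contDiffAt_differentiableAt hf)).fderiv]
  rfl

theorem IsPointTransformation.contDiffAt {E : Type} [NormedAddCommGroup E] [NormedSpace ℝ E]
    {e : OpenPartialHomeomorph E E} (he : IsPointTransformation e) {p : E} (hp : p ∈ e.source) :
    ContDiffAt ℝ ∞ e p := he.1.contDiffAt (e.open_source.mem_nhds hp)

theorem IsPointTransformation.symm {E : Type} [NormedAddCommGroup E] [NormedSpace ℝ E]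
    {e : OpenPartialHomeomorph E E} (he : IsPointTransformation e) :
    IsPointTransformation e.symm := ⟨he.2, he.1⟩

theorem IsPointTransformation.leftInverse {E : Type} [NormedAddCommGroup E] [NormedSpace ℝ E]
    {e : OpenPartialHomeomorph E E} (he : IsPointTransformation e) {p : E} (hp : p ∈ e.source)
    (u : E) : fderiv ℝ e.symm (e p) (fderiv ℝ e p u) = u := by
  rw [← fderiv_comp_at (he.symm.contDiffAt (e.map_source hp)) (he.contDiffAt hp)]
  have : (fun y => e.symm (e y)) =ᶠ[𝓝 p] id := e.eventually_left_inverse hp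
  rw [this.fderiv_eq, fderiv_id]
  rfl

theorem IsPointTransformation.injective {E : Type} [NormedAddCommGroup E] [NormedSpace ℝ E]
    {e : OpenPartialHomeomorph E E} (he : IsPointTransformation e) {p : E} (hp : p ∈ e.source) :
    Function.Injective (fderiv ℝ e p) := fun u v h => by
  rw [← he.leftInverse hp u, h, he.leftInverse hp v]

theorem IsPointTransformation.surjective {E : Type} [NormedAddCommGroup E] [NormedSpace ℝ E]
    {e : OpenPartialHomeomorph E E} (he : IsPointTransformation e) {p : E} (hp : p ∈ e.source) :
    Function.Surjective (fderiv ℝ e p) := fun u => by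
  have h := he.symm.leftInverse (e.map_source hp) u
  rw [OpenPartialHomeomorph.symm_symm, e.left_inv hp] at h
  exact ⟨_, h⟩

/-- The image of a graph under a point transformation is locally a graph if it is transversal to
the fibres. -/
theorem exists_image {e : OpenPartialHomeomorph VarSpace VarSpace} (he : IsPointTransformation e)
    {f : BaseSpace → ℂ} {z : BaseSpace} (hf : ContDiffAt ℝ ∞ f z) (hp : (z, f z) ∈ e.source)
    (hinj : Function.Injective fun u => (fderiv ℝ e (z, f z) (u, fderiv ℝ f z u)).1) :
    ∃ (g : BaseSpace → ℂ) (n : BaseSpace → BaseSpace), ContDiffAt ℝ ∞ g (e (z, f z)).1 ∧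
      MapsGraph e f g z (e (z, f z)).1 ∧
      ContinuousAt n (e (z, f z)).1 ∧ n (e (z, f z)).1 = z ∧
      (∀ᶠ w in 𝓝 (e (z, f z)).1, e (n w, f (n w)) = (w, g w)) ∧
      ∀ᶠ y in 𝓝 z, n (e (y, f y)).1 = y := by
  have hF : ContDiffAt ℝ ∞ (fun y => e (y, f y)) z :=
    ContDiffAt.comp (g := e) (f := fun y => (y, f y)) z (he.contDiffAt hp)
      (contDiffAt_graph hf)
  have hA : ContDiffAt ℝ ∞ (fun y => (e (y, f y)).1) z := hF.fst
  have hd : ∀ u, fderiv ℝ (fun y => (e (y, f y)).1) z u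
      = (fderiv ℝ e (z, f z) (u, fderiv ℝ f z u)).1 := by
    intro u
    have := (contDiffAt_differentiableAt hF).hasFDerivAt.fst
    rw [this.fderiv]
    have h2 := fderiv_comp_at (g := e) (c := fun y => (y, f y)) (he.contDiffAt hp)
      (contDiffAt_graph hf) u
    rw [fderiv_graph hf] at h2
    simp [h2]
  obtain ⟨n, hn, hnz, hr, hl⟩ := exists_smooth_inverse hA (by
    intro u v huv
    rw [hd, hd] at huv
    exact hinj huv)
  have hg : ∀ y, n (e (y, f y)).1 = y → (e (n (e (y, f y)).1, f (n (e (y, f y)).1))).2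
      = (e (y, f y)).2 := fun y hy => by rw [hy]
  refine ⟨fun w => (e (n w, f (n w))).2, n, ?_, ⟨hp, ?_, ?_⟩, hn.continuousAt, hnz, ?_, hl⟩
  · refine ContDiffAt.comp (g := fun y => (e (y, f y)).2) _ ?_ hn
    rw [hnz]
    exact hF.snd
  · ext1
    · rfl
    · exact (hg z hnz).symm
  · exact hl.mono fun y hy => (hg y hy).symm
  · exact hr.mono fun w hw => by
      ext1
      · exact hw
      · rfl

theorem MapsGraph.fderiv_eq {e : OpenPartialHomeomorph VarSpace VarSpace}
    (he : IsPointTransformation e) {f g : BaseSpace → ℂ} {z w : BaseSpace}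
    (hf : ContDiffAt ℝ ∞ f z) (hg : ContDiffAt ℝ ∞ g w) (h : MapsGraph e f g z w) (u : BaseSpace) :
    (fderiv ℝ e (z, f z) (u, fderiv ℝ f z u)).2
      = fderiv ℝ g w (fderiv ℝ e (z, f z) (u, fderiv ℝ f z u)).1 := by
  obtain ⟨hp, hw, hev⟩ := h
  have hF0 : ContDiffAt ℝ ∞ (fun y => (y, f y)) z := contDiffAt_graph hf
  have hF : ContDiffAt ℝ ∞ (fun y => e (y, f y)) z :=
    ContDiffAt.comp (g := e) (f := fun y => (y, f y)) z (he.contDiffAt hp) hF0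
  have h2 := fderiv_comp_at (g := e) (c := fun y => (y, f y)) (he.contDiffAt hp) hF0 u
  rw [fderiv_graph hf] at h2
  have hd := (contDiffAt_differentiableAt hF).hasFDerivAt
  have hgw : ContDiffAt ℝ ∞ g (e (z, f z)).1 := by rw [hw]; exact hg
  have h3 := fderiv_comp_at (g := g) (c := fun y => (e (y, f y)).1) hgw hF.fst u
  have h4 : (fun y => (e (y, f y)).2) =ᶠ[𝓝 z] fun y => g (e (y, f y)).1 := hev
  rw [← h4.fderiv_eq, hd.snd.fderiv, hd.fst.fderiv] at h3
  rw [← h2]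
  simpa [hw] using h3

/-- The spatial principal part is preserved: trace-free quadratic forms on the space of the new
independent variables pull back to trace-free forms. -/
theorem traceFree_pullback {V V' : Potential} {e : OpenPartialHomeomorph VarSpace VarSpace}
    (he : e ∈ admissible V V') {z : BaseSpace} {ψ : ℂ} (hp : (z, ψ) ∈ e.source)
    (Q : BaseSpace →L[ℝ] ℂ)
    (hinj : Function.Injective fun u => (fderiv ℝ e (z, ψ) (u, Q u)).1)
    (τ : BaseSpace →L[ℝ] BaseSpace →L[ℝ] ℝ)
    (hτ : τ (eb 0) (eb 0) + τ (eb 1) (eb 1) = 0) :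
    τ (fderiv ℝ e (z, ψ) (eb 0, Q (eb 0))).1 (fderiv ℝ e (z, ψ) (eb 0, Q (eb 0))).1
      + τ (fderiv ℝ e (z, ψ) (eb 1, Q (eb 1))).1 (fderiv ℝ e (z, ψ) (eb 1, Q (eb 1))).1 = 0 := by
  obtain ⟨hpt, -, hadm⟩ := he
  have hesm := hpt.contDiffAt hp
  set L := fderiv ℝ e (z, ψ) with hL
  set M : BaseSpace →L[ℝ] BaseSpace :=
    ((ContinuousLinearMap.fst ℝ BaseSpace ℂ).comp L).comp
      ((ContinuousLinearMap.id ℝ BaseSpace).prod Q) with hM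
  have hMapp : ∀ u, (L (u, Q u)).1 = M u := fun u => rfl
  simp only [hMapp] at hinj ⊢
  have hsurj : Function.Surjective M := LinearMap.injective_iff_surjective.1 hinj
  set c0 : ℂ := -(I * Q tb + ((‖ψ‖ ^ 2 : ℝ) : ℂ) * ψ + V.toFun z * ψ) / 2 with hc0
  let pr : BaseSpace →L[ℝ] ℝ :=
    (ContinuousLinearMap.proj (R := ℝ) (0 : Fin 2)).comp (ContinuousLinearMap.snd ℝ ℝ (Fin 2 → ℝ))
  let σ0 : BaseSpace →L[ℝ] BaseSpace →L[ℝ] ℂ := pr.smulRight (pr.smulRight c0)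
  have hσ00 : σ0 (eb 0) (eb 0) = c0 := by simp [σ0, pr, eb]
  have hσ01 : σ0 (eb 1) (eb 1) = 0 := by simp [σ0, pr, eb]
  have hbase : ∀ σ : BaseSpace →L[ℝ] BaseSpace →L[ℝ] ℂ,
      lhs V (quad z ψ Q (σ0 + σ)) z = 2 * (σ (eb 0) (eb 0) + σ (eb 1) (eb 1)) := by
    intro σ
    rw [lhs_eq V (contDiff_quad _ _ _ _).contDiffAt, fderiv_quad_self, D2_quad, D2_quad, quad_self]
    simp only [add_apply, hσ00, hσ01, hc0]
    ring
  have himg : ∀ σ : BaseSpace →L[ℝ] BaseSpace →L[ℝ] ℂ, ∃ g : BaseSpace → ℂ,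
      ContDiffAt ℝ ∞ g (e (z, ψ)).1 ∧ MapsGraph e (quad z ψ Q σ) g z (e (z, ψ)).1 := by
    intro σ
    have h := exists_image hpt (f := quad z ψ Q σ) (z := z) (contDiff_quad _ _ _ _).contDiffAt
      (by rwa [quad_self]) (by rw [quad_self, fderiv_quad_self]; exact hinj)
    rw [quad_self] at h
    obtain ⟨g, _, h1, h2, _⟩ := h
    exact ⟨g, h1, h2⟩
  set w := (e (z, ψ)).1 with hw
  obtain ⟨g0, hg0, hm0⟩ := himg (σ0 + 0)
  let H : VarSpace → ℂ := fun p => (e p).2 - g0 (e p).1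
  have hHsm : ContDiffAt ℝ ∞ H (z, ψ) :=
    hesm.snd.sub (ContDiffAt.comp (g := g0) (f := fun p => (e p).1) _ hg0 hesm.fst)
  have hHd : ∀ v, fderiv ℝ H (z, ψ) v = (L v).2 - fderiv ℝ g0 w (L v).1 := by
    intro v
    have hd := (contDiffAt_differentiableAt hesm).hasFDerivAt
    have h1 := hd.snd.sub ((contDiffAt_differentiableAt hg0).hasFDerivAt.comp (z, ψ) hd.fst)
    have h2 : HasFDerivAt H _ (z, ψ) := h1
    rw [h2.fderiv]
    rfl
  have hHQ : ∀ u, fderiv ℝ H (z, ψ) (u, Q u) = 0 := by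
    intro u
    have := hm0.fderiv_eq hpt (contDiff_quad _ _ _ _).contDiffAt hg0 u
    rw [quad_self, fderiv_quad_self] at this
    rw [hHd, sub_eq_zero]
    exact this
  let K : ℂ →L[ℝ] ℂ := (fderiv ℝ H (z, ψ)).comp (ContinuousLinearMap.inr ℝ BaseSpace ℂ)
  have hK : ∀ h, fderiv ℝ H (z, ψ) (0, h) = K h := fun h => rfl
  have hKinj : Function.Injective K.toLinearMap := by
    rw [← LinearMap.ker_eq_bot, LinearMap.ker_eq_bot']
    intro h hh
    have hh : fderiv ℝ H (z, ψ) (0, h) = 0 := hh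
    obtain ⟨u, hu⟩ := hsurj (L (0, h)).1
    have h1 := hHQ u
    rw [hHd, sub_eq_zero] at h1 hh
    have h2 : L (u, Q u) = L (0, h) := by
      ext1
      · rw [hMapp, hu]
      · rw [h1, hh, hMapp, hu]
    have h3 := hpt.injective hp h2
    have h4 : u = 0 := congrArg Prod.fst h3
    have h5 : Q u = h := congrArg Prod.snd h3
    rw [← h5, h4, map_zero]
  obtain ⟨k0, hk0⟩ := LinearMap.injective_iff_surjective.1 hKinj 1
  have hk0 : K k0 = 1 := hk0
  let σ : BaseSpace →L[ℝ] BaseSpace →L[ℝ] ℂ :=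
    (ContinuousLinearMap.compL ℝ BaseSpace ℝ ℂ
      ((ContinuousLinearMap.id ℝ ℝ).smulRight k0)).comp (τ.bilinearComp M M)
  have hσ : ∀ u v, σ u v = τ (M u) (M v) • k0 := fun u v => rfl
  obtain ⟨g1, hg1, hm1⟩ := himg (σ0 + σ)
  have hδ : ∀ σ' : BaseSpace →L[ℝ] BaseSpace →L[ℝ] ℂ, ∀ g : BaseSpace → ℂ, ContDiffAt ℝ ∞ g w →
      MapsGraph e (quad z ψ Q (σ0 + σ')) g z w →
      (fderiv ℝ g w = fderiv ℝ g0 w) ∧ ∀ u, D2 g w (M u) (M u) - D2 g0 w (M u) (M u)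
        = D2 H (z, ψ) (u, Q u) (u, Q u) + 2 * K ((σ0 + σ') u u) := by
    intro σ' g hg hm
    have hfs : ContDiffAt ℝ ∞ (quad z ψ Q (σ0 + σ')) z := (contDiff_quad _ _ _ _).contDiffAt
    have hGs : ContDiffAt ℝ ∞ (fun y => (y, quad z ψ Q (σ0 + σ') y)) z := contDiffAt_graph hfs
    have hfz : quad z ψ Q (σ0 + σ') z = ψ := quad_self _ _ _ _
    have h1 : fderiv ℝ g w = fderiv ℝ g0 w := by
      refine ContinuousLinearMap.ext fun v => ?_
      obtain ⟨u, rfl⟩ := hsurj v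
      have h2 := hm.fderiv_eq hpt hfs hg u
      rw [hfz, fderiv_quad_self] at h2
      have h3 := hHQ u
      rw [hHd, sub_eq_zero] at h3
      rw [← hMapp, ← h2, ← h3]
    refine ⟨h1, fun u => ?_⟩
    have hes : ContDiffAt ℝ ∞ e (z, quad z ψ Q (σ0 + σ') z) := by rw [hfz]; exact hesm
    have hHs : ContDiffAt ℝ ∞ H (z, quad z ψ Q (σ0 + σ') z) := by rw [hfz]; exact hHsm
    have hF : ContDiffAt ℝ ∞ (fun y => e (y, quad z ψ Q (σ0 + σ') y)) z :=
      ContDiffAt.comp (g := e) (f := fun y => (y, quad z ψ Q (σ0 + σ') y)) z hes hGs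
    have hδs : ContDiffAt ℝ ∞ (fun y => g y - g0 y) (e (z, quad z ψ Q (σ0 + σ') z)).1 := by
      rw [hfz]; exact hg.sub hg0
    have hev : (fun y => (fun y => g y - g0 y) (e (y, quad z ψ Q (σ0 + σ') y)).1) =ᶠ[𝓝 z]
        fun y => H (y, quad z ψ Q (σ0 + σ') y) :=
      hm.2.2.mono fun y hy => by simp only [H]; rw [hy]
    have h2 := D2_comp (g := fun y => g y - g0 y) (c := fun y => (e (y, quad z ψ Q (σ0 + σ') y)).1)
      hδs hF.fst u u
    have h3 := D2_comp (g := H) (c := fun y => (y, quad z ψ Q (σ0 + σ') y)) hHs hGs u u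
    rw [D2_congr hev, h3, D2_graph hfs, fderiv_graph hfs, fderiv_quad_self, D2_quad, hfz, ← hw,
      D2_sub hg hg0, fderiv_fun_sub (contDiffAt_differentiableAt hg)
        (contDiffAt_differentiableAt hg0), h1, hK] at h2
    have h4 : fderiv ℝ (fun y => (e (y, quad z ψ Q (σ0 + σ') y)).1) z u = M u := by
      rw [(contDiffAt_differentiableAt hF).hasFDerivAt.fst.fderiv]
      have h5 := fderiv_comp_at (g := e) (c := fun y => (y, quad z ψ Q (σ0 + σ') y)) hes hGs u
      rw [fderiv_graph hfs, fderiv_quad_self, hfz] at h5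
      rw [← hMapp, ← h5]
      rfl
    rw [h4] at h2
    simp only [sub_self, zero_apply, add_zero, sub_apply, map_add] at h2 ⊢
    rw [← h2]
    ring
  obtain ⟨-, hD0⟩ := hδ 0 g0 hg0 hm0
  obtain ⟨hD1, hD2⟩ := hδ σ g1 hg1 hm1
  have hD : ∀ v, D2 g1 w v v - D2 g0 w v v = ((2 * τ v v : ℝ) : ℂ) := by
    intro v
    obtain ⟨u, rfl⟩ := hsurj v
    have h1 := hD0 u
    have h0 : (σ0 + 0) u u = σ0 u u := by simp
    rw [sub_self, h0] at h1
    have h2 := hD2 u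
    rw [add_apply, add_apply, map_add, mul_add, ← add_assoc, ← h1, zero_add, hσ, map_smul, hk0]
      at h2
    rw [h2]
    simp
  have hz0 : lhs V' g0 w = 0 := (hadm _ _ _ _ (contDiff_quad _ _ _ _).contDiffAt hg0 hm0).1 (by
    rw [hbase]; simp)
  have hval : g1 w = g0 w := by
    have h1 := hm0.2.1
    have h2 := hm1.2.1
    rw [quad_self] at h1 h2
    have := h2.symm.trans h1
    exact congrArg Prod.snd this
  have hz1 : lhs V' g1 w = 0 := by
    rw [lhs_eq V' hg1, hval, hD1]
    rw [lhs_eq V' hg0] at hz0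
    have h1 := hD (eb 0)
    have h2 := hD (eb 1)
    have h3 : ((2 * τ (eb 0) (eb 0) : ℝ) : ℂ) + ((2 * τ (eb 1) (eb 1) : ℝ) : ℂ) = 0 := by
      rw [← Complex.ofReal_add, ← mul_add, hτ]; simp
    linear_combination hz0 + h1 + h2 + h3
  have hz2 := (hadm _ _ _ _ (contDiff_quad _ _ _ _).contDiffAt hg1 hm1).2 hz1
  rw [hbase, hσ, hσ, ← add_smul] at hz2
  have hk : k0 ≠ 0 := by
    rintro rfl
    rw [map_zero] at hk0
    exact zero_ne_one hk0
  have h3 : ((τ (M (eb 0)) (M (eb 0)) + τ (M (eb 1)) (M (eb 1)) : ℝ) : ℂ) = 0 := by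
    simpa [hk] using hz2
  exact_mod_cast h3

/-- The three relations contained in `traceFree_pullback`. -/
theorem conformal_relations {V V' : Potential} {e : OpenPartialHomeomorph VarSpace VarSpace}
    (he : e ∈ admissible V V') {z : BaseSpace} {ψ : ℂ} (hp : (z, ψ) ∈ e.source)
    (Q : BaseSpace →L[ℝ] ℂ)
    (hinj : Function.Injective fun u => (fderiv ℝ e (z, ψ) (u, Q u)).1)
    (y : Fin 2 → BaseSpace) (hy : ∀ a, y a = (fderiv ℝ e (z, ψ) (eb a, Q (eb a))).1) :
    (y 0).1 = 0 ∧ (y 1).1 = 0 ∧ (y 0).2 0 * (y 0).2 1 + (y 1).2 0 * (y 1).2 1 = 0 ∧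
      (y 0).2 0 ^ 2 + (y 1).2 0 ^ 2 = (y 0).2 1 ^ 2 + (y 1).2 1 ^ 2 := by
  let pt : BaseSpace →L[ℝ] ℝ := ContinuousLinearMap.fst ℝ ℝ (Fin 2 → ℝ)
  let pr (b : Fin 2) : BaseSpace →L[ℝ] ℝ :=
    (ContinuousLinearMap.proj (R := ℝ) b).comp (ContinuousLinearMap.snd ℝ ℝ (Fin 2 → ℝ))
  have h1 := traceFree_pullback he hp Q hinj (pt.smulRight pt) (by simp [pt, eb])
  have h2 := traceFree_pullback he hp Q hinj ((pr 0).smulRight (pr 1)) (by simp [pr, eb])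
  have h3 := traceFree_pullback he hp Q hinj
    ((pr 0).smulRight (pr 0) - (pr 1).smulRight (pr 1)) (by simp [pr, eb])
  rw [← hy, ← hy] at h1 h2 h3
  simp only [pt, pr, ContinuousLinearMap.smulRight_apply, ContinuousLinearMap.coe_fst', smul_apply,
    smul_eq_mul, sub_apply, ContinuousLinearMap.comp_apply, ContinuousLinearMap.coe_snd',
    ContinuousLinearMap.proj_apply] at h1 h2 h3
  refine ⟨?_, ?_, h2, by linear_combination h3⟩
  · nlinarith [mul_self_nonneg (y 0).1, mul_self_nonneg (y 1).1]
  · nlinarith [mul_self_nonneg (y 0).1, mul_self_nonneg (y 1).1]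

/-- Admissible transformations preserve the fibration over the base, the foliation by the levels of
`t`, and the spatial conformal structure, infinitesimally at each point. -/
theorem fibre_preserving {V V' : Potential} {e : OpenPartialHomeomorph VarSpace VarSpace}
    (he : e ∈ admissible V V') {p : VarSpace} (hp : p ∈ e.source) :
    (∀ h, (fderiv ℝ e p (0, h)).1 = 0) ∧
      Function.Injective (fun u : BaseSpace => (fderiv ℝ e p (u, 0)).1) ∧
      ∀ y : Fin 2 → BaseSpace, (∀ a, y a = (fderiv ℝ e p (eb a, 0)).1) →
        (y 0).1 = 0 ∧ (y 1).1 = 0 ∧ (y 0).2 0 * (y 0).2 1 + (y 1).2 0 * (y 1).2 1 = 0 ∧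
          (y 0).2 0 ^ 2 + (y 1).2 0 ^ 2 = (y 0).2 1 ^ 2 + (y 1).2 1 ^ 2 := by
  obtain ⟨z, ψ⟩ := p
  have hrel := conformal_relations he hp
  have hLs := he.1.surjective hp
  set L := fderiv ℝ e (z, ψ) with hL
  let Lb : VarSpace →L[ℝ] BaseSpace := (ContinuousLinearMap.fst ℝ BaseSpace ℂ).comp L
  have hLb : ∀ v, (L v).1 = Lb v := fun _ => rfl
  simp only [hLb] at hrel ⊢
  obtain ⟨Q0, hQ0⟩ := exists_graph_injective Lb (by
    intro v
    obtain ⟨u, hu⟩ := hLs (v, 0)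
    exact ⟨u, by rw [← hLb, hu]⟩)
  have hsplit : ∀ (Q : BaseSpace →L[ℝ] ℂ) (u : BaseSpace) (h : ℂ),
      Lb (u, h) = Lb (u, 0) + Lb (0, h) := by
    intro Q u h
    rw [← map_add]; simp
  have hpert : ∀ R : BaseSpace →L[ℝ] ℂ, ∃ s : ℝ, 0 < s ∧
      Function.Injective (fun u => Lb (u, (Q0 + s • R) u)) ∧
      Function.Injective (fun u => Lb (u, (Q0 + (-s) • R) u)) := by
    intro R
    let m : ℝ → BaseSpace →L[ℝ] BaseSpace := fun s =>
      Lb.comp ((ContinuousLinearMap.id ℝ BaseSpace).prod (Q0 + s • R))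
    have hm : Continuous m := by
      have h1 : m = fun s : ℝ => Lb.comp ((ContinuousLinearMap.id ℝ BaseSpace).prod Q0)
          + s • Lb.comp ((0 : BaseSpace →L[ℝ] BaseSpace).prod R) := by
        funext s
        refine ContinuousLinearMap.ext fun u => ?_
        simp only [m, ContinuousLinearMap.comp_apply, add_apply, smul_apply, ← map_smul, ← map_add]
        simp
      rw [h1]
      fun_prop
    have hopen := (ContinuousLinearMap.isOpen_injective (𝕜 := ℝ) (E := BaseSpace)
      (F := BaseSpace)).preimage hm
    have h0 : (0 : ℝ) ∈ m ⁻¹' {L | Function.Injective L} := by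
      have : m 0 = Lb.comp ((ContinuousLinearMap.id ℝ BaseSpace).prod Q0) :=
        ContinuousLinearMap.ext fun u => by simp [m]
      change Function.Injective (m 0)
      rw [this]
      exact hQ0
    obtain ⟨r, hr, hball⟩ := Metric.isOpen_iff.1 hopen 0 h0
    refine ⟨r / 2, by positivity, hball ?_, hball ?_⟩
    · rw [mem_ball_zero_iff, Real.norm_eq_abs, abs_of_pos (by positivity)]; linarith
    · rw [mem_ball_zero_iff, norm_neg, Real.norm_eq_abs, abs_of_pos (by positivity)]; linarith
  have hvert : ∀ h, Lb (0, h) = 0 := by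
    intro h
    let pr : BaseSpace →L[ℝ] ℝ :=
      (ContinuousLinearMap.proj (R := ℝ) 0).comp (ContinuousLinearMap.snd ℝ ℝ (Fin 2 → ℝ))
    obtain ⟨s, hs, hi1, hi2⟩ := hpert (pr.smulRight h)
    have hval : ∀ s : ℝ, Lb (eb 0, (Q0 + s • pr.smulRight h) (eb 0))
          = Lb (eb 0, Q0 (eb 0)) + s • Lb (0, h) ∧
        Lb (eb 1, (Q0 + s • pr.smulRight h) (eb 1)) = Lb (eb 1, Q0 (eb 1)) := by
      intro s
      constructor
      · rw [← map_smul, ← map_add]; simp [pr, eb]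
      · simp [pr, eb]
    obtain ⟨a1, -, a2, a3⟩ := hrel Q0 hQ0 (fun a => Lb (eb a, Q0 (eb a))) (fun a => rfl)
    obtain ⟨b1, -, b2, b3⟩ := hrel _ hi1 (fun a => Lb (eb a, (Q0 + s • pr.smulRight h) (eb a)))
      (fun a => rfl)
    obtain ⟨-, -, c2, c3⟩ := hrel _ hi2 (fun a => Lb (eb a, (Q0 + (-s) • pr.smulRight h) (eb a)))
      (fun a => rfl)
    simp only [(hval _).1, (hval _).2, Prod.fst_add, Prod.smul_fst, Prod.snd_add, Prod.smul_snd,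
      Pi.add_apply, Pi.smul_apply, smul_eq_mul] at a1 a2 a3 b1 b2 b3 c2 c3
    have hs2 : s ^ 2 ≠ 0 := by positivity
    have k1 : (Lb (0, h)).1 = 0 := by
      rw [a1, zero_add] at b1
      exact (mul_eq_zero.1 b1).resolve_left hs.ne'
    have k2 : (Lb (0, h)).2 0 * (Lb (0, h)).2 1 = 0 := by
      apply (mul_eq_zero.1 _).resolve_left hs2
      linear_combination (b2 + c2 - 2 * a2) / 2
    have k3 : (Lb (0, h)).2 0 ^ 2 = (Lb (0, h)).2 1 ^ 2 := by
      apply mul_left_cancel₀ hs2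
      linear_combination (b3 + c3 - 2 * a3) / 2
    have k4 : (Lb (0, h)).2 0 = 0 := by
      rcases mul_eq_zero.1 k2 with h0 | h0
      · exact h0
      · rw [h0] at k3; simpa using k3
    have k5 : (Lb (0, h)).2 1 = 0 := by
      rw [k4] at k3; simpa using k3.symm
    refine Prod.ext k1 (funext fun b => ?_)
    fin_cases b
    · exact k4
    · exact k5
  have hQ : ∀ u, Lb (u, 0) = Lb (u, Q0 u) := by
    intro u
    rw [hsplit Q0 u (Q0 u), hvert, add_zero]
  refine ⟨hvert, ?_, ?_⟩
  · simpa only [hQ] using hQ0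
  · intro y hy
    exact hrel Q0 hQ0 y fun a => by rw [hy, hQ]

/-- The conditions on the `2`-jet of a map `A` of the base under which the Schrödinger operator
pulls back to a Schrödinger operator; `m` is the square of the spatial scale factor, `k = m / T_t`,
and `C` collects the coefficients of the first-order spatial terms. -/
structure BaseJet (A : BaseSpace → BaseSpace) (z : BaseSpace) (m k : ℝ) (C : Fin 2 → ℂ) : Prop where
  smooth : ContDiffAt ℝ ∞ A z
  pos : 0 < m
  time : ∀ a, (fderiv ℝ A z (eb a)).1 = 0
  time2 : ∀ a, (D2 A z (eb a) (eb a)).1 = 0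
  time_deriv : k * (fderiv ℝ A z tb).1 = m
  row0 : (fderiv ℝ A z (eb 0)).2 0 ^ 2 + (fderiv ℝ A z (eb 1)).2 0 ^ 2 = m
  row1 : (fderiv ℝ A z (eb 0)).2 1 ^ 2 + (fderiv ℝ A z (eb 1)).2 1 ^ 2 = m
  row01 : (fderiv ℝ A z (eb 0)).2 0 * (fderiv ℝ A z (eb 0)).2 1
    + (fderiv ℝ A z (eb 1)).2 0 * (fderiv ℝ A z (eb 1)).2 1 = 0
  coeff : ∀ a, m * C a
    = I * k * (((fderiv ℝ A z tb).2 0 * (fderiv ℝ A z (eb a)).2 0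
        + (fderiv ℝ A z tb).2 1 * (fderiv ℝ A z (eb a)).2 1 : ℝ) : ℂ)
      + ((((D2 A z (eb 0) (eb 0)).2 0 + (D2 A z (eb 1) (eb 1)).2 0) * (fderiv ℝ A z (eb a)).2 0
        + ((D2 A z (eb 0) (eb 0)).2 1 + (D2 A z (eb 1) (eb 1)).2 1)
          * (fderiv ℝ A z (eb a)).2 1 : ℝ) : ℂ)

/-- The transformed Schrödinger operator in the old variables. -/
noncomputable def pulledOperator (V' : Potential) (w : BaseSpace) (m k : ℝ) (C : Fin 2 → ℂ)
    (D : BaseSpace → ℂ) (z : BaseSpace) : ℂ :=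
  D2 D z (eb 0) (eb 0) + D2 D z (eb 1) (eb 1) + I * k * fderiv ℝ D z tb
    - C 0 * fderiv ℝ D z (eb 0) - C 1 * fderiv ℝ D z (eb 1)
    + m * (((‖D z‖ ^ 2 : ℝ) : ℂ) * D z + V'.toFun w * D z)

theorem clm_decomp {F : Type*} [NormedAddCommGroup F] [NormedSpace ℝ F] (G : BaseSpace →L[ℝ] F)
    (u : BaseSpace) : G u = u.1 • G tb + u.2 0 • G (eb 0) + u.2 1 • G (eb 1) := by
  conv_lhs => rw [baseSpace_decomp u]
  simp only [map_add, map_smul]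

theorem lhs_pullback (V' : Potential) {A : BaseSpace → BaseSpace} {z : BaseSpace} {m k : ℝ}
    {C : Fin 2 → ℂ} (hA : BaseJet A z m k C) {g D : BaseSpace → ℂ}
    (hg : ContDiffAt ℝ ∞ g (A z)) (hD : ∀ᶠ y in 𝓝 z, D y = g (A y)) :
    m * lhs V' g (A z) = pulledOperator V' (A z) m k C D z := by
  have hD' : D =ᶠ[𝓝 z] fun y => g (A y) := hD
  have hd : ∀ u, fderiv ℝ D z u = fderiv ℝ g (A z) (fderiv ℝ A z u) := fun u => by
    rw [hD'.fderiv_eq, fderiv_comp_at hg hA.smooth]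
  have hd2 : ∀ u v, D2 D z u v = D2 g (A z) (fderiv ℝ A z u) (fderiv ℝ A z v)
      + fderiv ℝ g (A z) (D2 A z u v) := fun u v => by
    rw [D2_congr hD', D2_comp hg hA.smooth]
  have hsym := D2_symm hg (eb 1) (eb 0)
  obtain ⟨-, hm, ht, ht2, htd, r0, r1, r01, hC⟩ := hA
  have hC0 := hC 0
  have hC1 := hC 1
  rw [lhs_eq V' hg, pulledOperator, hD.self_of_nhds]
  simp only [hd, hd2]
  generalize fderiv ℝ g (A z) = G at *
  generalize D2 g (A z) = G2 at *
  have e2 : ∀ a, G2 (fderiv ℝ A z (eb a)) (fderiv ℝ A z (eb a))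
      = (((fderiv ℝ A z (eb a)).2 0 ^ 2 : ℝ) : ℂ) * G2 (eb 0) (eb 0)
        + ((2 * ((fderiv ℝ A z (eb a)).2 0 * (fderiv ℝ A z (eb a)).2 1) : ℝ) : ℂ) * G2 (eb 0) (eb 1)
        + (((fderiv ℝ A z (eb a)).2 1 ^ 2 : ℝ) : ℂ) * G2 (eb 1) (eb 1) := by
    intro a
    rw [clm_decomp G2 (fderiv ℝ A z (eb a)), ht a]
    simp only [add_apply, smul_apply, zero_smul, zero_add]
    rw [clm_decomp (G2 (eb 0)) (fderiv ℝ A z (eb a)), clm_decomp (G2 (eb 1)) (fderiv ℝ A z (eb a)),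
      ht a, hsym]
    simp only [zero_smul, zero_add, Complex.real_smul, ofReal_pow, ofReal_mul, ofReal_ofNat]
    ring
  have e1 : ∀ a, G (fderiv ℝ A z (eb a)) = ((fderiv ℝ A z (eb a)).2 0 : ℂ) * G (eb 0)
      + ((fderiv ℝ A z (eb a)).2 1 : ℂ) * G (eb 1) := by
    intro a
    rw [clm_decomp G, ht a]
    simp
  have e3 : ∀ a, G (D2 A z (eb a) (eb a)) = ((D2 A z (eb a) (eb a)).2 0 : ℂ) * G (eb 0)
      + ((D2 A z (eb a) (eb a)).2 1 : ℂ) * G (eb 1) := by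
    intro a
    rw [clm_decomp G, ht2 a]
    simp
  have e4 : G (fderiv ℝ A z tb) = ((fderiv ℝ A z tb).1 : ℂ) * G tb
      + ((fderiv ℝ A z tb).2 0 : ℂ) * G (eb 0) + ((fderiv ℝ A z tb).2 1 : ℂ) * G (eb 1) := by
    rw [clm_decomp G]
    simp
  rw [e2, e2, e1, e1, e3, e3, e4]
  have hm' : (m : ℂ) ≠ 0 := by exact_mod_cast hm.ne'
  have htd' : (k : ℂ) * ((fderiv ℝ A z tb).1 : ℂ) = m := by exact_mod_cast htd
  have r0' := congrArg (fun s : ℝ => (s : ℂ)) r0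
  have r1' := congrArg (fun s : ℝ => (s : ℂ)) r1
  have r01' := congrArg (fun s : ℝ => (s : ℂ)) r01
  push_cast at r0' r1' r01' hC0 hC1 ⊢
  generalize ((fderiv ℝ A z (eb 0)).2 0 : ℂ) = x00 at *
  generalize ((fderiv ℝ A z (eb 0)).2 1 : ℂ) = x01 at *
  generalize ((fderiv ℝ A z (eb 1)).2 0 : ℂ) = x10 at *
  generalize ((fderiv ℝ A z (eb 1)).2 1 : ℂ) = x11 at *
  generalize ((fderiv ℝ A z tb).2 0 : ℂ) = xt0 at *
  generalize ((fderiv ℝ A z tb).2 1 : ℂ) = xt1 at *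
  generalize ((D2 A z (eb 0) (eb 0)).2 0 : ℂ) = u00 at *
  generalize ((D2 A z (eb 0) (eb 0)).2 1 : ℂ) = u01 at *
  generalize ((D2 A z (eb 1) (eb 1)).2 0 : ℂ) = u10 at *
  generalize ((D2 A z (eb 1) (eb 1)).2 1 : ℂ) = u11 at *
  apply mul_left_cancel₀ hm'
  linear_combination (exp := 1) (-m * G2 (eb 0) (eb 0)) * r0' - m * G2 (eb 1) (eb 1) * r1'
    - 2 * m * G2 (eb 0) (eb 1) * r01' - I * m * G tb * htd'
    + (x00 * G (eb 0) + x01 * G (eb 1)) * hC0 + (x10 * G (eb 0) + x11 * G (eb 1)) * hC1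
    + (I * k * xt0 + u00 + u10) * (G (eb 0) * r0' + G (eb 1) * r01')
    + (I * k * xt1 + u01 + u11) * (G (eb 0) * r01' + G (eb 1) * r1')

/-- The determining equation: an admissible transformation over the map `A` of the base turns
solutions at `z` into solutions of the pulled back equation at `z`. -/
theorem determining_equation {V V' : Potential} {e : OpenPartialHomeomorph VarSpace VarSpace}
    (he : e ∈ admissible V V') {f : BaseSpace → ℂ} {z : BaseSpace} (hf : ContDiffAt ℝ ∞ f z)
    (hp : (z, f z) ∈ e.source) (hlhs : lhs V f z = 0) {A : BaseSpace → BaseSpace} {m k : ℝ}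
    {C : Fin 2 → ℂ} (hA : BaseJet A z m k C) (heA : ∀ᶠ p in 𝓝 (z, f z), (e p).1 = A p.1) :
    pulledOperator V' (A z) m k C (fun y => (e (y, f y)).2) z = 0 := by
  have heA' : (fun p => (e p).1) =ᶠ[𝓝 (z, f z)] fun p => A p.1 := heA
  obtain ⟨hv, hinj, -⟩ := fibre_preserving he hp
  have hsplit : ∀ u h, (fderiv ℝ e (z, f z) (u, h)).1 = (fderiv ℝ e (z, f z) (u, 0)).1 := by
    intro u h
    have : ((u, h) : VarSpace) = (u, 0) + (0, h) := by simp
    rw [this, map_add, Prod.fst_add, hv, add_zero]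
  obtain ⟨g, n, hg, hm, -⟩ := exists_image he.1 hf hp (by simpa only [hsplit] using hinj)
  have hAz : (e (z, f z)).1 = A z := heA.self_of_nhds
  rw [hAz] at hg hm
  have hlg := (he.2.2 f g z (A z) hf hg hm).1 hlhs
  have hc : Filter.Tendsto (fun y => (y, f y)) (𝓝 z) (𝓝 (z, f z)) :=
    (contDiffAt_graph hf).continuousAt
  rw [← lhs_pullback V' hA hg, hlg, mul_zero]
  filter_upwards [hm.2.2, hc.eventually heA] with y h1 h2
  rw [h1, h2]

/-- A complex cubic polynomial in `(φ, φ*)` of the type arising from the determining equation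
vanishes on a ball only if the shift `γ` vanishes and the cubic terms cancel. -/
theorem cubic_vanishing {a γ P R φ₀ : ℂ} {m r : ℝ} (hr : 0 < r) (ha : a ≠ 0)
    (h : ∀ φ ∈ Metric.ball φ₀ r, (m : ℂ) * (((‖a * φ + γ‖ ^ 2 : ℝ) : ℂ) * (a * φ + γ))
      - a * (((‖φ‖ ^ 2 : ℝ) : ℂ) * φ) + P * φ + R = 0) :
    m * ‖a‖ ^ 2 = 1 ∧ γ = 0 := by
  have key : ∀ φ ∈ Metric.ball φ₀ r, (m : ℂ) * ((a * φ + γ)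
      * (starRingEnd ℂ a * starRingEnd ℂ φ + starRingEnd ℂ γ) * (a * φ + γ))
      - a * (φ * starRingEnd ℂ φ * φ) + P * φ + R = 0 := by
    intro φ hφ
    have := h φ hφ
    push_cast at this
    rw [← Complex.mul_conj', ← Complex.mul_conj', map_add, map_mul] at this
    linear_combination this
  have mem : ∀ (s : ℝ) (u : ℂ), |s| ≤ 2 → ‖u‖ ≤ r / 3 → φ₀ + s * u ∈ Metric.ball φ₀ r := by
    intro s u hs hu
    rw [mem_ball_iff_norm, add_sub_cancel_left, norm_mul, Complex.norm_real, Real.norm_eq_abs]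
    nlinarith [norm_nonneg u, abs_nonneg s]
  have key2 : ∀ u : ℂ, ‖u‖ ≤ r / 3 →
      ((m : ℂ) * (a * starRingEnd ℂ a * a) - a) * (u * starRingEnd ℂ u * u) = 0 ∧
      (m : ℂ) * (2 * (a * u * (starRingEnd ℂ a * starRingEnd ℂ u)) * (a * φ₀ + γ)
          + (a * u) ^ 2 * (starRingEnd ℂ a * starRingEnd ℂ φ₀ + starRingEnd ℂ γ))
        - a * (2 * (u * starRingEnd ℂ u) * φ₀ + u ^ 2 * starRingEnd ℂ φ₀) = 0 := by
    intro u hu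
    have h0 := key _ (mem 0 u (by norm_num) hu)
    have h1 := key _ (mem 1 u (by norm_num) hu)
    have h2 := key _ (mem (-1) u (by norm_num) hu)
    have h3 := key _ (mem 2 u (by norm_num) hu)
    simp only [map_add, map_mul, map_zero, map_one, map_neg, map_ofNat, ofReal_zero, ofReal_one, ofReal_neg,
      ofReal_ofNat] at h0 h1 h2 h3
    constructor
    · linear_combination (h3 - 3 * h1 + 3 * h0 - h2) / 6
    · linear_combination (h1 + h2 - 2 * h0) / 2
  have hr3 : ((r / 3 : ℝ) : ℂ) ≠ 0 := by exact_mod_cast (by positivity : r / 3 ≠ 0)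
  have hn : ‖((r / 3 : ℝ) : ℂ)‖ = r / 3 := by
    rw [Complex.norm_real, Real.norm_eq_abs, abs_of_pos (by positivity)]
  have k1 := (key2 ((r / 3 : ℝ) : ℂ) hn.le).1
  have k1' : (m : ℂ) * (a * starRingEnd ℂ a) = 1 := by
    rw [Complex.conj_ofReal] at k1
    have h1 := (mul_eq_zero.1 k1).resolve_right (mul_ne_zero (mul_ne_zero hr3 hr3) hr3)
    apply mul_left_cancel₀ ha
    linear_combination h1
  have k2 : ∀ u : ℂ, ‖u‖ ≤ r / 3 →
      2 * (u * starRingEnd ℂ u) * γ * starRingEnd ℂ a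
        + a * u ^ 2 * starRingEnd ℂ γ = 0 := by
    intro u hu
    have h1 := (key2 u hu).2
    have hm : (m : ℂ) ≠ 0 := by rintro h0; rw [h0, zero_mul] at k1'; exact zero_ne_one k1'
    apply mul_left_cancel₀ (mul_ne_zero hm ha)
    linear_combination h1 - (2 * (u * starRingEnd ℂ u) * φ₀ * a + a * u ^ 2 * starRingEnd ℂ φ₀) * k1'
  have k3 := k2 ((r / 3 : ℝ) : ℂ) hn.le
  have k4 := k2 (((r / 3 : ℝ) : ℂ) * I) (by rw [norm_mul, hn, Complex.norm_I, mul_one])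
  have hI := Complex.I_sq
  simp only [map_mul, Complex.conj_ofReal, Complex.conj_I] at k3 k4
  constructor
  · rw [Complex.mul_conj'] at k1'
    exact_mod_cast k1'
  · have hca : starRingEnd ℂ a ≠ 0 := by simpa using ha
    apply (mul_eq_zero.1 _).resolve_left (mul_ne_zero (mul_ne_zero hr3 hr3) hca)
    linear_combination (k3 + k4) / 4
      + ((r / 3 : ℝ) : ℂ) ^ 2 * (2 * γ * starRingEnd ℂ a - a * starRingEnd ℂ γ) / 4 * hI

/-- `hat` as a continuous real-linear map. -/
noncomputable def hatL (c : ℝ) : ℂ →L[ℝ] ℂ :=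
  if 0 < c then ContinuousLinearMap.id ℝ ℂ else (conjCLE : ℂ →L[ℝ] ℂ)

theorem hatL_apply (c : ℝ) (β : ℂ) : hatL c β = hat c β := by
  unfold hatL hat
  split_ifs <;> simp

theorem hat_add (c : ℝ) (β γ : ℂ) : hat c (β + γ) = hat c β + hat c γ := by
  simp [← hatL_apply]

theorem hat_sub (c : ℝ) (β γ : ℂ) : hat c (β - γ) = hat c β - hat c γ := by
  simp [← hatL_apply]

theorem hat_zero (c : ℝ) : hat c 0 = 0 := by simp [← hatL_apply]

theorem hat_mul (c : ℝ) (β γ : ℂ) : hat c (β * γ) = hat c β * hat c γ := by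
  unfold hat
  split_ifs <;> simp

theorem hat_ofReal (c r : ℝ) : hat c r = r := by
  unfold hat
  split_ifs <;> simp

theorem norm_hat (c : ℝ) (β : ℂ) : ‖hat c β‖ = ‖β‖ := by
  unfold hat
  split_ifs <;> simp

theorem hat_hat (c : ℝ) (β : ℂ) : hat c (hat c β) = β := by
  unfold hat
  split_ifs <;> simp

theorem hat_eq_zero {c : ℝ} {β : ℂ} : hat c β = 0 ↔ β = 0 := by
  rw [← norm_eq_zero, norm_hat, norm_eq_zero]

theorem hat_I {k : ℝ} (hk : k = 1 ∨ k = -1) : hat k I = I * k := by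
  rcases hk with rfl | rfl
  · simp [hat]
  · norm_num [hat]

theorem hat_congr {c c' : ℝ} (h : 0 < c ↔ 0 < c') (β : ℂ) : hat c β = hat c' β := by
  simp only [hat, h]

theorem contDiffAt_hat {E : Type*} [NormedAddCommGroup E] [NormedSpace ℝ E] {f : E → ℂ} {z : E}
    (hf : ContDiffAt ℝ ∞ f z) (c : ℝ) : ContDiffAt ℝ ∞ (fun y => hat c (f y)) z := by
  simp only [← hatL_apply]
  exact ((hatL c).contDiff.contDiffAt).comp z hf

theorem fderiv_hat {E : Type*} [NormedAddCommGroup E] [NormedSpace ℝ E] {f : E → ℂ} {z : E}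
    (hf : DifferentiableAt ℝ f z) (c : ℝ) (u : E) :
    fderiv ℝ (fun y => hat c (f y)) z u = hat c (fderiv ℝ f z u) := by
  simp only [← hatL_apply]
  have := (hatL c).hasFDerivAt.comp z hf.hasFDerivAt
  exact congrArg (fun L => L u) this.fderiv

theorem D2_hat {E : Type*} [NormedAddCommGroup E] [NormedSpace ℝ E] {f : E → ℂ} {z : E}
    (hf : ContDiffAt ℝ ∞ f z) (c : ℝ) (u v : E) :
    D2 (fun y => hat c (f y)) z u v = hat c (D2 f z u v) := by
  rw [← fderiv_fderiv_apply (contDiffAt_hat hf c)]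
  have h : (fun y => fderiv ℝ (fun y => hat c (f y)) y v) =ᶠ[𝓝 z]
      fun y => hat c (fderiv ℝ f y v) := by
    filter_upwards [eventually_differentiableAt hf] with y hy
    exact fderiv_hat hy c v
  rw [h.fderiv_eq, fderiv_hat, fderiv_fderiv_apply hf]
  exact (contDiffAt_differentiableAt (contDiffAt_fderiv hf)).clm_apply (differentiableAt_const v)

/-- The pulled back operator on `D = α f̂ + γ`. -/
theorem pulledOperator_affine (V V' : Potential) {z w : BaseSpace} {m k : ℝ} (C : Fin 2 → ℂ)
    (hk : k = 1 ∨ k = -1) {α γ f D : BaseSpace → ℂ} (hα : ContDiffAt ℝ ∞ α z)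
    (hγ : ContDiffAt ℝ ∞ γ z) (hf : ContDiffAt ℝ ∞ f z)
    (hD : ∀ᶠ y in 𝓝 z, D y = α y * hat k (f y) + γ y) :
    pulledOperator V' w m k C D z = α z * hat k (lhs V f z)
      + (2 * fderiv ℝ α z (eb 0) - C 0 * α z) * hat k (fderiv ℝ f z (eb 0))
      + (2 * fderiv ℝ α z (eb 1) - C 1 * α z) * hat k (fderiv ℝ f z (eb 1))
      + (m * (((‖α z * hat k (f z) + γ z‖ ^ 2 : ℝ) : ℂ) * (α z * hat k (f z) + γ z))
        - α z * (((‖hat k (f z)‖ ^ 2 : ℝ) : ℂ) * hat k (f z))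
        + (D2 α z (eb 0) (eb 0) + D2 α z (eb 1) (eb 1) + I * k * fderiv ℝ α z tb
          - C 0 * fderiv ℝ α z (eb 0) - C 1 * fderiv ℝ α z (eb 1) - α z * hat k (V.toFun z)
          + m * V'.toFun w * α z) * hat k (f z)
        + (D2 γ z (eb 0) (eb 0) + D2 γ z (eb 1) (eb 1) + I * k * fderiv ℝ γ z tb
          - C 0 * fderiv ℝ γ z (eb 0) - C 1 * fderiv ℝ γ z (eb 1) + m * V'.toFun w * γ z)) := by
  have hfh := contDiffAt_hat hf k
  have hfd := contDiffAt_differentiableAt hf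
  have hD' : D =ᶠ[𝓝 z] fun y => α y * hat k (f y) + γ y := hD
  have h1 : ∀ u, fderiv ℝ D z u
      = fderiv ℝ α z u * hat k (f z) + α z * hat k (fderiv ℝ f z u) + fderiv ℝ γ z u := by
    intro u
    rw [hD'.fderiv_eq, fderiv_fun_add ((contDiffAt_differentiableAt hα).fun_mul
      (contDiffAt_differentiableAt hfh)) (contDiffAt_differentiableAt hγ),
      fderiv_fun_mul (contDiffAt_differentiableAt hα) (contDiffAt_differentiableAt hfh)]
    simp only [add_apply, smul_apply, smul_eq_mul, fderiv_hat hfd]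
    ring
  have h2 : ∀ u v, D2 D z u v = D2 α z u v * hat k (f z) + α z * hat k (D2 f z u v)
      + fderiv ℝ α z u * hat k (fderiv ℝ f z v) + fderiv ℝ α z v * hat k (fderiv ℝ f z u)
      + D2 γ z u v := by
    intro u v
    rw [D2_congr hD', D2_add (hα.mul hfh) hγ]
    simp only [add_apply]
    rw [D2_mul hα hfh, fderiv_hat hfd, fderiv_hat hfd, D2_hat hf]
  rw [pulledOperator, hD.self_of_nhds, h1, h1, h1, h2, h2, lhs_eq V hf]
  simp only [hat_add, hat_mul, hat_ofReal, hat_I hk, norm_hat]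
  ring

/-- The dependence on `ψ` of the new dependent variable, infinitesimally. -/
theorem fibre_relations {V V' : Potential} {e : OpenPartialHomeomorph VarSpace VarSpace}
    (he : e ∈ admissible V V') {z : BaseSpace} {ψ : ℂ} (hp : (z, ψ) ∈ e.source)
    {A : BaseSpace → BaseSpace} {m k : ℝ} {C : Fin 2 → ℂ} (hA : BaseJet A z m k C)
    (heA : ∀ᶠ p in 𝓝 (z, ψ), (e p).1 = A p.1) :
    (∀ h, (fderiv ℝ e (z, ψ) (0, I * h)).2 = I * k * (fderiv ℝ e (z, ψ) (0, h)).2) ∧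
      (∀ h, D2 (fun p => (e p).2) (z, ψ) (0, h) (0, h) = 0) ∧ (k = 1 ∨ k = -1) := by
  have hes := he.1.contDiffAt hp
  set B : VarSpace → ℂ := fun p => (e p).2 with hB
  have hBs : ContDiffAt ℝ ∞ B (z, ψ) := hes.snd
  have hBd : ∀ v, fderiv ℝ B (z, ψ) v = (fderiv ℝ e (z, ψ) v).2 := by
    intro v
    rw [hB, (contDiffAt_differentiableAt hes).hasFDerivAt.snd.fderiv]
    rfl
  let pt : BaseSpace →L[ℝ] ℝ := ContinuousLinearMap.fst ℝ ℝ (Fin 2 → ℝ)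
  let pr : BaseSpace →L[ℝ] ℝ :=
    (ContinuousLinearMap.proj (R := ℝ) 0).comp (ContinuousLinearMap.snd ℝ ℝ (Fin 2 → ℝ))
  have main : ∀ ft q : ℂ, D2 B (z, ψ) (eb 0, q) (eb 0, q)
      + fderiv ℝ B (z, ψ) (0, -(I * ft + ((‖ψ‖ ^ 2 : ℝ) : ℂ) * ψ + V.toFun z * ψ))
      + D2 B (z, ψ) (eb 1, 0) (eb 1, 0)
      + I * k * fderiv ℝ B (z, ψ) (tb, ft) - C 0 * fderiv ℝ B (z, ψ) (eb 0, q)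
      - C 1 * fderiv ℝ B (z, ψ) (eb 1, 0)
      + m * (((‖B (z, ψ)‖ ^ 2 : ℝ) : ℂ) * B (z, ψ) + V'.toFun (A z) * B (z, ψ)) = 0 := by
    intro ft q
    set c : ℂ := -(I * ft + ((‖ψ‖ ^ 2 : ℝ) : ℂ) * ψ + V.toFun z * ψ) / 2 with hc
    let Q : BaseSpace →L[ℝ] ℂ := pt.smulRight ft + pr.smulRight q
    let σ : BaseSpace →L[ℝ] BaseSpace →L[ℝ] ℂ := pr.smulRight (pr.smulRight c)
    have hQt : Q tb = ft := by simp [Q, pt, pr, tb]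
    have hQ0 : Q (eb 0) = q := by simp [Q, pt, pr, eb]
    have hQ1 : Q (eb 1) = 0 := by simp [Q, pt, pr, eb]
    have hσ0 : σ (eb 0) (eb 0) = c := by simp [σ, pr, eb]
    have hσ1 : σ (eb 1) (eb 1) = 0 := by simp [σ, pr, eb]
    have hfs : ContDiffAt ℝ ∞ (quad z ψ Q σ) z := (contDiff_quad _ _ _ _).contDiffAt
    have hfz : quad z ψ Q σ z = ψ := quad_self _ _ _ _
    have hlhs : lhs V (quad z ψ Q σ) z = 0 := by
      rw [lhs_eq V hfs, fderiv_quad_self, D2_quad, D2_quad, hfz, hσ0, hσ1, hQt, hc]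
      ring
    have h := determining_equation he hfs (by rwa [hfz]) hlhs hA (by rwa [hfz])
    have hBs' : ContDiffAt ℝ ∞ B (z, quad z ψ Q σ z) := by rw [hfz]; exact hBs
    have hd : ∀ u, fderiv ℝ (fun y => (e (y, quad z ψ Q σ y)).2) z u
        = fderiv ℝ B (z, ψ) (u, Q u) := by
      intro u
      have := fderiv_comp_at (g := B) (c := fun y => (y, quad z ψ Q σ y)) hBs'
        (contDiffAt_graph hfs) u
      rw [fderiv_graph hfs, fderiv_quad_self, hfz] at this
      exact this
    have hd2 : ∀ u, D2 (fun y => (e (y, quad z ψ Q σ y)).2) z u u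
        = D2 B (z, ψ) (u, Q u) (u, Q u) + fderiv ℝ B (z, ψ) (0, 2 * σ u u) := by
      intro u
      have := D2_comp (g := B) (c := fun y => (y, quad z ψ Q σ y)) hBs' (contDiffAt_graph hfs) u u
      rw [fderiv_graph hfs, D2_graph hfs, D2_quad, fderiv_quad_self, hfz, ← two_mul] at this
      exact this
    rw [pulledOperator, hd, hd, hd, hd2, hd2, hQt, hQ0, hQ1, hσ0, hσ1, hfz, hc,
      mul_div_cancel₀ _ (two_ne_zero' ℂ), mul_zero] at h
    have h00 : fderiv ℝ B (z, ψ) (0, 0) = 0 := map_zero _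
    rw [h00] at h
    linear_combination h
  have hsplit : ∀ u h, fderiv ℝ B (z, ψ) (u, h)
      = fderiv ℝ B (z, ψ) (u, 0) + fderiv ℝ B (z, ψ) (0, h) := by
    intro u h
    rw [← map_add]; simp
  have hvadd : ∀ a b : ℂ, fderiv ℝ B (z, ψ) (0, a + b)
      = fderiv ℝ B (z, ψ) (0, a) + fderiv ℝ B (z, ψ) (0, b) := by
    intro a b
    rw [← map_add]; simp
  have hvneg : ∀ a : ℂ, fderiv ℝ B (z, ψ) (0, -a) = - fderiv ℝ B (z, ψ) (0, a) := by
    intro a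
    rw [← map_neg]; simp
  have h00 : fderiv ℝ B (z, ψ) (0, 0) = 0 := map_zero _
  have c1 : ∀ h, fderiv ℝ B (z, ψ) (0, I * h) = I * k * fderiv ℝ B (z, ψ) (0, h) := by
    intro h
    have h1 := main h 0
    have h2 := main 0 0
    rw [hsplit tb h, hvneg, hvadd, hvadd] at h1
    rw [mul_zero, zero_add, hvneg, hvadd] at h2
    linear_combination h2 - h1
  have c2 : ∀ h, D2 B (z, ψ) (0, h) (0, h) = 0 := by
    intro h
    have h1 := main 0 h
    have h2 := main 0 (-h)
    have h3 := main 0 0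
    have s1 : ((eb 0, h) : VarSpace) = (eb 0, 0) + (0, h) := by simp
    have s2 : ((eb 0, -h) : VarSpace) = (eb 0, 0) - (0, h) := by simp
    rw [s1] at h1
    rw [s2] at h2
    simp only [map_add, map_sub, add_apply, sub_apply] at h1 h2
    linear_combination (h1 + h2 - 2 * h3) / 2
  refine ⟨fun h => by rw [← hBd, ← hBd]; exact c1 h, c2, ?_⟩
  have hne : fderiv ℝ B (z, ψ) (0, 1) ≠ 0 := by
    intro h0
    have h1 : fderiv ℝ e (z, ψ) (0, 1) = fderiv ℝ e (z, ψ) (0, 0) := by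
      ext1
      · rw [(fibre_preserving he hp).1, (fibre_preserving he hp).1]
      · rw [← hBd, ← hBd, h0, h00]
    have h2 := he.1.injective hp h1
    have h3 : (1 : ℂ) = 0 := congrArg Prod.snd h2
    exact one_ne_zero h3
  have h1 := c1 1
  have h2 := c1 I
  rw [mul_one] at h1
  rw [Complex.I_mul_I, hvneg, h1] at h2
  have h3 : ((k : ℂ) ^ 2 - 1) * fderiv ℝ B (z, ψ) (0, 1) = 0 := by
    linear_combination h2 + (k : ℂ) ^ 2 * fderiv ℝ B (z, ψ) (0, 1) * Complex.I_sq
  have h4 : (k : ℂ) ^ 2 - 1 = 0 := (mul_eq_zero.1 h3).resolve_right hne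
  have h5 : k ^ 2 - 1 = 0 := by exact_mod_cast h4
  exact mul_self_eq_one_iff.1 (by linarith)

/-- The relations for the coefficients of the new dependent variable `α ψ̂ + γ`. -/
theorem coefficient_relations {V V' : Potential} {e : OpenPartialHomeomorph VarSpace VarSpace}
    (he : e ∈ admissible V V') {z : BaseSpace} {ψ₀ : ℂ} {r : ℝ} (hr : 0 < r)
    {A : BaseSpace → BaseSpace} {m k : ℝ} {C : Fin 2 → ℂ} (hA : BaseJet A z m k C)
    (hk : k = 1 ∨ k = -1) {α γ : BaseSpace → ℂ} (hα : ContDiffAt ℝ ∞ α z)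
    (hγ : ContDiffAt ℝ ∞ γ z) (hα0 : α z ≠ 0)
    (hsrc : ∀ ψ ∈ Metric.ball ψ₀ r, (z, ψ) ∈ e.source)
    (hform : ∀ ψ ∈ Metric.ball ψ₀ r, ∀ᶠ p in 𝓝 (z, ψ),
      e p = (A p.1, α p.1 * hat k p.2 + γ p.1)) :
    (∀ a, 2 * fderiv ℝ α z (eb a) = C a * α z) ∧ m * ‖α z‖ ^ 2 = 1 ∧ γ z = 0 := by
  let pr (b : Fin 2) : BaseSpace →L[ℝ] ℝ :=
    (ContinuousLinearMap.proj (R := ℝ) b).comp (ContinuousLinearMap.snd ℝ ℝ (Fin 2 → ℝ))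
  have main : ∀ ψ ∈ Metric.ball ψ₀ r, ∀ q : Fin 2 → ℂ,
      (2 * fderiv ℝ α z (eb 0) - C 0 * α z) * hat k (q 0)
      + (2 * fderiv ℝ α z (eb 1) - C 1 * α z) * hat k (q 1)
      + (m * (((‖α z * hat k ψ + γ z‖ ^ 2 : ℝ) : ℂ) * (α z * hat k ψ + γ z))
        - α z * (((‖hat k ψ‖ ^ 2 : ℝ) : ℂ) * hat k ψ)
        + (D2 α z (eb 0) (eb 0) + D2 α z (eb 1) (eb 1) + I * k * fderiv ℝ α z tb
          - C 0 * fderiv ℝ α z (eb 0) - C 1 * fderiv ℝ α z (eb 1) - α z * hat k (V.toFun z)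
          + m * V'.toFun (A z) * α z) * hat k ψ
        + (D2 γ z (eb 0) (eb 0) + D2 γ z (eb 1) (eb 1) + I * k * fderiv ℝ γ z tb
          - C 0 * fderiv ℝ γ z (eb 0) - C 1 * fderiv ℝ γ z (eb 1)
          + m * V'.toFun (A z) * γ z)) = 0 := by
    intro ψ hψ q
    set c : ℂ := -(((‖ψ‖ ^ 2 : ℝ) : ℂ) * ψ + V.toFun z * ψ) / 2 with hc
    let Q : BaseSpace →L[ℝ] ℂ := (pr 0).smulRight (q 0) + (pr 1).smulRight (q 1)
    let σ : BaseSpace →L[ℝ] BaseSpace →L[ℝ] ℂ := (pr 0).smulRight ((pr 0).smulRight c)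
    have hQt : Q tb = 0 := by simp [Q, pr, tb]
    have hQ0 : Q (eb 0) = q 0 := by simp [Q, pr, eb]
    have hQ1 : Q (eb 1) = q 1 := by simp [Q, pr, eb]
    have hσ0 : σ (eb 0) (eb 0) = c := by simp [σ, pr, eb]
    have hσ1 : σ (eb 1) (eb 1) = 0 := by simp [σ, pr, eb]
    have hfs : ContDiffAt ℝ ∞ (quad z ψ Q σ) z := (contDiff_quad _ _ _ _).contDiffAt
    have hfz : quad z ψ Q σ z = ψ := quad_self _ _ _ _
    have hlhs : lhs V (quad z ψ Q σ) z = 0 := by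
      rw [lhs_eq V hfs, fderiv_quad_self, D2_quad, D2_quad, hfz, hσ0, hσ1, hQt, hc]
      ring
    have hf := hform ψ hψ
    have h := determining_equation he hfs (by rw [hfz]; exact hsrc ψ hψ) hlhs hA
      (by rw [hfz]; exact hf.mono fun p hp => by rw [hp])
    have hcont : Filter.Tendsto (fun y => (y, quad z ψ Q σ y)) (𝓝 z) (𝓝 (z, ψ)) := by
      have := (contDiffAt_graph hfs).continuousAt.tendsto
      rwa [hfz] at this
    rw [pulledOperator_affine V V' C hk hα hγ hfs
      ((hcont.eventually hf).mono fun y hy => by rw [hy]), hlhs, hat_zero, mul_zero, zero_add,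
      fderiv_quad_self, hfz, hQ0, hQ1] at h
    exact h
  have hψ₀ := Metric.mem_ball_self (x := ψ₀) hr
  have h0 := main ψ₀ hψ₀ 0
  simp only [Pi.zero_apply, hat_zero, mul_zero, zero_add] at h0
  have h1 : hat k 1 = 1 := by simpa using hat_ofReal k 1
  obtain ⟨g1, g2⟩ := cubic_vanishing (φ₀ := hat k ψ₀) hr hα0 (by
    intro φ hφ
    have hmem : hat k φ ∈ Metric.ball ψ₀ r := by
      rw [mem_ball_iff_norm] at hφ ⊢
      rw [← norm_hat k, hat_sub, hat_hat]
      exact hφ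
    have h := main _ hmem 0
    simp only [Pi.zero_apply, hat_zero, mul_zero, zero_add, hat_hat] at h
    exact h)
  refine ⟨Fin.forall_fin_two.2 ⟨?_, ?_⟩, g1, g2⟩
  · have h := main ψ₀ hψ₀ ![1, 0]
    simp only [Matrix.cons_val_zero, Matrix.cons_val_one, hat_zero, h1] at h
    linear_combination h - h0
  · have h := main ψ₀ hψ₀ ![0, 1]
    simp only [Matrix.cons_val_zero, Matrix.cons_val_one, hat_zero, h1] at h
    linear_combination h - h0

section TimeFunctions

variable {F : Type*} [NormedAddCommGroup F] [NormedSpace ℝ F]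

theorem contDiffAt_deriv {φ : ℝ → F} {t : ℝ} (hφ : ContDiffAt ℝ ∞ φ t) :
    ContDiffAt ℝ ∞ (deriv φ) t := by
  have : deriv φ = fun s => fderiv ℝ φ s 1 := by ext s; simp
  rw [this]
  exact (contDiffAt_fderiv hφ).clm_apply contDiffAt_const

theorem contDiffAt_time {φ : ℝ → F} {z : BaseSpace} (hφ : ContDiffAt ℝ ∞ φ z.1) :
    ContDiffAt ℝ ∞ (fun y : BaseSpace => φ y.1) z :=
  ContDiffAt.comp z hφ contDiffAt_fst

theorem hasFDerivAt_time {φ : ℝ → F} {z : BaseSpace} {φ' : F} (hφ : HasDerivAt φ φ' z.1) :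
    HasFDerivAt (fun y : BaseSpace => φ y.1)
      ((ContinuousLinearMap.fst ℝ ℝ (Fin 2 → ℝ)).smulRight φ') z := by
  have h := hφ.hasFDerivAt.comp z (hasFDerivAt_fst (p := z))
  refine HasFDerivAt.congr_fderiv h ?_
  ext <;> simp

theorem contDiffAt_coord (a : Fin 2) (z : BaseSpace) :
    ContDiffAt ℝ ∞ (fun y : BaseSpace => y.2 a) z := by fun_prop

/-- The coordinate function `x_a`. -/
noncomputable def coordL (a : Fin 2) : BaseSpace →L[ℝ] ℝ :=
  (ContinuousLinearMap.proj (R := ℝ) a).comp (ContinuousLinearMap.snd ℝ ℝ (Fin 2 → ℝ))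

theorem coordL_apply (a : Fin 2) (u : BaseSpace) : coordL a u = u.2 a := rfl

theorem hasFDerivAt_coord (a : Fin 2) (z : BaseSpace) :
    HasFDerivAt (fun y : BaseSpace => y.2 a) (coordL a) z := (coordL a).hasFDerivAt

/-- The derivative of a quadratic polynomial in `x` with coefficients depending on `t`. -/
theorem fderiv_timePoly {A L0 L1 P : ℝ → ℝ} {z : BaseSpace} {A' L0' L1' P' : ℝ}
    (hA : HasDerivAt A A' z.1) (h0 : HasDerivAt L0 L0' z.1) (h1 : HasDerivAt L1 L1' z.1)
    (hP : HasDerivAt P P' z.1) (u : BaseSpace) :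
    fderiv ℝ (fun y : BaseSpace => A y.1 * (y.2 0 * y.2 0 + y.2 1 * y.2 1)
        + (L0 y.1 * y.2 0 + L1 y.1 * y.2 1) + P y.1) z u
      = u.1 * (A' * (z.2 0 * z.2 0 + z.2 1 * z.2 1) + (L0' * z.2 0 + L1' * z.2 1) + P')
        + u.2 0 * (2 * A z.1 * z.2 0 + L0 z.1) + u.2 1 * (2 * A z.1 * z.2 1 + L1 z.1) := by
  have c0 := hasFDerivAt_coord 0 z
  have c1 := hasFDerivAt_coord 1 z
  have h := (((hasFDerivAt_time hA).mul ((c0.mul c0).add (c1.mul c1))).add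
    (((hasFDerivAt_time h0).mul c0).add ((hasFDerivAt_time h1).mul c1))).add (hasFDerivAt_time hP)
  have h' : HasFDerivAt (fun y : BaseSpace => A y.1 * (y.2 0 * y.2 0 + y.2 1 * y.2 1)
        + (L0 y.1 * y.2 0 + L1 y.1 * y.2 1) + P y.1) _ z := h
  rw [h'.fderiv]
  simp [coordL_apply]
  ring

theorem D2_timePoly {A L0 L1 P : ℝ → ℝ} {z : BaseSpace} (hA : ContDiffAt ℝ ∞ A z.1)
    (h0 : ContDiffAt ℝ ∞ L0 z.1) (h1 : ContDiffAt ℝ ∞ L1 z.1) (hP : ContDiffAt ℝ ∞ P z.1)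
    (a : Fin 2) :
    D2 (fun y : BaseSpace => A y.1 * (y.2 0 * y.2 0 + y.2 1 * y.2 1)
        + (L0 y.1 * y.2 0 + L1 y.1 * y.2 1) + P y.1) z (eb a) (eb a) = 2 * A z.1 := by
  have sm : ContDiffAt ℝ ∞ (fun y : BaseSpace => A y.1 * (y.2 0 * y.2 0 + y.2 1 * y.2 1)
        + (L0 y.1 * y.2 0 + L1 y.1 * y.2 1) + P y.1) z :=
    (((contDiffAt_time hA).mul (((contDiffAt_coord 0 z).mul (contDiffAt_coord 0 z)).add
      ((contDiffAt_coord 1 z).mul (contDiffAt_coord 1 z)))).add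
      (((contDiffAt_time h0).mul (contDiffAt_coord 0 z)).add
        ((contDiffAt_time h1).mul (contDiffAt_coord 1 z)))).add (contDiffAt_time hP)
  have ht : Filter.Tendsto (fun y : BaseSpace => y.1) (𝓝 z) (𝓝 z.1) := continuous_fst.continuousAt
  rw [← fderiv_fderiv_apply sm]
  let L : Fin 2 → ℝ → ℝ := ![L0, L1]
  have hL : ContDiffAt ℝ ∞ (L a) z.1 := by fin_cases a <;> simp [L, h0, h1]
  have hev : (fun y => fderiv ℝ (fun y : BaseSpace => A y.1 * (y.2 0 * y.2 0 + y.2 1 * y.2 1)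
        + (L0 y.1 * y.2 0 + L1 y.1 * y.2 1) + P y.1) y (eb a)) =ᶠ[𝓝 z]
      fun y => 2 * A y.1 * y.2 a + L a y.1 := by
    filter_upwards [ht.eventually (eventually_differentiableAt hA),
      ht.eventually (eventually_differentiableAt h0),
      ht.eventually (eventually_differentiableAt h1),
      ht.eventually (eventually_differentiableAt hP)] with y d1 d2 d3 d4
    rw [fderiv_timePoly d1.hasDerivAt d2.hasDerivAt d3.hasDerivAt d4.hasDerivAt]
    fin_cases a <;> simp [eb, L]
  have h := (((hasFDerivAt_time (contDiffAt_differentiableAt hA).hasDerivAt).const_mul 2).mul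
    (hasFDerivAt_coord a z)).add
      (hasFDerivAt_time (contDiffAt_differentiableAt hL).hasDerivAt)
  have h' : HasFDerivAt (fun y : BaseSpace => 2 * A y.1 * y.2 a + L a y.1) _ z := h
  rw [hev.fderiv_eq, h'.fderiv]
  simp [coordL_apply, eb]

end TimeFunctions

/-- The parameters of an explicit transformation. -/
structure Coeffs where
  T : ℝ → ℝ
  O : Matrix (Fin 2) (Fin 2) ℝ
  X : Fin 2 → ℝ → ℝ
  Ψ : ℝ → ℝ

namespace Coeffs

variable (D : Coeffs)

/-- The parameters are smooth at `t` and nondegenerate. -/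
structure ValidAt (t : ℝ) : Prop where
  smoothT : ContDiffAt ℝ ∞ D.T t
  smoothX : ∀ a, ContDiffAt ℝ ∞ (D.X a) t
  smoothΨ : ContDiffAt ℝ ∞ D.Ψ t
  deriv_ne : deriv D.T t ≠ 0
  orth : D.O ∈ Matrix.orthogonalGroup (Fin 2) ℝ

/-- The induced transformation of `(t, x)`. -/
noncomputable def base (z : BaseSpace) : BaseSpace := (D.T z.1, newX D.T D.O D.X z.1 z.2)

/-- The factor of `ψ̂` in the transformation of `ψ`. -/
noncomputable def alpha (z : BaseSpace) : ℂ :=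
  ((1 / Real.sqrt |deriv D.T z.1| : ℝ) : ℂ)
    * Complex.exp (I * (phase D.T D.O D.X D.Ψ z.1 z.2 : ℂ))

/-- The induced transformation of `(t, x, ψ)`. -/
noncomputable def map (p : VarSpace) : VarSpace :=
  (D.base p.1, newPsi D.T D.O D.X D.Ψ p.1.1 p.1.2 p.2)

/-- The transformation of the potential. -/
noncomputable def pot (z : BaseSpace) (v : ℂ) : ℂ := newV D.T D.O D.X D.Ψ z.1 z.2 v

/-- The transformation of `(t, x, ψ, V)`. -/
noncomputable def ext (q : ExtSpace) : ExtSpace := (D.map q.1, D.pot q.1.1 q.2)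

/-- The scale factor `|T_t|^{1/2}`. -/
noncomputable def scale (t : ℝ) : ℝ := Real.sqrt |deriv D.T t|

/-- The coefficient of `x_a x_a` in the phase. -/
noncomputable def phase2 (t : ℝ) : ℝ := 1 / 8 * (iteratedDeriv 2 D.T t / |deriv D.T t|)

/-- The coefficient of `x_a` in the phase. -/
noncomputable def phase1 (a : Fin 2) (t : ℝ) : ℝ :=
  1 / 2 * (Real.sign (deriv D.T t) * (deriv (D.X 0) t / D.scale t * D.O 0 a
    + deriv (D.X 1) t / D.scale t * D.O 1 a))

theorem phase_eq (z : BaseSpace) : phase D.T D.O D.X D.Ψ z.1 z.2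
    = D.phase2 z.1 * (z.2 0 * z.2 0 + z.2 1 * z.2 1)
      + (D.phase1 0 z.1 * z.2 0 + D.phase1 1 z.1 * z.2 1) + D.Ψ z.1 := by
  simp only [phase, phase2, phase1, scale, Fin.sum_univ_two]
  ring

theorem newPsi_eq (z : BaseSpace) (ψ : ℂ) :
    newPsi D.T D.O D.X D.Ψ z.1 z.2 ψ = D.alpha z * hat (deriv D.T z.1) ψ := rfl

variable {D} {t : ℝ}

theorem sign_deriv (h : D.ValidAt t) :
    Real.sign (deriv D.T t) = 1 ∨ Real.sign (deriv D.T t) = -1 := by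
  rcases lt_or_gt_of_ne h.deriv_ne with h1 | h1
  · right; exact Real.sign_of_neg h1
  · left; exact Real.sign_of_pos h1

theorem sign_mul_deriv (t : ℝ) : Real.sign (deriv D.T t) * deriv D.T t = |deriv D.T t| := by
  rcases lt_trichotomy (deriv D.T t) 0 with h1 | h1 | h1
  · rw [Real.sign_of_neg h1, abs_of_neg h1]; ring
  · simp [h1]
  · rw [Real.sign_of_pos h1, abs_of_pos h1]; ring

theorem scale_pos (h : D.ValidAt t) : 0 < D.scale t :=
  Real.sqrt_pos.2 (abs_pos.2 h.deriv_ne)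

theorem scale_sq (t : ℝ) : D.scale t ^ 2 = |deriv D.T t| := Real.sq_sqrt (abs_nonneg _)

theorem eventually_sign (h : D.ValidAt t) :
    ∀ᶠ s in 𝓝 t, Real.sign (deriv D.T s) = Real.sign (deriv D.T t) := by
  have hc := (contDiffAt_deriv h.smoothT).continuousAt
  rcases lt_or_gt_of_ne h.deriv_ne with h1 | h1
  · filter_upwards [hc.eventually (gt_mem_nhds h1)] with s hs
    rw [Real.sign_of_neg h1, Real.sign_of_neg hs]
  · filter_upwards [hc.eventually (lt_mem_nhds h1)] with s hs
    rw [Real.sign_of_pos h1, Real.sign_of_pos hs]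

theorem eventually_abs (h : D.ValidAt t) : (fun s => |deriv D.T s|) =ᶠ[𝓝 t]
    fun s => Real.sign (deriv D.T t) * deriv D.T s := by
  filter_upwards [eventually_sign h] with s hs
  rw [← hs, sign_mul_deriv]

theorem contDiffAt_abs (h : D.ValidAt t) : ContDiffAt ℝ ∞ (fun s => |deriv D.T s|) t :=
  (contDiffAt_const.mul (contDiffAt_deriv h.smoothT)).congr_of_eventuallyEq (eventually_abs h)

theorem contDiffAt_scale (h : D.ValidAt t) : ContDiffAt ℝ ∞ D.scale t :=
  (contDiffAt_abs h).sqrt (abs_pos.2 h.deriv_ne).ne'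

theorem contDiffAt_sign (h : D.ValidAt t) :
    ContDiffAt ℝ ∞ (fun s => Real.sign (deriv D.T s)) t :=
  contDiffAt_const.congr_of_eventuallyEq (eventually_sign h)

theorem iteratedDeriv_two_eq : iteratedDeriv 2 D.T = deriv (deriv D.T) := by
  rw [iteratedDeriv_succ, iteratedDeriv_one]

theorem iteratedDeriv_three_eq : iteratedDeriv 3 D.T = deriv (deriv (deriv D.T)) := by
  rw [iteratedDeriv_succ, iteratedDeriv_two_eq]

theorem contDiffAt_phase2 (h : D.ValidAt t) : ContDiffAt ℝ ∞ D.phase2 t := by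
  unfold phase2
  rw [iteratedDeriv_two_eq]
  exact contDiffAt_const.mul ((contDiffAt_deriv (contDiffAt_deriv h.smoothT)).div
    (contDiffAt_abs h) (abs_pos.2 h.deriv_ne).ne')

theorem contDiffAt_phase1 (h : D.ValidAt t) (a : Fin 2) : ContDiffAt ℝ ∞ (D.phase1 a) t := by
  have hs := contDiffAt_scale h
  have hs0 := (scale_pos h).ne'
  have hX := fun b => contDiffAt_deriv (h.smoothX b)
  exact contDiffAt_const.mul ((contDiffAt_sign h).mul
    ((((hX 0).div hs hs0).mul contDiffAt_const).add (((hX 1).div hs hs0).mul contDiffAt_const)))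

theorem hasDerivAt_abs (h : D.ValidAt t) : HasDerivAt (fun s => |deriv D.T s|)
    (Real.sign (deriv D.T t) * deriv (deriv D.T) t) t :=
  ((contDiffAt_differentiableAt (contDiffAt_deriv h.smoothT)).hasDerivAt.const_mul
    _).congr_of_eventuallyEq (eventually_abs h)

theorem hasDerivAt_scale (h : D.ValidAt t) : HasDerivAt D.scale
    (Real.sign (deriv D.T t) * deriv (deriv D.T) t / (2 * D.scale t)) t :=
  (hasDerivAt_abs h).sqrt (abs_pos.2 h.deriv_ne).ne'

theorem hasDerivAt_phase2 (h : D.ValidAt t) : HasDerivAt D.phase2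
    (1 / 8 * ((deriv (deriv (deriv D.T)) t * |deriv D.T t|
      - deriv (deriv D.T) t * (Real.sign (deriv D.T t) * deriv (deriv D.T) t))
        / |deriv D.T t| ^ 2)) t := by
  unfold phase2
  rw [iteratedDeriv_two_eq]
  exact ((contDiffAt_differentiableAt (contDiffAt_deriv
    (contDiffAt_deriv h.smoothT))).hasDerivAt.div (hasDerivAt_abs h)
      (abs_pos.2 h.deriv_ne).ne').const_mul _

theorem hasDerivAt_phase1 (h : D.ValidAt t) (a : Fin 2) : HasDerivAt (D.phase1 a)
    (1 / 2 * (Real.sign (deriv D.T t) * (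
      (deriv (deriv (D.X 0)) t * D.scale t - deriv (D.X 0) t
        * (Real.sign (deriv D.T t) * deriv (deriv D.T) t / (2 * D.scale t))) / D.scale t ^ 2
          * D.O 0 a
      + (deriv (deriv (D.X 1)) t * D.scale t - deriv (D.X 1) t
        * (Real.sign (deriv D.T t) * deriv (deriv D.T) t / (2 * D.scale t))) / D.scale t ^ 2
          * D.O 1 a))) t := by
  have hs := hasDerivAt_scale h
  have hs0 := (scale_pos h).ne'
  have hX := fun b => (contDiffAt_differentiableAt (contDiffAt_deriv (h.smoothX b))).hasDerivAt
  have h1 := (((((hX 0).div hs hs0).mul_const (D.O 0 a)).add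
    (((hX 1).div hs hs0).mul_const (D.O 1 a))).const_mul (Real.sign (deriv D.T t))).const_mul
      (1 / 2 : ℝ)
  refine h1.congr_of_eventuallyEq ?_
  filter_upwards [eventually_sign h] with s hs
  simp only [phase1, hs]
  rfl

theorem orth_rel (h : D.ValidAt t) :
    D.O 0 0 ^ 2 + D.O 0 1 ^ 2 = 1 ∧ D.O 1 0 ^ 2 + D.O 1 1 ^ 2 = 1 ∧
      D.O 0 0 * D.O 1 0 + D.O 0 1 * D.O 1 1 = 0 := by
  have h1 := (Matrix.mem_orthogonalGroup_iff (Fin 2) ℝ).1 h.orth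
  have e := fun i j => congrFun (congrFun h1 i) j
  have e00 := e 0 0
  have e11 := e 1 1
  have e01 := e 0 1
  simp [Matrix.mul_apply, Fin.sum_univ_two] at e00 e11 e01
  refine ⟨by linarith, by linarith, by linarith⟩

theorem orth_rel' (h : D.ValidAt t) :
    D.O 0 0 ^ 2 + D.O 1 0 ^ 2 = 1 ∧ D.O 0 1 ^ 2 + D.O 1 1 ^ 2 = 1 ∧
      D.O 0 0 * D.O 0 1 + D.O 1 0 * D.O 1 1 = 0 := by
  have h1 := (Matrix.mem_orthogonalGroup_iff' (Fin 2) ℝ).1 h.orth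
  have e := fun i j => congrFun (congrFun h1 i) j
  have e00 := e 0 0
  have e11 := e 1 1
  have e01 := e 0 1
  simp [Matrix.mul_apply, Fin.sum_univ_two] at e00 e11 e01
  refine ⟨by linarith, by linarith, by linarith⟩

end Coeffs

namespace Coeffs

variable {D : Coeffs} {z : BaseSpace}

/-- The phase as a function of `(t, x)`. -/
noncomputable def phaseFn (D : Coeffs) (z : BaseSpace) : ℝ :=
  phase D.T D.O D.X D.Ψ z.1 z.2

/-- The derivative of the phase in the direction of `x_a`. -/
noncomputable def grad (D : Coeffs) (a : Fin 2) (z : BaseSpace) : ℝ :=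
  2 * D.phase2 z.1 * z.2 a + D.phase1 a z.1

/-- The derivative of the phase in the direction of `t`. -/
noncomputable def phaseT (D : Coeffs) (z : BaseSpace) : ℝ :=
  deriv D.phase2 z.1 * (z.2 0 * z.2 0 + z.2 1 * z.2 1)
    + (deriv (D.phase1 0) z.1 * z.2 0 + deriv (D.phase1 1) z.1 * z.2 1) + deriv D.Ψ z.1

theorem phaseFn_eq : D.phaseFn = fun z => D.phase2 z.1 * (z.2 0 * z.2 0 + z.2 1 * z.2 1)
      + (D.phase1 0 z.1 * z.2 0 + D.phase1 1 z.1 * z.2 1) + D.Ψ z.1 := by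
  ext z
  exact D.phase_eq z

theorem contDiffAt_phaseFn (h : D.ValidAt z.1) : ContDiffAt ℝ ∞ D.phaseFn z := by
  have hA := contDiffAt_time (contDiffAt_phase2 h)
  have hL := fun a => contDiffAt_time (contDiffAt_phase1 h a)
  have hΨ := contDiffAt_time h.smoothΨ
  rw [phaseFn_eq]
  exact ((hA.mul (((contDiffAt_coord 0 z).mul (contDiffAt_coord 0 z)).add
      ((contDiffAt_coord 1 z).mul (contDiffAt_coord 1 z)))).add
      (((hL 0).mul (contDiffAt_coord 0 z)).add
        ((hL 1).mul (contDiffAt_coord 1 z)))).add hΨ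

theorem fderiv_phaseFn (h : D.ValidAt z.1) (u : BaseSpace) : fderiv ℝ D.phaseFn z u
    = u.1 * D.phaseT z + u.2 0 * D.grad 0 z + u.2 1 * D.grad 1 z := by
  rw [phaseFn_eq, fderiv_timePoly (contDiffAt_differentiableAt (contDiffAt_phase2 h)).hasDerivAt
    (contDiffAt_differentiableAt (contDiffAt_phase1 h 0)).hasDerivAt
    (contDiffAt_differentiableAt (contDiffAt_phase1 h 1)).hasDerivAt
    (contDiffAt_differentiableAt h.smoothΨ).hasDerivAt]
  rfl

theorem D2_phaseFn (h : D.ValidAt z.1) (a : Fin 2) :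
    D2 D.phaseFn z (eb a) (eb a) = 2 * D.phase2 z.1 := by
  rw [phaseFn_eq, D2_timePoly (contDiffAt_phase2 h) (contDiffAt_phase1 h 0)
    (contDiffAt_phase1 h 1) h.smoothΨ]

theorem grad_eq (h : D.ValidAt z.1) (a : Fin 2) : fderiv ℝ D.phaseFn z (eb a) = D.grad a z := by
  rw [fderiv_phaseFn h]
  fin_cases a <;> simp [eb]

theorem alpha_eq : D.alpha = fun z => ((1 / D.scale z.1 : ℝ) : ℂ)
    * Complex.exp (I * (D.phaseFn z : ℂ)) := rfl

theorem _root_.CubicNLS.contDiffAt_ofReal {E : Type*} [NormedAddCommGroup E] [NormedSpace ℝ E]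
    {f : E → ℝ} {z : E} (hf : ContDiffAt ℝ ∞ f z) :
    ContDiffAt ℝ ∞ (fun y => (f y : ℂ)) z :=
  (Complex.ofRealCLM.contDiff.contDiffAt).comp z hf

theorem _root_.CubicNLS.hasFDerivAt_ofReal {E : Type*} [NormedAddCommGroup E] [NormedSpace ℝ E]
    {f : E → ℝ} {f' : E →L[ℝ] ℝ} {z : E} (hf : HasFDerivAt f f' z) :
    HasFDerivAt (fun y => (f y : ℂ)) (Complex.ofRealCLM.comp f') z :=
  Complex.ofRealCLM.hasFDerivAt.comp z hf

theorem contDiffAt_inv_scale {t : ℝ} (h : D.ValidAt t) :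
    ContDiffAt ℝ ∞ (fun s => 1 / D.scale s) t :=
  contDiffAt_const.div (contDiffAt_scale h) (scale_pos h).ne'

theorem contDiffAt_exp_phase (h : D.ValidAt z.1) :
    ContDiffAt ℝ ∞ (fun z => Complex.exp (I * (D.phaseFn z : ℂ))) z :=
  (contDiffAt_const.mul (contDiffAt_ofReal (contDiffAt_phaseFn h))).cexp

theorem contDiffAt_alpha (h : D.ValidAt z.1) : ContDiffAt ℝ ∞ D.alpha z := by
  rw [alpha_eq]
  exact (contDiffAt_ofReal (contDiffAt_time (contDiffAt_inv_scale h))).mul (contDiffAt_exp_phase h)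

theorem alpha_ne_zero (h : D.ValidAt z.1) : D.alpha z ≠ 0 := by
  rw [alpha_eq]
  refine mul_ne_zero ?_ (Complex.exp_ne_zero _)
  exact_mod_cast (one_div_pos.2 (scale_pos h)).ne'

theorem norm_alpha (h : D.ValidAt z.1) : ‖D.alpha z‖ = 1 / D.scale z.1 := by
  rw [alpha_eq]
  simp only
  rw [norm_mul, mul_comm I, Complex.norm_exp_ofReal_mul_I, mul_one, Complex.norm_real,
    Real.norm_eq_abs, abs_of_pos (one_div_pos.2 (scale_pos h))]

theorem norm_alpha_sq (h : D.ValidAt z.1) : |deriv D.T z.1| * ‖D.alpha z‖ ^ 2 = 1 := by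
  rw [norm_alpha h, ← scale_sq]
  have := (scale_pos h).ne'
  field_simp

theorem fderiv_alpha (h : D.ValidAt z.1) (u : BaseSpace) : fderiv ℝ D.alpha z u
    = (-((Real.sign (deriv D.T z.1) * deriv (deriv D.T) z.1 / (2 * D.scale z.1 ^ 2) * u.1 : ℝ) : ℂ)
      + I * ((fderiv ℝ D.phaseFn z u : ℝ) : ℂ)) * D.alpha z := by
  have hs0 := (scale_pos h).ne'
  have h1 := hasFDerivAt_ofReal (hasFDerivAt_time (z := z)
    ((hasDerivAt_const z.1 (1 : ℝ)).div (hasDerivAt_scale h) hs0))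
  have h2 := ((hasFDerivAt_ofReal
    (contDiffAt_differentiableAt (contDiffAt_phaseFn h)).hasFDerivAt).const_mul I).cexp
  have h3 : HasFDerivAt D.alpha _ z := h1.mul h2
  have hs1 : (D.scale z.1 : ℂ) ≠ 0 := by exact_mod_cast hs0
  have hph : phase D.T D.O D.X D.Ψ z.1 z.2 = D.phaseFn z := rfl
  rw [h3.fderiv, alpha_eq]
  simp [hph]
  field_simp
  ring

theorem fderiv_alpha_eb (h : D.ValidAt z.1) (a : Fin 2) :
    fderiv ℝ D.alpha z (eb a) = I * (D.grad a z : ℂ) * D.alpha z := by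
  rw [fderiv_alpha h, grad_eq h]
  simp [eb]

theorem D2_alpha (h : D.ValidAt z.1) (a : Fin 2) : D2 D.alpha z (eb a) (eb a)
    = (2 * I * (D.phase2 z.1 : ℂ) - (D.grad a z : ℂ) ^ 2) * D.alpha z := by
  have hE := contDiffAt_exp_phase h
  have hS := contDiffAt_ofReal (contDiffAt_time (z := z) (contDiffAt_inv_scale h))
  have hθ := contDiffAt_phaseFn h
  have hS1 : fderiv ℝ (fun y : BaseSpace => ((1 / D.scale y.1 : ℝ) : ℂ)) z (eb a) = 0 := by
    have h1 := hasFDerivAt_ofReal (hasFDerivAt_time (z := z)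
      (contDiffAt_differentiableAt (contDiffAt_inv_scale h)).hasDerivAt)
    rw [h1.fderiv]
    simp [eb]
  have hS2 : D2 (fun y : BaseSpace => ((1 / D.scale y.1 : ℝ) : ℂ)) z (eb a) (eb a) = 0 := by
    rw [← fderiv_fderiv_apply hS]
    have : (fun y => fderiv ℝ (fun y : BaseSpace => ((1 / D.scale y.1 : ℝ) : ℂ)) y (eb a))
        =ᶠ[𝓝 z] fun _ => 0 := by
      filter_upwards [(continuous_fst.continuousAt (x := z)).eventually
        (eventually_differentiableAt (contDiffAt_inv_scale h))] with y hy
      rw [(hasFDerivAt_ofReal (hasFDerivAt_time (z := y) hy.hasDerivAt)).fderiv]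
      simp [eb]
    rw [this.fderiv_eq]
    simp
  have hE1 : ∀ᶠ y in 𝓝 z, fderiv ℝ (fun z => Complex.exp (I * (D.phaseFn z : ℂ))) y (eb a)
      = I * ((fderiv ℝ D.phaseFn y (eb a) : ℝ) : ℂ) * Complex.exp (I * (D.phaseFn y : ℂ)) := by
    filter_upwards [eventually_differentiableAt hθ] with y hy
    have := ((hasFDerivAt_ofReal hy.hasFDerivAt).const_mul I).cexp
    rw [this.fderiv]
    simp
    ring
  have hE2 : D2 (fun z => Complex.exp (I * (D.phaseFn z : ℂ))) z (eb a) (eb a)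
      = (2 * I * (D.phase2 z.1 : ℂ) - (D.grad a z : ℂ) ^ 2)
        * Complex.exp (I * (D.phaseFn z : ℂ)) := by
    rw [← fderiv_fderiv_apply hE]
    have hE1' : (fun y => fderiv ℝ (fun z => Complex.exp (I * (D.phaseFn z : ℂ))) y (eb a))
      =ᶠ[𝓝 z] fun y => I * ((fderiv ℝ D.phaseFn y (eb a) : ℝ) : ℂ)
        * Complex.exp (I * (D.phaseFn y : ℂ)) := hE1
    have d1 : DifferentiableAt ℝ (fun y => fderiv ℝ D.phaseFn y (eb a)) z :=
      (contDiffAt_differentiableAt (contDiffAt_fderiv hθ)).clm_apply (differentiableAt_const _)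
    have d2 := ((hasFDerivAt_ofReal d1.hasFDerivAt).const_mul I)
    have d3 := d2.mul (contDiffAt_differentiableAt hE).hasFDerivAt
    have d4 : HasFDerivAt (fun y => I * ((fderiv ℝ D.phaseFn y (eb a) : ℝ) : ℂ)
        * Complex.exp (I * (D.phaseFn y : ℂ))) _ z := d3
    rw [hE1'.fderiv_eq, d4.fderiv]
    simp only [add_apply, smul_apply, ContinuousLinearMap.comp_apply, smul_eq_mul,
      Complex.ofRealCLM_apply, hE1.self_of_nhds, fderiv_fderiv_apply hθ, D2_phaseFn h, grad_eq h]
    push_cast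
    linear_combination (D.grad a z : ℂ) ^ 2 * Complex.exp (I * (D.phaseFn z : ℂ)) * Complex.I_sq
  rw [alpha_eq, D2_mul hS hE, hS1, hS2, hE2]
  ring

theorem contDiffAt_base (h : D.ValidAt z.1) : ContDiffAt ℝ ∞ D.base z := by
  refine (contDiffAt_time h.smoothT).prodMk (contDiffAt_pi.2 fun b => ?_)
  unfold newX
  simp only [Fin.sum_univ_two]
  exact ((contDiffAt_time (contDiffAt_scale h)).mul ((contDiffAt_const.mul
    (contDiffAt_coord 0 z)).add (contDiffAt_const.mul (contDiffAt_coord 1 z)))).add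
      (contDiffAt_time (h.smoothX b))

theorem fderiv_base {s' : ℝ} {X' : Fin 2 → ℝ} {T' : ℝ} (hT : HasDerivAt D.T T' z.1)
    (hs : HasDerivAt D.scale s' z.1) (hX : ∀ b, HasDerivAt (D.X b) (X' b) z.1) (u : BaseSpace) :
    fderiv ℝ D.base z u = (u.1 * T', fun b => u.1 * (s' * (D.O b 0 * z.2 0 + D.O b 1 * z.2 1) + X' b)
      + D.scale z.1 * (D.O b 0 * u.2 0 + D.O b 1 * u.2 1)) := by
  have h1 : ∀ b, HasFDerivAt (fun y : BaseSpace => newX D.T D.O D.X y.1 y.2 b) _ z := fun b => by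
    unfold newX
    simp only [Fin.sum_univ_two]
    exact ((hasFDerivAt_time hs).mul (((hasFDerivAt_coord 0 z).const_mul (D.O b 0)).add
      ((hasFDerivAt_coord 1 z).const_mul (D.O b 1)))).add (hasFDerivAt_time (hX b))
  have h2 : HasFDerivAt D.base _ z := (hasFDerivAt_time hT).prodMk (hasFDerivAt_pi.2 h1)
  rw [h2.fderiv]
  ext b
  · simp
  · simp [coordL_apply]
    ring

theorem D2_base (h : D.ValidAt z.1) (a c : Fin 2) : D2 D.base z (eb a) (eb c) = 0 := by
  rw [← fderiv_fderiv_apply (contDiffAt_base h)]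
  have ht : Filter.Tendsto (fun y : BaseSpace => y.1) (𝓝 z) (𝓝 z.1) := continuous_fst.continuousAt
  have hev : (fun y => fderiv ℝ D.base y (eb c)) =ᶠ[𝓝 z]
      fun y => (fun s => ((0, fun b => D.scale s * D.O b c) : BaseSpace)) y.1 := by
    filter_upwards [ht.eventually (eventually_differentiableAt h.smoothT),
      ht.eventually (eventually_differentiableAt (contDiffAt_scale h)),
      ht.eventually (eventually_differentiableAt (h.smoothX 0)),
      ht.eventually (eventually_differentiableAt (h.smoothX 1))] with y h1 h2 h3 h4
    rw [fderiv_base h1.hasDerivAt h2.hasDerivAt (X' := fun b => deriv (D.X b) y.1)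
      (Fin.forall_fin_two.2 ⟨h3.hasDerivAt, h4.hasDerivAt⟩)]
    ext b
    · simp [eb]
    · fin_cases c <;> simp [eb]
  have hd : DifferentiableAt ℝ (fun s => ((0, fun b => D.scale s * D.O b c) : BaseSpace)) z.1 :=
    (differentiableAt_const _).prodMk (differentiableAt_pi.2 fun b =>
      (contDiffAt_differentiableAt (contDiffAt_scale h)).mul (differentiableAt_const _))
  rw [hev.fderiv_eq, (hasFDerivAt_time (z := z) hd.hasDerivAt).fderiv]
  simp [eb]

theorem baseJet (h : D.ValidAt z.1) : BaseJet D.base z |deriv D.T z.1|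
    (Real.sign (deriv D.T z.1)) (fun a => 2 * I * (D.grad a z : ℂ)) := by
  have hs := hasDerivAt_scale h
  have hd := fun u => fderiv_base (z := z) (contDiffAt_differentiableAt h.smoothT).hasDerivAt hs
    (fun b => (contDiffAt_differentiableAt (h.smoothX b)).hasDerivAt) u
  have hs0 := (scale_pos h).ne'
  obtain ⟨o1, o2, o3⟩ := orth_rel h
  obtain ⟨o4, o5, o6⟩ := orth_rel' h
  refine ⟨contDiffAt_base h, abs_pos.2 h.deriv_ne, ?_, ?_, ?_, ?_, ?_, ?_, ?_⟩
  · intro a; simp [hd, eb]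
  · intro a; simp [D2_base h]
  · simp [hd, tb, sign_mul_deriv]
  · rw [← scale_sq]; simp [hd, eb]
    linear_combination D.scale z.1 ^ 2 * o1
  · rw [← scale_sq]; simp [hd, eb]
    linear_combination D.scale z.1 ^ 2 * o2
  · simp [hd, eb]
    linear_combination D.scale z.1 ^ 2 * o3
  · have hr : ∀ a, D.scale z.1 ^ 2 * (2 * D.grad a z) = Real.sign (deriv D.T z.1)
        * ((fderiv ℝ D.base z tb).2 0 * (fderiv ℝ D.base z (eb a)).2 0
          + (fderiv ℝ D.base z tb).2 1 * (fderiv ℝ D.base z (eb a)).2 1) := by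
      refine Fin.forall_fin_two.2 ⟨?_, ?_⟩
      · simp [hd, eb, tb, grad, phase2, phase1, iteratedDeriv_two_eq, ← scale_sq]
        rcases sign_deriv h with hκ | hκ <;> rw [hκ] <;> field_simp
        · linear_combination (-8 * deriv (deriv D.T) z.1 * z.2 0) * o4
            - 8 * deriv (deriv D.T) z.1 * z.2 1 * o6
        · linear_combination (-8 * deriv (deriv D.T) z.1 * z.2 0) * o4
            - 8 * deriv (deriv D.T) z.1 * z.2 1 * o6
      · simp [hd, eb, tb, grad, phase2, phase1, iteratedDeriv_two_eq, ← scale_sq]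
        rcases sign_deriv h with hκ | hκ <;> rw [hκ] <;> field_simp
        · linear_combination (-8 * deriv (deriv D.T) z.1 * z.2 1) * o5
            - 8 * deriv (deriv D.T) z.1 * z.2 0 * o6
        · linear_combination (-8 * deriv (deriv D.T) z.1 * z.2 1) * o5
            - 8 * deriv (deriv D.T) z.1 * z.2 0 * o6
    intro a
    have h1 := congrArg (fun x : ℝ => (x : ℂ)) (hr a)
    simp only [D2_base h, ← scale_sq]
    push_cast at h1 ⊢
    simp only [Prod.snd_zero, Pi.zero_apply, ofReal_zero, add_zero, zero_mul]
    linear_combination I * h1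

theorem phase1_sq {t : ℝ} (h : D.ValidAt t) : D.phase1 0 t ^ 2 + D.phase1 1 t ^ 2
    = (deriv (D.X 0) t ^ 2 + deriv (D.X 1) t ^ 2) / (4 * D.scale t ^ 2) := by
  obtain ⟨o1, o2, o3⟩ := orth_rel h
  have hs0 := (scale_pos h).ne'
  have hκ : Real.sign (deriv D.T t) ^ 2 = 1 := by
    rcases sign_deriv h with h1 | h1 <;> rw [h1] <;> norm_num
  have h1 : ∀ a, D.phase1 a t = Real.sign (deriv D.T t)
      * ((deriv (D.X 0) t * D.O 0 a + deriv (D.X 1) t * D.O 1 a) / (2 * D.scale t)) := by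
    intro a
    unfold phase1
    field_simp
  rw [h1, h1, mul_pow, mul_pow, hκ]
  field_simp
  linear_combination 4 * deriv (D.X 0) t ^ 2 * o1 + 4 * deriv (D.X 1) t ^ 2 * o2
    + 8 * deriv (D.X 0) t * deriv (D.X 1) t * o3

theorem pot_eq (h : D.ValidAt z.1) (v : ℂ) : |deriv D.T z.1| * D.pot z v
    = hat (deriv D.T z.1) v + ((Real.sign (deriv D.T z.1) * D.phaseT z
      - (D.grad 0 z ^ 2 + D.grad 1 z ^ 2) : ℝ) : ℂ) := by
  have hs0 := (scale_pos h).ne'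
  have hT0 := (abs_pos.2 h.deriv_ne).ne'
  have hTc : ((|deriv D.T z.1| : ℝ) : ℂ) ≠ 0 := by exact_mod_cast hT0
  have hdX : ∀ b, deriv (fun s => deriv (D.X b) s / deriv D.T s) z.1
      = (deriv (deriv (D.X b)) z.1 * deriv D.T z.1 - deriv (D.X b) z.1 * deriv (deriv D.T) z.1)
        / deriv D.T z.1 ^ 2 := fun b =>
    ((contDiffAt_differentiableAt (contDiffAt_deriv (h.smoothX b))).hasDerivAt.div
      (contDiffAt_differentiableAt (contDiffAt_deriv h.smoothT)).hasDerivAt h.deriv_ne).deriv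
  rw [pot, newV, mul_add, mul_div_cancel₀ _ hTc]
  congr 1
  rw [← Complex.ofReal_mul]
  congr 1
  have hg : D.grad 0 z ^ 2 + D.grad 1 z ^ 2
      = 4 * D.phase2 z.1 ^ 2 * (z.2 0 * z.2 0 + z.2 1 * z.2 1)
        + 4 * D.phase2 z.1 * (D.phase1 0 z.1 * z.2 0 + D.phase1 1 z.1 * z.2 1)
        + (deriv (D.X 0) z.1 ^ 2 + deriv (D.X 1) z.1 ^ 2) / (4 * D.scale z.1 ^ 2) := by
    rw [← phase1_sq h]
    unfold grad
    ring
  have hT : deriv D.T z.1 = Real.sign (deriv D.T z.1) * D.scale z.1 ^ 2 := by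
    rw [scale_sq, ← sign_mul_deriv]
    rcases sign_deriv h with h1 | h1 <;> rw [h1] <;> ring
  have hsc : Real.sqrt |deriv D.T z.1| = D.scale z.1 := rfl
  rw [hg, phaseT, (hasDerivAt_phase2 h).deriv, (hasDerivAt_phase1 h 0).deriv,
    (hasDerivAt_phase1 h 1).deriv]
  simp only [Fin.sum_univ_two, hdX, phase1, phase2, iteratedDeriv_two_eq, iteratedDeriv_three_eq,
    hsc]
  simp only [← scale_sq]
  rcases sign_deriv h with hκ | hκ
  · rw [hκ, one_mul] at hT
    rw [hκ, hT]
    field_simp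
    ring
  · rw [hκ] at hT
    rw [hκ, hT]
    field_simp
    ring

end Coeffs

section SmoothMaps

variable {E : Type} [NormedAddCommGroup E] [NormedSpace ℝ E]

/-- Fibrewise affine maps are local diffeomorphisms if they are so on the base. -/
theorem fibre_affine_immersion {M : E × ℂ → E × ℂ} {m : E → E} {a b : E → ℂ} {c : ℝ} {p : E × ℂ}
    (hm : ContDiffAt ℝ ∞ m p.1) (ha : ContDiffAt ℝ ∞ a p.1) (hb : ContDiffAt ℝ ∞ b p.1)
    (ha0 : a p.1 ≠ 0) (hinj : Function.Injective (fderiv ℝ m p.1))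
    (hM : ∀ᶠ q in 𝓝 p, M q = (m q.1, a q.1 * hat c q.2 + b q.1)) :
    ContDiffAt ℝ ∞ M p ∧ Function.Injective (fderiv ℝ M p) := by
  have hM' : M =ᶠ[𝓝 p] fun q => (m q.1, a q.1 * hat c q.2 + b q.1) := hM
  have hm1 : ContDiffAt ℝ ∞ (fun q : E × ℂ => m q.1) p := ContDiffAt.comp p hm contDiffAt_fst
  have ha1 : ContDiffAt ℝ ∞ (fun q : E × ℂ => a q.1) p := ContDiffAt.comp p ha contDiffAt_fst
  have hb1 : ContDiffAt ℝ ∞ (fun q : E × ℂ => b q.1) p := ContDiffAt.comp p hb contDiffAt_fst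
  have hh : ContDiffAt ℝ ∞ (fun q : E × ℂ => hat c q.2) p := contDiffAt_hat contDiffAt_snd c
  have hs : ContDiffAt ℝ ∞ (fun q : E × ℂ => (m q.1, a q.1 * hat c q.2 + b q.1)) p :=
    hm1.prodMk ((ha1.mul hh).add hb1)
  refine ⟨hs.congr_of_eventuallyEq hM', ?_⟩
  rw [hM'.fderiv_eq]
  have d1 := (contDiffAt_differentiableAt hm).hasFDerivAt.comp p (hasFDerivAt_fst (p := p))
  have d2 := (contDiffAt_differentiableAt ha).hasFDerivAt.comp p (hasFDerivAt_fst (p := p))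
  have d3 := (contDiffAt_differentiableAt hb).hasFDerivAt.comp p (hasFDerivAt_fst (p := p))
  have d4 : HasFDerivAt (fun q : E × ℂ => hat c q.2) ((hatL c).comp
      (ContinuousLinearMap.snd ℝ E ℂ)) p := by
    simp only [← hatL_apply]
    exact (hatL c).hasFDerivAt.comp p hasFDerivAt_snd
  have d5 : HasFDerivAt (fun q : E × ℂ => (m q.1, a q.1 * hat c q.2 + b q.1)) _ p :=
    d1.prodMk ((d2.mul d4).add d3)
  rw [d5.fderiv, injective_iff_map_eq_zero]
  rintro ⟨u, h⟩ huh
  have h1 : fderiv ℝ m p.1 u = 0 := congrArg Prod.fst huh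
  have h2 : u = 0 := hinj (by rw [h1, map_zero])
  subst h2
  have h3 := congrArg Prod.snd huh
  simp [hatL_apply, ha0] at h3
  simpa [hat_eq_zero] using h3

theorem contDiffAt_symm_of_immersion [FiniteDimensional ℝ E] {e : OpenPartialHomeomorph E E}
    {M : E → E} {p : E} (hp : p ∈ e.source) (heM : ∀ᶠ q in 𝓝 p, e q = M q)
    (hM : ContDiffAt ℝ ∞ M p) (hinj : Function.Injective (fderiv ℝ M p)) :
    ContDiffAt ℝ ∞ e.symm (e p) := by
  obtain ⟨n, hn, -, -, hl⟩ := exists_smooth_inverse hM hinj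
  rw [heM.self_of_nhds]
  refine hn.congr_of_eventuallyEq ?_
  rw [← heM.self_of_nhds]
  have hc := e.continuousAt_symm (e.map_source hp)
  rw [ContinuousAt, e.left_inv hp] at hc
  filter_upwards [hc.eventually heM, hc.eventually hl, e.open_target.mem_nhds (e.map_source hp)]
    with y h1 h2 h3
  rw [← h1, e.right_inv h3] at h2
  exact h2.symm

theorem isPointTransformation_of_immersion [FiniteDimensional ℝ E] {e : OpenPartialHomeomorph E E}
    (h : ∀ p ∈ e.source, ∃ M : E → E, (∀ᶠ q in 𝓝 p, e q = M q) ∧ ContDiffAt ℝ ∞ M p ∧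
      Function.Injective (fderiv ℝ M p)) : IsPointTransformation e := by
  constructor
  · intro p hp
    obtain ⟨M, h1, h2, -⟩ := h p hp
    exact (h2.congr_of_eventuallyEq h1).contDiffWithinAt
  · intro y hy
    obtain ⟨M, h1, h2, h3⟩ := h _ (e.map_target hy)
    have := contDiffAt_symm_of_immersion (e.map_target hy) h1 h2 h3
    rw [e.right_inv hy] at this
    exact this.contDiffWithinAt

theorem exists_local_homeo [FiniteDimensional ℝ E] {M : E → E} {p : E}
    (hM : ContDiffAt ℝ ∞ M p) (hinj : Function.Injective (fderiv ℝ M p)) :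
    ∃ b : OpenPartialHomeomorph E E, p ∈ b.source ∧ ∀ q, b q = M q := by
  have : CompleteSpace E := FiniteDimensional.complete ℝ E
  let L : E ≃L[ℝ] E :=
    (LinearEquiv.ofInjectiveEndo (fderiv ℝ M p).toLinearMap hinj).toContinuousLinearEquiv
  have hL : HasFDerivAt M (L : E →L[ℝ] E) p := by
    convert (contDiffAt_differentiableAt hM).hasFDerivAt using 1
    exact ContinuousLinearMap.ext fun u => rfl
  exact ⟨hM.toOpenPartialHomeomorph M hL (by norm_num),
    hM.mem_toOpenPartialHomeomorph_source hL (by norm_num), fun _ => rfl⟩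

end SmoothMaps

namespace Coeffs

variable {D : Coeffs}

theorem eventually_hat {t : ℝ} (h : D.ValidAt t) :
    ∀ᶠ s in 𝓝 t, ∀ β, hat (deriv D.T s) β = hat (Real.sign (deriv D.T t)) β := by
  have hc := (contDiffAt_deriv h.smoothT).continuousAt
  rcases lt_or_gt_of_ne h.deriv_ne with h1 | h1
  · filter_upwards [hc.eventually (gt_mem_nhds h1)] with s hs β
    rw [Real.sign_of_neg h1]
    exact hat_congr ⟨fun h => absurd h (not_lt.2 hs.le), fun h => by norm_num at h⟩ β
  · filter_upwards [hc.eventually (lt_mem_nhds h1)] with s hs β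
    rw [Real.sign_of_pos h1]
    exact hat_congr ⟨fun _ => one_pos, fun _ => hs⟩ β

theorem injective_fderiv_base {z : BaseSpace} (h : D.ValidAt z.1) :
    Function.Injective (fderiv ℝ D.base z) := by
  rw [injective_iff_map_eq_zero]
  intro u hu
  rw [fderiv_base (contDiffAt_differentiableAt h.smoothT).hasDerivAt (hasDerivAt_scale h)
    (fun b => (contDiffAt_differentiableAt (h.smoothX b)).hasDerivAt)] at hu
  have h1 : u.1 * deriv D.T z.1 = 0 := congrArg Prod.fst hu
  have h2 : u.1 = 0 := (mul_eq_zero.1 h1).resolve_right h.deriv_ne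
  have h3 : ∀ b, D.O b 0 * u.2 0 + D.O b 1 * u.2 1 = 0 := by
    intro b
    have := congrFun (congrArg Prod.snd hu) b
    simp only [h2, zero_mul, zero_add, Prod.snd_zero, Pi.zero_apply] at this
    exact (mul_eq_zero.1 this).resolve_left (scale_pos h).ne'
  obtain ⟨o4, o5, o6⟩ := orth_rel' h
  refine Prod.ext h2 (funext (Fin.forall_fin_two.2 ⟨?_, ?_⟩))
  · change u.2 0 = 0
    linear_combination D.O 0 0 * h3 0 + D.O 1 0 * h3 1 - u.2 0 * o4 - u.2 1 * o6
  · change u.2 1 = 0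
    linear_combination D.O 0 1 * h3 0 + D.O 1 1 * h3 1 - u.2 1 * o5 - u.2 0 * o6

theorem eventually_map {p : VarSpace} (h : D.ValidAt p.1.1) : ∀ᶠ q in 𝓝 p,
    D.map q = (D.base q.1, D.alpha q.1 * hat (Real.sign (deriv D.T p.1.1)) q.2 + 0) := by
  have ht : Filter.Tendsto (fun q : VarSpace => q.1.1) (𝓝 p) (𝓝 p.1.1) :=
    (continuous_fst.comp continuous_fst).continuousAt
  filter_upwards [ht.eventually (eventually_hat h)] with q hq
  rw [map, newPsi_eq, hq, add_zero]

theorem map_immersion {p : VarSpace} (h : D.ValidAt p.1.1) :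
    ContDiffAt ℝ ∞ D.map p ∧ Function.Injective (fderiv ℝ D.map p) :=
  fibre_affine_immersion (contDiffAt_base h) (contDiffAt_alpha h) contDiffAt_const
    (alpha_ne_zero h) (injective_fderiv_base h) (eventually_map h)

theorem contDiffAt_phaseT {z : BaseSpace} (h : D.ValidAt z.1) : ContDiffAt ℝ ∞ D.phaseT z := by
  have h2 := contDiffAt_time (contDiffAt_deriv (contDiffAt_phase2 h))
  have h1 := fun a => contDiffAt_time (contDiffAt_deriv (contDiffAt_phase1 h a))
  have h0 := contDiffAt_time (contDiffAt_deriv h.smoothΨ)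
  have c0 := contDiffAt_coord 0 z
  have c1 := contDiffAt_coord 1 z
  exact ((h2.mul ((c0.mul c0).add (c1.mul c1))).add (((h1 0).mul c0).add ((h1 1).mul c1))).add h0

theorem contDiffAt_grad {z : BaseSpace} (h : D.ValidAt z.1) (a : Fin 2) :
    ContDiffAt ℝ ∞ (D.grad a) z :=
  ((contDiffAt_const.mul (contDiffAt_time (contDiffAt_phase2 h))).mul (contDiffAt_coord a z)).add
    (contDiffAt_time (contDiffAt_phase1 h a))

/-- The inhomogeneous part of the transformation of the potential. -/
noncomputable def shift (D : Coeffs) (z : BaseSpace) : ℂ :=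
  ((Real.sign (deriv D.T z.1) * D.phaseT z - (D.grad 0 z ^ 2 + D.grad 1 z ^ 2) : ℝ) : ℂ)
    / ((|deriv D.T z.1| : ℝ) : ℂ)

theorem pot_eq' {z : BaseSpace} (h : D.ValidAt z.1) (v : ℂ) : D.pot z v
    = (((|deriv D.T z.1|)⁻¹ : ℝ) : ℂ) * hat (deriv D.T z.1) v + D.shift z := by
  have hTc : ((|deriv D.T z.1| : ℝ) : ℂ) ≠ 0 := by exact_mod_cast (abs_pos.2 h.deriv_ne).ne'
  rw [shift, ← sub_eq_of_eq_add' (pot_eq h v)]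
  push_cast
  field_simp
  ring

theorem contDiffAt_inv_abs {t : ℝ} (h : D.ValidAt t) :
    ContDiffAt ℝ ∞ (fun s => (|deriv D.T s|)⁻¹) t :=
  (contDiffAt_abs h).inv (abs_pos.2 h.deriv_ne).ne'

theorem contDiffAt_shift {z : BaseSpace} (h : D.ValidAt z.1) : ContDiffAt ℝ ∞ D.shift z := by
  have h1 : ContDiffAt ℝ ∞ (fun z => (Real.sign (deriv D.T z.1) * D.phaseT z
      - (D.grad 0 z ^ 2 + D.grad 1 z ^ 2)) / |deriv D.T z.1|) z :=
    (((contDiffAt_time (contDiffAt_sign h)).mul (contDiffAt_phaseT h)).sub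
      (((contDiffAt_grad h 0).pow 2).add ((contDiffAt_grad h 1).pow 2))).div
        (contDiffAt_time (contDiffAt_abs h)) (abs_pos.2 h.deriv_ne).ne'
  have h2 : D.shift = fun z => (((Real.sign (deriv D.T z.1) * D.phaseT z
      - (D.grad 0 z ^ 2 + D.grad 1 z ^ 2)) / |deriv D.T z.1| : ℝ) : ℂ) := by
    ext z
    rw [Complex.ofReal_div]
    rfl
  rw [h2]
  exact contDiffAt_ofReal h1

/-- The parameters are smooth and nondegenerate on the open set `J`. -/
structure ValidOn (D : Coeffs) (J : Set ℝ) : Prop where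
  isOpen : IsOpen J
  valid : ∀ t ∈ J, D.ValidAt t

theorem ext_immersion {J : Set ℝ} (hJ : D.ValidOn J) {q : ExtSpace} (hq : q.1.1.1 ∈ J) :
    ContDiffAt ℝ ∞ D.ext q ∧ Function.Injective (fderiv ℝ D.ext q) := by
  have h := hJ.valid _ hq
  have ht : Filter.Tendsto (fun q : ExtSpace => q.1.1.1) (𝓝 q) (𝓝 q.1.1.1) :=
    (continuous_fst.comp (continuous_fst.comp continuous_fst)).continuousAt
  refine fibre_affine_immersion (m := D.map)
    (a := fun p : VarSpace => (((|deriv D.T p.1.1|)⁻¹ : ℝ) : ℂ))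
    (b := fun p : VarSpace => D.shift p.1) (c := Real.sign (deriv D.T q.1.1.1)) (map_immersion h).1
    ?_ ?_ ?_ (map_immersion h).2 ?_
  · exact contDiffAt_ofReal (ContDiffAt.comp (g := fun z : BaseSpace => (|deriv D.T z.1|)⁻¹)
      (f := fun p : VarSpace => p.1) q.1 (contDiffAt_time (contDiffAt_inv_abs h)) contDiffAt_fst)
  · exact ContDiffAt.comp (g := D.shift) q.1 (contDiffAt_shift h) contDiffAt_fst
  · exact_mod_cast (inv_pos.2 (abs_pos.2 h.deriv_ne)).ne'
  · filter_upwards [ht.eventually (eventually_hat h), ht.eventually (hJ.isOpen.mem_nhds hq)]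
      with q' h1 h2
    rw [ext, pot_eq' (hJ.valid _ h2), h1]

/-- The transformation of the left-hand side of the equation under an explicit transformation. -/
theorem lhs_map (V V' : Potential) {z : BaseSpace} (h : D.ValidAt z.1) {f g : BaseSpace → ℂ}
    (hf : ContDiffAt ℝ ∞ f z) (hg : ContDiffAt ℝ ∞ g (D.base z))
    (hfg : ∀ᶠ y in 𝓝 z, (D.map (y, f y)).2 = g (D.map (y, f y)).1) :
    |deriv D.T z.1| * lhs V' g (D.base z)
      = D.alpha z * hat (Real.sign (deriv D.T z.1)) (lhs V f z)
        + |deriv D.T z.1| * (V'.toFun (D.base z) - D.pot z (V.toFun z))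
          * (D.alpha z * hat (Real.sign (deriv D.T z.1)) (f z)) := by
  have ht : Filter.Tendsto (fun y : BaseSpace => y.1) (𝓝 z) (𝓝 z.1) := continuous_fst.continuousAt
  have hev := ht.eventually (eventually_hat h)
  have hk := sign_deriv h
  rw [lhs_pullback V' (baseJet h) (D := fun y => (D.map (y, f y)).2) hg hfg,
    pulledOperator_affine V V' (α := D.alpha) (γ := fun _ => 0) (f := f) _ hk (contDiffAt_alpha h)
    contDiffAt_const hf (by
      filter_upwards [hev] with y hy
      rw [map, newPsi_eq, hy, add_zero])]
  have h0 : D2 (fun _ : BaseSpace => (0 : ℂ)) z = 0 := by simp [D2]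
  have hph : fderiv ℝ D.phaseFn z tb = D.phaseT z := by
    rw [fderiv_phaseFn h]; simp [tb]
  have hn := congrArg (fun x : ℝ => (x : ℂ)) (norm_alpha_sq h)
  have hp := pot_eq h (V.toFun z)
  rw [hev.self_of_nhds] at hp
  have hsc : (D.scale z.1 : ℂ) ^ 2 = ((|deriv D.T z.1| : ℝ) : ℂ) := by
    exact_mod_cast scale_sq (D := D) z.1
  have hA0 : ((|deriv D.T z.1| : ℝ) : ℂ) ≠ 0 := by exact_mod_cast (abs_pos.2 h.deriv_ne).ne'
  have hk2 : (Real.sign (deriv D.T z.1) : ℂ) ^ 2 = 1 := by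
    rcases hk with h1 | h1 <;> rw [h1] <;> norm_num
  simp only [h0, fderiv_fun_const, Pi.zero_apply, zero_apply, fderiv_alpha_eb h, D2_alpha h,
    fderiv_alpha h tb, hph, norm_mul, norm_hat, mul_pow, add_zero, phase2, iteratedDeriv_two_eq]
  push_cast at hn hp ⊢
  rw [hsc]
  simp only [tb, ofReal_one, mul_one]
  generalize hat (Real.sign (deriv D.T z.1)) (f z) = φ
  generalize hat (Real.sign (deriv D.T z.1)) (V.toFun z) = v at *
  generalize (Real.sign (deriv D.T z.1) : ℂ) = k at *
  generalize ((|deriv D.T z.1| : ℝ) : ℂ) = m at *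
  linear_combination ((‖f z‖ : ℂ) ^ 2 * D.alpha z * φ) * hn
    + ((k * D.phaseT z - 2 * D.grad 0 z ^ 2 - 2 * D.grad 1 z ^ 2) * D.alpha z * φ) * Complex.I_sq
    - (I * ((deriv (deriv D.T) z.1 : ℝ) : ℂ) / (2 * m) * D.alpha z * φ) * hk2 + (D.alpha z * φ) * hp

end Coeffs

/-- `e` coincides with the explicit transformation `D.map` near `p`. -/
def ExplicitNear (e : OpenPartialHomeomorph VarSpace VarSpace) (D : Coeffs) (p : VarSpace) : Prop :=
  (∃ J, D.ValidOn J ∧ p.1.1 ∈ J) ∧ ∀ᶠ q in 𝓝 p, e q = D.map q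

theorem ExplicitNear.validAt {e : OpenPartialHomeomorph VarSpace VarSpace} {D : Coeffs}
    {p : VarSpace} (h : ExplicitNear e D p) : D.ValidAt p.1.1 := by
  obtain ⟨⟨J, hJ, hp⟩, -⟩ := h
  exact hJ.valid _ hp

theorem ExplicitNear.eventually {e : OpenPartialHomeomorph VarSpace VarSpace} {D : Coeffs}
    {p : VarSpace} (h : ExplicitNear e D p) : ∀ᶠ q in 𝓝 p, ExplicitNear e D q := by
  obtain ⟨⟨J, hJ, hp⟩, hev⟩ := h
  have ht : Filter.Tendsto (fun q : VarSpace => q.1.1) (𝓝 p) (𝓝 p.1.1) :=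
    (continuous_fst.comp continuous_fst).continuousAt
  filter_upwards [eventually_eventually_nhds.2 hev, ht.eventually (hJ.isOpen.mem_nhds hp)]
    with q h1 h2
  exact ⟨⟨J, hJ, h2⟩, h1⟩

theorem admissible_of_explicit {V V' : Potential} {e : OpenPartialHomeomorph VarSpace VarSpace}
    (hdom : ∀ p ∈ e.source, p.1 ∈ V.domain ∧ (e p).1 ∈ V'.domain)
    (h : ∀ p ∈ e.source, ∃ D : Coeffs, ExplicitNear e D p ∧
      V'.toFun (D.base p.1) = D.pot p.1 (V.toFun p.1)) : e ∈ admissible V V' := by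
  refine ⟨isPointTransformation_of_immersion fun p hp => ?_, hdom, ?_⟩
  · obtain ⟨D, hD, -⟩ := h p hp
    exact ⟨D.map, hD.2, Coeffs.map_immersion hD.validAt⟩
  · intro f g z w hf hg hm
    obtain ⟨D, hD, hV⟩ := h _ hm.1
    have hw : D.base z = w := by
      have := hD.2.self_of_nhds
      rw [hm.2.1] at this
      exact (congrArg Prod.fst this).symm
    rw [← hw] at hg ⊢
    have hval : D.ValidAt z.1 := hD.validAt
    have hc : Filter.Tendsto (fun y => (y, f y)) (𝓝 z) (𝓝 (z, f z)) :=
      (contDiffAt_graph hf).continuousAt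
    have key := Coeffs.lhs_map V V' hval hf hg (by
      filter_upwards [hc.eventually hD.2, hm.2.2] with y h1 h2
      rw [← h1, h2])
    simp only at hV
    rw [hV, sub_self, mul_zero, zero_mul, add_zero] at key
    have hT : ((|deriv D.T z.1| : ℝ) : ℂ) ≠ 0 := by
      exact_mod_cast (abs_pos.2 hval.deriv_ne).ne'
    constructor
    · intro h0
      rw [h0, hat_zero, mul_zero] at key
      exact (mul_eq_zero.1 key).resolve_left hT
    · intro h0
      rw [h0, mul_zero] at key
      exact hat_eq_zero.1 ((mul_eq_zero.1 key.symm).resolve_left (Coeffs.alpha_ne_zero hval))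

/-- The new potential is determined by the transformation and the old potential. -/
theorem potential_eq {V V' : Potential} {e : OpenPartialHomeomorph VarSpace VarSpace}
    (he : e ∈ admissible V V') {p : VarSpace} (hp : p ∈ e.source) {D : Coeffs}
    (hD : ExplicitNear e D p) : V'.toFun (e p).1 = D.pot p.1 (V.toFun p.1) := by
  obtain ⟨z, ψ₀⟩ := p
  have hw0 : (e (z, ψ₀)).1 = D.base z := congrArg Prod.fst hD.2.self_of_nhds
  rw [hw0]
  have hc : Filter.Tendsto (fun ψ : ℂ => ((z, ψ) : VarSpace)) (𝓝 ψ₀) (𝓝 (z, ψ₀)) :=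
    (continuous_const.prodMk continuous_id).continuousAt
  have hev : ∀ᶠ ψ in 𝓝 ψ₀, (z, ψ) ∈ e.source ∧ ExplicitNear e D (z, ψ) :=
    (hc.eventually (e.open_source.mem_nhds hp)).and (hc.eventually hD.eventually)
  have hfr : ∃ᶠ ψ in 𝓝 ψ₀, ψ ∈ ({0} : Set ℂ)ᶜ :=
    mem_closure_iff_frequently.1 (dense_compl_singleton (0 : ℂ) ψ₀)
  obtain ⟨ψ, hψ0, hsrc, hE⟩ := (hfr.and_eventually hev).exists
  have hval : D.ValidAt z.1 := hE.validAt
  let σ : BaseSpace →L[ℝ] BaseSpace →L[ℝ] ℂ := (coordL 0).smulRight ((coordL 0).smulRight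
    (-(((‖ψ‖ ^ 2 : ℝ) : ℂ) * ψ + V.toFun z * ψ) / 2))
  have hfs : ContDiffAt ℝ ∞ (quad z ψ 0 σ) z := (contDiff_quad _ _ _ _).contDiffAt
  have hfz : quad z ψ 0 σ z = ψ := quad_self _ _ _ _
  have hlhs : lhs V (quad z ψ 0 σ) z = 0 := by
    rw [lhs_eq V hfs, fderiv_quad_self, D2_quad, D2_quad, hfz]
    simp [σ, coordL_apply, eb]
  obtain ⟨hv, hinj, -⟩ := fibre_preserving he hsrc
  have hsplit : ∀ u h, (fderiv ℝ e (z, ψ) (u, h)).1 = (fderiv ℝ e (z, ψ) (u, 0)).1 := by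
    intro u h
    have : ((u, h) : VarSpace) = (u, 0) + (0, h) := by simp
    rw [this, map_add, Prod.fst_add, hv, add_zero]
  obtain ⟨g, n, hg, hm, -⟩ := exists_image he.1 hfs (by rwa [hfz])
    (by rw [hfz]; simpa only [hsplit] using hinj)
  have hw : (e (z, ψ)).1 = D.base z := congrArg Prod.fst hE.2.self_of_nhds
  rw [hfz, hw] at hg hm
  have h0 := (he.2.2 _ g z _ hfs hg hm).1 hlhs
  have hcg : Filter.Tendsto (fun y => (y, quad z ψ 0 σ y)) (𝓝 z) (𝓝 (z, ψ)) := by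
    have := (contDiffAt_graph hfs).continuousAt.tendsto
    rwa [hfz] at this
  have key := Coeffs.lhs_map V V' hval hfs hg (by
    filter_upwards [hcg.eventually hE.2, hm.2.2] with y h1 h2
    rw [← h1, h2])
  rw [h0, hlhs, hat_zero, mul_zero, mul_zero, zero_add, hfz] at key
  have hT : ((|deriv D.T z.1| : ℝ) : ℂ) ≠ 0 := by
    exact_mod_cast (abs_pos.2 hval.deriv_ne).ne'
  have hne : D.alpha z * hat (Real.sign (deriv D.T z.1)) ψ ≠ 0 :=
    mul_ne_zero (Coeffs.alpha_ne_zero hval) (fun h => hψ0 (hat_eq_zero.1 h))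
  have := (mul_eq_zero.1 ((mul_eq_zero.1 key.symm).resolve_right hne)).resolve_left hT
  exact sub_eq_zero.1 this

theorem constant_on_ball {E F : Type*} [NormedAddCommGroup E] [NormedSpace ℝ E]
    [NormedAddCommGroup F] [NormedSpace ℝ F] {f : E → F} {c : E} {r : ℝ}
    (h : ∀ y ∈ Metric.ball c r, HasFDerivAt f (0 : E →L[ℝ] F) y) {y : E}
    (hy : y ∈ Metric.ball c r) : f y = f c := by
  have hr : 0 < r := lt_of_le_of_lt dist_nonneg (Metric.mem_ball.1 hy)
  refine Metric.isOpen_ball.is_const_of_fderiv_eq_zero (𝕜 := ℝ)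
    (convex_ball c r).isPreconnected (fun y hy => (h y hy).differentiableAt.differentiableWithinAt)
    (fun y hy => (h y hy).fderiv) hy (Metric.mem_ball_self hr)

theorem mem_ball_prod {E F : Type*} [SeminormedAddCommGroup E] [SeminormedAddCommGroup F] {q p : E × F}
    {r : ℝ} : q ∈ Metric.ball p r ↔ q.1 ∈ Metric.ball p.1 r ∧ q.2 ∈ Metric.ball p.2 r := by
  obtain ⟨p1, p2⟩ := p
  rw [← ball_prod_same]
  exact Set.mem_prod

/-- A function on a ball of a product is independent of the second variable if its partial
derivative vanishes. -/
theorem eq_of_partial_zero {E F G : Type*} [NormedAddCommGroup E] [NormedSpace ℝ E]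
    [NormedAddCommGroup F] [NormedSpace ℝ F] [NormedAddCommGroup G] [NormedSpace ℝ G]
    {f : E × F → G} {p : E × F} {r : ℝ}
    (hd : ∀ q ∈ Metric.ball p r, DifferentiableAt ℝ f q)
    (h : ∀ q ∈ Metric.ball p r, ∀ v, fderiv ℝ f q (0, v) = 0) {q : E × F}
    (hq : q ∈ Metric.ball p r) : f q = f (q.1, p.2) := by
  obtain ⟨u, v⟩ := q
  obtain ⟨hu, hv⟩ := mem_ball_prod.1 hq
  refine constant_on_ball (f := fun v => f (u, v)) (fun y hy => ?_) hv
  have hm : ((u, y) : E × F) ∈ Metric.ball p r := mem_ball_prod.2 ⟨hu, hy⟩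
  have h1 := (hd _ hm).hasFDerivAt.comp y (hasFDerivAt_prodMk_right u y)
  refine HasFDerivAt.congr_fderiv h1 (ContinuousLinearMap.ext fun w => ?_)
  exact h _ hm w

theorem eventually_ball {E : Type*} [PseudoMetricSpace E] {p : E} {r : ℝ} {P : E → Prop}
    (h : ∀ q ∈ Metric.ball p r, P q) {q : E} (hq : q ∈ Metric.ball p r) : ∀ᶠ y in 𝓝 q, P y :=
  Filter.mem_of_superset (Metric.isOpen_ball.mem_nhds hq) h

/-- The transformation of the base near a point: the new time depends on the old time only, and
the spatial part is conformal, with the conformal factor determined by the new time. -/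
theorem exists_base {V V' : Potential} {e : OpenPartialHomeomorph VarSpace VarSpace}
    (he : e ∈ admissible V V') {p : VarSpace} (hp : p ∈ e.source) :
    ∃ (r k : ℝ) (T : ℝ → ℝ) (A : BaseSpace → BaseSpace) (C : BaseSpace → Fin 2 → ℂ), 0 < r ∧
      (k = 1 ∨ k = -1) ∧ Metric.ball p r ⊆ e.source ∧
      (∀ t ∈ Metric.ball p.1.1 r, ContDiffAt ℝ ∞ T t ∧ 0 < k * deriv T t) ∧
      (∀ z ∈ Metric.ball p.1 r, BaseJet A z (k * deriv T z.1) k (C z)) ∧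
      (∀ z ∈ Metric.ball p.1 r, (A z).1 = T z.1) ∧
      ∀ q ∈ Metric.ball p r, (e q).1 = A q.1 := by
  obtain ⟨r0, hr0, hball⟩ := Metric.isOpen_iff.1 e.open_source p hp
  let A : BaseSpace → BaseSpace := fun z => (e (z, p.2)).1
  let T : ℝ → ℝ := fun t => (A (t, p.1.2)).1
  have hes : ∀ q ∈ Metric.ball p r0, ContDiffAt ℝ ∞ e q := fun q hq => he.1.contDiffAt (hball hq)
  have heA : ∀ q ∈ Metric.ball p r0, (e q).1 = A q.1 := fun q hq =>
    eq_of_partial_zero (f := fun q => (e q).1)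
      (fun q hq => (contDiffAt_differentiableAt (hes q hq)).fst) (fun q hq v => by
        rw [(contDiffAt_differentiableAt (hes q hq)).hasFDerivAt.fst.fderiv]
        exact (fibre_preserving he (hball hq)).1 v) hq
  have hz : ∀ z ∈ Metric.ball p.1 r0, (z, p.2) ∈ Metric.ball p r0 := fun z hz =>
    mem_ball_prod.2 ⟨hz, Metric.mem_ball_self hr0⟩
  have hAs : ∀ z ∈ Metric.ball p.1 r0, ContDiffAt ℝ ∞ A z := fun z h =>
    (ContDiffAt.comp (g := e) (f := fun z => (z, p.2)) z (hes _ (hz z h))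
      (contDiffAt_id.prodMk contDiffAt_const)).fst
  have hAd : ∀ z ∈ Metric.ball p.1 r0, ∀ u, fderiv ℝ A z u = (fderiv ℝ e (z, p.2) (u, 0)).1 := by
    intro z h u
    have h1 : HasFDerivAt (fun z => e (z, p.2)) _ z :=
      (contDiffAt_differentiableAt (hes _ (hz z h))).hasFDerivAt.comp z
        (hasFDerivAt_prodMk_left z p.2)
    have h2 : HasFDerivAt A _ z := h1.fst
    rw [h2.fderiv]
    rfl
  have hrel : ∀ z ∈ Metric.ball p.1 r0, Function.Injective (fderiv ℝ A z) ∧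
      (fderiv ℝ A z (eb 0)).1 = 0 ∧ (fderiv ℝ A z (eb 1)).1 = 0 ∧
      (fderiv ℝ A z (eb 0)).2 0 * (fderiv ℝ A z (eb 0)).2 1
        + (fderiv ℝ A z (eb 1)).2 0 * (fderiv ℝ A z (eb 1)).2 1 = 0 ∧
      (fderiv ℝ A z (eb 0)).2 0 ^ 2 + (fderiv ℝ A z (eb 1)).2 0 ^ 2
        = (fderiv ℝ A z (eb 0)).2 1 ^ 2 + (fderiv ℝ A z (eb 1)).2 1 ^ 2 := by
    intro z h
    obtain ⟨-, h1, h2⟩ := fibre_preserving he (hball (hz z h))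
    refine ⟨fun u v huv => h1 ?_, h2 (fun a => fderiv ℝ A z (eb a)) fun a => hAd z h _⟩
    simpa only [hAd z h] using huv
  have htime : ∀ z ∈ Metric.ball p.1 r0, ∀ a, (fderiv ℝ A z (eb a)).1 = 0 := fun z h =>
    Fin.forall_fin_two.2 ⟨(hrel z h).2.1, (hrel z h).2.2.1⟩
  have hAT : ∀ z ∈ Metric.ball p.1 r0, (A z).1 = T z.1 := fun z h =>
    eq_of_partial_zero (f := fun z => (A z).1)
      (fun z h => (contDiffAt_differentiableAt (hAs z h)).fst) (fun z h v => by
        rw [(contDiffAt_differentiableAt (hAs z h)).hasFDerivAt.fst.fderiv]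
        change (fderiv ℝ A z (0, v)).1 = 0
        rw [clm_decomp]
        simp [htime z h]) h
  have htx : ∀ t ∈ Metric.ball p.1.1 r0, (t, p.1.2) ∈ Metric.ball p.1 r0 := fun t h =>
    mem_ball_prod.2 ⟨h, Metric.mem_ball_self hr0⟩
  have hTs : ∀ t ∈ Metric.ball p.1.1 r0, ContDiffAt ℝ ∞ T t := fun t h =>
    (ContDiffAt.comp (g := A) (f := fun t => (t, p.1.2)) t (hAs _ (htx t h))
      (contDiffAt_id.prodMk contDiffAt_const)).fst
  have hTd : ∀ z ∈ Metric.ball p.1 r0, (fderiv ℝ A z tb).1 = deriv T z.1 := by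
    intro z h
    have h1 := (contDiffAt_differentiableAt (hAs z h)).hasFDerivAt.fst
    have h2 : (fun z => (A z).1) =ᶠ[𝓝 z] fun z => T z.1 := eventually_ball hAT h
    have h3 := hasFDerivAt_time (contDiffAt_differentiableAt
      (hTs z.1 (mem_ball_prod.1 h).1)).hasDerivAt
    have h4 := congrArg (fun L => L tb) ((h1.congr_of_eventuallyEq h2.symm).unique h3)
    simpa [tb] using h4
  have hTne : ∀ z ∈ Metric.ball p.1 r0, deriv T z.1 ≠ 0 := by
    intro z h h0
    obtain ⟨u, hu⟩ := LinearMap.injective_iff_surjective.1 (hrel z h).1 tb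
    have h1 : (fderiv ℝ A z u).1 = 1 := congrArg Prod.fst hu
    rw [clm_decomp] at h1
    simp [htime z h, hTd z h, h0] at h1
  have hp1 : p.1 ∈ Metric.ball p.1 r0 := Metric.mem_ball_self hr0
  have hTc := (contDiffAt_deriv (hTs p.1.1 (mem_ball_prod.1 hp1).1)).continuousAt
  obtain ⟨k, hk, hk0⟩ : ∃ k : ℝ, (k = 1 ∨ k = -1) ∧ 0 < k * deriv T p.1.1 := by
    rcases lt_or_gt_of_ne (hTne _ hp1) with h1 | h1
    · exact ⟨-1, Or.inr rfl, by linarith⟩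
    · exact ⟨1, Or.inl rfl, by linarith⟩
  have hev : ∀ᶠ t in 𝓝 p.1.1, 0 < k * deriv T t :=
    (continuousAt_const.mul hTc).eventually (lt_mem_nhds hk0)
  obtain ⟨r1, hr1, hball1⟩ := Metric.eventually_nhds_iff_ball.1 hev
  let r := min r0 r1
  have hrr0 : ∀ {E : Type} [PseudoMetricSpace E] (c : E), Metric.ball c r ⊆ Metric.ball c r0 :=
    fun c => Metric.ball_subset_ball (min_le_left _ _)
  let m : BaseSpace → ℝ := fun z => (fderiv ℝ A z (eb 0)).2 0 ^ 2 + (fderiv ℝ A z (eb 1)).2 0 ^ 2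
  let C : BaseSpace → Fin 2 → ℂ := fun z a =>
    (I * k * (((fderiv ℝ A z tb).2 0 * (fderiv ℝ A z (eb a)).2 0
        + (fderiv ℝ A z tb).2 1 * (fderiv ℝ A z (eb a)).2 1 : ℝ) : ℂ)
      + ((((D2 A z (eb 0) (eb 0)).2 0 + (D2 A z (eb 1) (eb 1)).2 0) * (fderiv ℝ A z (eb a)).2 0
        + ((D2 A z (eb 0) (eb 0)).2 1 + (D2 A z (eb 1) (eb 1)).2 1)
          * (fderiv ℝ A z (eb a)).2 1 : ℝ) : ℂ)) / m z
  refine ⟨r, k, T, A, C, lt_min hr0 hr1, hk, (hrr0 p).trans hball, fun t ht =>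
    ⟨hTs t (hrr0 _ ht), hball1 t (Metric.ball_subset_ball (min_le_right _ _) ht)⟩, ?_,
    fun z h => hAT z (hrr0 _ h), fun q h => heA q (hrr0 _ h)⟩
  intro z hzr
  have h := hrr0 _ hzr
  obtain ⟨hinj, -, -, r01, r0eq⟩ := hrel z h
  have hkT : 0 < k * deriv T z.1 :=
    hball1 _ (Metric.ball_subset_ball (min_le_right _ _) (mem_ball_prod.1 hzr).1)
  have hmpos : 0 < m z := by
    rcases lt_or_eq_of_le (by positivity : 0 ≤ m z) with h1 | h1
    · exact h1
    · exfalso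
      have h00 : (fderiv ℝ A z (eb 0)).2 0 = 0 := by
        have : (fderiv ℝ A z (eb 0)).2 0 ^ 2 + (fderiv ℝ A z (eb 1)).2 0 ^ 2 = 0 := h1.symm
        nlinarith [sq_nonneg ((fderiv ℝ A z (eb 0)).2 0), sq_nonneg ((fderiv ℝ A z (eb 1)).2 0)]
      have h01 : (fderiv ℝ A z (eb 0)).2 1 = 0 := by
        have : (fderiv ℝ A z (eb 0)).2 0 ^ 2 + (fderiv ℝ A z (eb 1)).2 0 ^ 2 = 0 := h1.symm
        nlinarith [sq_nonneg ((fderiv ℝ A z (eb 0)).2 1), sq_nonneg ((fderiv ℝ A z (eb 1)).2 1)]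
      have h2 : fderiv ℝ A z (eb 0) = fderiv ℝ A z 0 := by
        rw [map_zero]
        exact Prod.ext (htime z h 0) (funext (Fin.forall_fin_two.2 ⟨h00, h01⟩))
      have h3 := congrFun (congrArg Prod.snd (hinj h2)) 0
      simp [eb] at h3
  have htime2 : ∀ a, (D2 A z (eb a) (eb a)).1 = 0 := by
    intro a
    rw [← fderiv_fderiv_apply (hAs z h)]
    have h1 : (fun y => (fderiv ℝ A y (eb a)).1) =ᶠ[𝓝 z] fun _ => 0 :=
      eventually_ball (P := fun y => (fderiv ℝ A y (eb a)).1 = 0) (fun y hy => htime y hy a) h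
    have h2 : DifferentiableAt ℝ (fun y => fderiv ℝ A y (eb a)) z :=
      (contDiffAt_differentiableAt (contDiffAt_fderiv (hAs z h))).clm_apply
        (differentiableAt_const (eb a))
    have h3 := h1.fderiv_eq (𝕜 := ℝ)
    rw [h2.hasFDerivAt.fst.fderiv] at h3
    have h4 := congrArg (fun L : BaseSpace →L[ℝ] ℝ => L (eb a)) h3
    simpa using h4
  have jet : BaseJet A z (m z) (m z / deriv T z.1)
      (fun a => (I * (m z / deriv T z.1 : ℝ) * (((fderiv ℝ A z tb).2 0 * (fderiv ℝ A z (eb a)).2 0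
        + (fderiv ℝ A z tb).2 1 * (fderiv ℝ A z (eb a)).2 1 : ℝ) : ℂ)
      + ((((D2 A z (eb 0) (eb 0)).2 0 + (D2 A z (eb 1) (eb 1)).2 0) * (fderiv ℝ A z (eb a)).2 0
        + ((D2 A z (eb 0) (eb 0)).2 1 + (D2 A z (eb 1) (eb 1)).2 1)
          * (fderiv ℝ A z (eb a)).2 1 : ℝ) : ℂ)) / m z) :=
    ⟨hAs z h, hmpos, htime z h, htime2, by rw [hTd z h]; exact div_mul_cancel₀ _ (hTne z h),
      rfl, r0eq.symm, r01, fun a => mul_div_cancel₀ _ (by exact_mod_cast hmpos.ne')⟩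
  obtain ⟨-, -, hks⟩ := fibre_relations he (hball (hz z h)) jet (eventually_ball heA (hz z h))
  have hmk : m z / deriv T z.1 = k := by
    have h1 : 0 < m z / deriv T z.1 * k := by
      have : m z / deriv T z.1 * k = m z * (k * deriv T z.1) / deriv T z.1 ^ 2 := by
        field_simp [hTne z h]
      rw [this]
      have := hTne z h
      positivity
    rcases hk with hk | hk <;> rcases hks with hks | hks <;> rw [hk, hks] at h1 <;>
      first | exact hks.trans hk.symm | norm_num at h1
  rw [hmk] at jet
  have hmz : m z = k * deriv T z.1 := by rw [← hmk, div_mul_cancel₀ _ (hTne z h)]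
  rw [← hmz]
  exact jet

/-- The dependence of the new dependent variable on the old one. -/
theorem exists_fibre {V V' : Potential} {e : OpenPartialHomeomorph VarSpace VarSpace}
    (he : e ∈ admissible V V') {p : VarSpace} {r k : ℝ} {m : BaseSpace → ℝ}
    {A : BaseSpace → BaseSpace} {C : BaseSpace → Fin 2 → ℂ} (hr : 0 < r) (hk : k = 1 ∨ k = -1)
    (hball : Metric.ball p r ⊆ e.source) (hA : ∀ z ∈ Metric.ball p.1 r, BaseJet A z (m z) k (C z))
    (heA : ∀ q ∈ Metric.ball p r, (e q).1 = A q.1) :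
    ∃ α : BaseSpace → ℂ, (∀ z ∈ Metric.ball p.1 r, ContDiffAt ℝ ∞ α z ∧ α z ≠ 0 ∧
        (∀ a, 2 * fderiv ℝ α z (eb a) = C z a * α z) ∧ m z * ‖α z‖ ^ 2 = 1) ∧
      ∀ q ∈ Metric.ball p r, (e q).2 = α q.1 * hat k q.2 := by
  let B : VarSpace → ℂ := fun q => (e q).2
  have hBs : ∀ q ∈ Metric.ball p r, ContDiffAt ℝ ∞ B q := fun q hq =>
    (he.1.contDiffAt (hball hq)).snd
  have hBd : ∀ q ∈ Metric.ball p r, ∀ v, fderiv ℝ B q v = (fderiv ℝ e q v).2 := by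
    intro q hq v
    have h1 : HasFDerivAt B _ q :=
      (contDiffAt_differentiableAt (he.1.contDiffAt (hball hq))).hasFDerivAt.snd
    rw [h1.fderiv]
    rfl
  have hrel : ∀ q ∈ Metric.ball p r,
      (∀ h, fderiv ℝ B q (0, I * h) = I * k * fderiv ℝ B q (0, h)) ∧
      (∀ h, D2 B q (0, h) (0, h) = 0) := by
    intro q hq
    obtain ⟨h1, h2, -⟩ := fibre_relations he (hball hq) (hA q.1 (mem_ball_prod.1 hq).1)
      (eventually_ball heA hq)
    exact ⟨fun h => by rw [hBd q hq, hBd q hq]; exact h1 h, h2⟩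
  have hz : ∀ z ∈ Metric.ball p.1 r, (z, p.2) ∈ Metric.ball p r := fun z hz =>
    mem_ball_prod.2 ⟨hz, Metric.mem_ball_self hr⟩
  let α : BaseSpace → ℂ := fun z => fderiv ℝ B (z, p.2) (0, 1)
  have hα : ∀ q ∈ Metric.ball p r, fderiv ℝ B q (0, 1) = α q.1 := fun q hq =>
    eq_of_partial_zero (f := fun q => fderiv ℝ B q (0, 1))
      (fun q hq => (contDiffAt_differentiableAt (contDiffAt_fderiv (hBs q hq))).clm_apply
        (differentiableAt_const _)) (fun q hq v => by
        rw [fderiv_fderiv_apply (hBs q hq)]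
        have h0 := (hrel q hq).2 ((v : ℂ) + 1)
        have s1 : ((0, v + 1) : VarSpace) = (0, v) + (0, 1) := by simp
        rw [s1] at h0
        simp only [map_add, add_apply, (hrel q hq).2, D2_symm (hBs q hq) (0, 1) (0, v)] at h0
        linear_combination h0 / 2) hq
  have hBh : ∀ q ∈ Metric.ball p r, ∀ h, fderiv ℝ B q (0, h) = α q.1 * hat k h := by
    intro q hq h
    have h1 : ((0, h) : VarSpace) = h.re • ((0, 1) : VarSpace) + h.im • ((0, I * 1) : VarSpace) := by
      ext1
      · simp
      · simp [Complex.re_add_im]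
    have h2 : hat k h = h.re + I * k * h.im := by
      conv_lhs => rw [← Complex.re_add_im h]
      rw [hat_add, hat_mul, hat_ofReal, hat_ofReal, hat_I hk]
      ring
    rw [h1, map_add, map_smul, map_smul, (hrel q hq).1, hα q hq, h2]
    simp
    ring
  have hsm : ∀ z ∈ Metric.ball p.1 r, ContDiffAt ℝ ∞ α z := fun z h =>
    (ContDiffAt.comp (g := fun q => fderiv ℝ B q) (f := fun z => (z, p.2)) z
      (contDiffAt_fderiv (hBs _ (hz z h))) (contDiffAt_id.prodMk contDiffAt_const)).clm_apply
        contDiffAt_const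
  let γ : BaseSpace → ℂ := fun z => B (z, p.2) - α z * hat k p.2
  have hγ : ∀ z ∈ Metric.ball p.1 r, ContDiffAt ℝ ∞ γ z := fun z h =>
    (ContDiffAt.comp (g := B) (f := fun z => (z, p.2)) z
      (hBs _ (hz z h)) (contDiffAt_id.prodMk contDiffAt_const)).sub
        ((hsm z h).mul contDiffAt_const)
  have hform : ∀ q ∈ Metric.ball p r, B q = α q.1 * hat k q.2 + γ q.1 := by
    intro q hq
    have h1 : B q - α q.1 * hat k q.2 = B (q.1, p.2) - α q.1 * hat k p.2 :=
      eq_of_partial_zero (f := fun q : VarSpace => B q - α q.1 * hat k q.2)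
        (fun q hq => (contDiffAt_differentiableAt (hBs q hq)).sub
          ((contDiffAt_differentiableAt (ContDiffAt.comp (g := α) q
            (hsm q.1 (mem_ball_prod.1 hq).1) contDiffAt_fst)).mul
            (contDiffAt_differentiableAt (contDiffAt_hat contDiffAt_snd k))))
        (fun q hq v => by
          have d1 := (contDiffAt_differentiableAt (hBs q hq)).hasFDerivAt
          have d2 := (contDiffAt_differentiableAt
            (hsm q.1 (mem_ball_prod.1 hq).1)).hasFDerivAt.comp q (hasFDerivAt_fst (p := q))
          have d3 : HasFDerivAt (fun q : VarSpace => hat k q.2) ((hatL k).comp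
              (ContinuousLinearMap.snd ℝ BaseSpace ℂ)) q := by
            simp only [← hatL_apply]
            exact (hatL k).hasFDerivAt.comp q hasFDerivAt_snd
          have d4 : HasFDerivAt (fun q : VarSpace => B q - α q.1 * hat k q.2) _ q :=
            d1.sub (d2.mul d3)
          rw [d4.fderiv]
          simp [hBh q hq, hatL_apply]) hq
    rw [← sub_eq_iff_eq_add']
    exact h1
  have hα0 : ∀ z ∈ Metric.ball p.1 r, α z ≠ 0 := by
    intro z h h0
    have hp := hball (hz z h)
    have h1 : fderiv ℝ e (z, p.2) (0, 1) = fderiv ℝ e (z, p.2) (0, 0) := by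
      ext1
      · rw [(fibre_preserving he hp).1, (fibre_preserving he hp).1]
      · rw [← hBd _ (hz z h), ← hBd _ (hz z h), hBh _ (hz z h), hBh _ (hz z h)]
        simp [h0]
    have h2 := he.1.injective hp h1
    have h3 : (1 : ℂ) = 0 := congrArg Prod.snd h2
    exact one_ne_zero h3
  have hcoef : ∀ z ∈ Metric.ball p.1 r, _ := fun z h =>
    coefficient_relations he (ψ₀ := p.2) hr (hA z h) hk (hsm z h) (hγ z h) (hα0 z h)
      (fun ψ hψ => hball (mem_ball_prod.2 ⟨h, hψ⟩))
      (fun ψ hψ => by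
        have hm : ((z, ψ) : VarSpace) ∈ Metric.ball p r := mem_ball_prod.2 ⟨h, hψ⟩
        exact eventually_ball (P := fun q => e q = (A q.1, α q.1 * hat k q.2 + γ q.1))
          (fun q hq => Prod.ext (heA q hq) (hform q hq)) hm)
  refine ⟨α, fun z h => ⟨hsm z h, hα0 z h, (hcoef z h).1, (hcoef z h).2.1⟩, fun q hq => ?_⟩
  have h1 := hform q hq
  rw [(hcoef q.1 (mem_ball_prod.1 hq).1).2.2, add_zero] at h1
  exact h1

/-- The component `b` of the derivative of the spatial part of `A` in the direction `v`. -/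
noncomputable def spatialDeriv (A : BaseSpace → BaseSpace) (v : BaseSpace) (b : Fin 2)
    (z : BaseSpace) : ℝ := (fderiv ℝ A z v).2 b

theorem contDiffAt_spatialDeriv {A : BaseSpace → BaseSpace} {z : BaseSpace}
    (hA : ContDiffAt ℝ ∞ A z) (v : BaseSpace) (b : Fin 2) :
    ContDiffAt ℝ ∞ (spatialDeriv A v b) z :=
  contDiffAt_pi.1 ((contDiffAt_fderiv hA).clm_apply contDiffAt_const).snd b

theorem fderiv_spatialDeriv {A : BaseSpace → BaseSpace} {z : BaseSpace}
    (hA : ContDiffAt ℝ ∞ A z) (u v : BaseSpace) (b : Fin 2) :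
    fderiv ℝ (spatialDeriv A v b) z u = (D2 A z u v).2 b := by
  have h1 : DifferentiableAt ℝ (fun y => fderiv ℝ A y v) z :=
    (contDiffAt_differentiableAt (contDiffAt_fderiv hA)).clm_apply (differentiableAt_const v)
  have h2 : HasFDerivAt (spatialDeriv A v b) _ z := hasFDerivAt_pi'.1 h1.hasFDerivAt.snd b
  rw [h2.fderiv, ← fderiv_fderiv_apply hA]
  rfl

/-- The columns of a `2 × 2` matrix are orthogonal of equal length if the rows are. -/
theorem columns_of_rows {a b c d m : ℝ} (hm : m ≠ 0) (h0 : a ^ 2 + b ^ 2 = m)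
    (h1 : c ^ 2 + d ^ 2 = m) (h2 : a * c + b * d = 0) :
    a ^ 2 + c ^ 2 = m ∧ b ^ 2 + d ^ 2 = m ∧ a * b + c * d = 0 := by
  have e1 : (a * d - b * c) * a = m * d := by linear_combination (d * h0 - b * h2)
  have e2 : (a * d - b * c) * b = -(m * c) := by linear_combination (-c * h0 + a * h2)
  have e3 : (a * d - b * c) ^ 2 = m ^ 2 := by
    linear_combination h0 * m + (c ^ 2 + d ^ 2) * h0 - m * h0 + m * h1 - (a * c + b * d) * h2
  have hm2 : m ^ 2 ≠ 0 := pow_ne_zero 2 hm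
  refine ⟨mul_left_cancel₀ hm2 ?_, mul_left_cancel₀ hm2 ?_, mul_left_cancel₀ hm2 ?_⟩
  · linear_combination m ^ 2 * h0 + b ^ 2 * e3 + (m * c - (a * d - b * c) * b) * e2
  · linear_combination m ^ 2 * h0 + a ^ 2 * e3 - ((a * d - b * c) * a + m * d) * e1
  · linear_combination -a * b * e3 + (a * d - b * c) * b * e1 + m * d * e2

theorem BaseJet.columns {A : BaseSpace → BaseSpace} {z : BaseSpace} {m k : ℝ} {C : Fin 2 → ℂ}
    (hA : BaseJet A z m k C) :
    spatialDeriv A (eb 0) 0 z ^ 2 + spatialDeriv A (eb 0) 1 z ^ 2 = m ∧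
    spatialDeriv A (eb 1) 0 z ^ 2 + spatialDeriv A (eb 1) 1 z ^ 2 = m ∧
    spatialDeriv A (eb 0) 0 z * spatialDeriv A (eb 1) 0 z
      + spatialDeriv A (eb 0) 1 z * spatialDeriv A (eb 1) 1 z = 0 :=
  columns_of_rows hA.pos.ne' hA.row0 hA.row1 hA.row01

theorem fderiv_dot {f g f' g' : BaseSpace → ℝ} {z : BaseSpace} (hf : DifferentiableAt ℝ f z)
    (hg : DifferentiableAt ℝ g z) (hf' : DifferentiableAt ℝ f' z) (hg' : DifferentiableAt ℝ g' z)
    (u : BaseSpace) : fderiv ℝ (fun y => f y * g y + f' y * g' y) z u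
      = f z * fderiv ℝ g z u + g z * fderiv ℝ f z u
        + (f' z * fderiv ℝ g' z u + g' z * fderiv ℝ f' z u) := by
  have h := ((hf.hasFDerivAt.mul hg.hasFDerivAt).add (hf'.hasFDerivAt.mul hg'.hasFDerivAt))
  have h' : HasFDerivAt (fun y => f y * g y + f' y * g' y) _ z := h
  rw [h'.fderiv]
  simp

section BaseGeometry

variable {A : BaseSpace → BaseSpace} {z : BaseSpace} {k : ℝ} {T : ℝ → ℝ}
  {C : BaseSpace → Fin 2 → ℂ}

theorem dot_deriv (hT : ContDiffAt ℝ ∞ T z.1)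
    (hA : ∀ᶠ y in 𝓝 z, BaseJet A y (k * deriv T y.1) k (C y)) (u : BaseSpace) :
    2 * (spatialDeriv A (eb 0) 0 z * (D2 A z u (eb 0)).2 0
      + spatialDeriv A (eb 0) 1 z * (D2 A z u (eb 0)).2 1) = u.1 * (k * deriv (deriv T) z.1) ∧
    2 * (spatialDeriv A (eb 1) 0 z * (D2 A z u (eb 1)).2 0
      + spatialDeriv A (eb 1) 1 z * (D2 A z u (eb 1)).2 1) = u.1 * (k * deriv (deriv T) z.1) ∧
    spatialDeriv A (eb 0) 0 z * (D2 A z u (eb 1)).2 0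
      + spatialDeriv A (eb 1) 0 z * (D2 A z u (eb 0)).2 0
      + (spatialDeriv A (eb 0) 1 z * (D2 A z u (eb 1)).2 1
        + spatialDeriv A (eb 1) 1 z * (D2 A z u (eb 0)).2 1) = 0 := by
  have hs := hA.self_of_nhds.smooth
  have hd := fun v b => contDiffAt_differentiableAt (contDiffAt_spatialDeriv hs v b)
  have hm : fderiv ℝ (fun y : BaseSpace => k * deriv T y.1) z u
      = u.1 * (k * deriv (deriv T) z.1) := by
    have h1 := hasFDerivAt_time (z := z)
      ((contDiffAt_differentiableAt (contDiffAt_deriv hT)).hasDerivAt.const_mul k)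
    rw [h1.fderiv]
    simp
  have h00 : (fun y => spatialDeriv A (eb 0) 0 y * spatialDeriv A (eb 0) 0 y
      + spatialDeriv A (eb 0) 1 y * spatialDeriv A (eb 0) 1 y)
      =ᶠ[𝓝 z] fun y => k * deriv T y.1 := by
    filter_upwards [hA] with y hy
    linarith [hy.columns.1]
  have h11 : (fun y => spatialDeriv A (eb 1) 0 y * spatialDeriv A (eb 1) 0 y
      + spatialDeriv A (eb 1) 1 y * spatialDeriv A (eb 1) 1 y)
      =ᶠ[𝓝 z] fun y => k * deriv T y.1 := by
    filter_upwards [hA] with y hy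
    linarith [hy.columns.2.1]
  have h01 : (fun y => spatialDeriv A (eb 0) 0 y * spatialDeriv A (eb 1) 0 y
      + spatialDeriv A (eb 0) 1 y * spatialDeriv A (eb 1) 1 y)
      =ᶠ[𝓝 z] fun _ => (0 : ℝ) := by
    filter_upwards [hA] with y hy
    exact hy.columns.2.2
  have e00 := congrArg (fun L => L u) (h00.fderiv_eq (𝕜 := ℝ))
  have e11 := congrArg (fun L => L u) (h11.fderiv_eq (𝕜 := ℝ))
  have e01 := congrArg (fun L => L u) (h01.fderiv_eq (𝕜 := ℝ))
  simp only [fderiv_dot (hd _ _) (hd _ _) (hd _ _) (hd _ _), hm, fderiv_spatialDeriv hs,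
    fderiv_fun_const, Pi.zero_apply, zero_apply] at e00 e11 e01
  exact ⟨by linarith, by linarith, by linarith⟩

theorem eq_zero_of_dot {a b c d x y m : ℝ} (hm : m ≠ 0) (h0 : a ^ 2 + b ^ 2 = m)
    (h1 : c ^ 2 + d ^ 2 = m) (h2 : a * c + b * d = 0) (e0 : a * x + c * y = 0)
    (e1 : b * x + d * y = 0) : x = 0 ∧ y = 0 := by
  constructor <;> refine mul_left_cancel₀ hm ?_
  · linear_combination (-x) * h0 + a * e0 + b * e1 - y * h2
  · linear_combination (-y) * h1 + c * e0 + d * e1 - x * h2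

theorem spatial_second_zero (hT : ContDiffAt ℝ ∞ T z.1)
    (hA : ∀ᶠ y in 𝓝 z, BaseJet A y (k * deriv T y.1) k (C y)) (a c : Fin 2) (b : Fin 2) :
    (D2 A z (eb a) (eb c)).2 b = 0 := by
  have hz := hA.self_of_nhds
  have hs := hz.smooth
  obtain ⟨a0, a1, a2⟩ := dot_deriv hT hA (eb 0)
  obtain ⟨b0, b1, b2⟩ := dot_deriv hT hA (eb 1)
  have hsym := D2_symm hs (eb 1) (eb 0)
  rw [hsym] at b0 b2
  simp only [show ∀ a, (eb a).1 = 0 from fun _ => rfl, zero_mul] at a0 a1 b0 b1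
  have sol := fun x y => eq_zero_of_dot (x := x) (y := y) hz.pos.ne' hz.row0 hz.row1 hz.row01
  simp only [← spatialDeriv.eq_def] at sol
  change ∀ x y, spatialDeriv A (eb 0) 0 z * x + spatialDeriv A (eb 0) 1 z * y = 0 →
    spatialDeriv A (eb 1) 0 z * x + spatialDeriv A (eb 1) 1 z * y = 0 → _ at sol
  have s00 := sol ((D2 A z (eb 0) (eb 0)).2 0) ((D2 A z (eb 0) (eb 0)).2 1)
    (by linarith) (by linarith)
  have s01 := sol ((D2 A z (eb 0) (eb 1)).2 0) ((D2 A z (eb 0) (eb 1)).2 1)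
    (by linarith) (by linarith)
  have s11 := sol ((D2 A z (eb 1) (eb 1)).2 0) ((D2 A z (eb 1) (eb 1)).2 1)
    (by linarith) (by linarith)
  fin_cases a <;> fin_cases c <;> fin_cases b <;>
    simp only [Fin.zero_eta, Fin.mk_one, Fin.isValue, hsym, s00, s01, s11]

theorem time_second (hT' : ∀ᶠ t in 𝓝 z.1, ContDiffAt ℝ ∞ T t)
    (hA : ∀ᶠ y in 𝓝 z, BaseJet A y (k * deriv T y.1) k (C y)) (hk : k = 1 ∨ k = -1)
    {α : BaseSpace → ℂ} (hα : ContDiffAt ℝ ∞ α z) (hα0 : α z ≠ 0)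
    (hCα : ∀ᶠ y in 𝓝 z, ∀ a, 2 * fderiv ℝ α y (eb a) = C y a * α y) (a b : Fin 2) :
    2 * (k * deriv T z.1) * (D2 A z tb (eb a)).2 b
      = k * deriv (deriv T) z.1 * spatialDeriv A (eb a) b z := by
  have hT := hT'.self_of_nhds
  have hz := hA.self_of_nhds
  have hs := hz.smooth
  have htt : Filter.Tendsto (fun y : BaseSpace => y.1) (𝓝 z) (𝓝 z.1) := continuous_fst.continuousAt
  let F : Fin 2 → BaseSpace → ℝ := fun a y => spatialDeriv A tb 0 y * spatialDeriv A (eb a) 0 y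
    + spatialDeriv A tb 1 y * spatialDeriv A (eb a) 1 y
  have hα1 : ∀ᶠ y in 𝓝 z, ∀ a, 2 * ((k * deriv T y.1 : ℝ) : ℂ) * fderiv ℝ α y (eb a)
      = I * k * ((F a y : ℝ) : ℂ) * α y := by
    filter_upwards [hA.eventually_nhds, hCα, htt.eventually hT']
      with y hy hCy hTy a
    have h1 := hy.self_of_nhds.coeff a
    simp only [spatial_second_zero hTy hy] at h1
    simp only [zero_mul, Complex.ofReal_zero, add_zero] at h1
    have h2 := hCy a
    change _ = I * k * ((((fderiv ℝ A y tb).2 0 * (fderiv ℝ A y (eb a)).2 0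
      + (fderiv ℝ A y tb).2 1 * (fderiv ℝ A y (eb a)).2 1 : ℝ)) : ℂ) * α y
    linear_combination ((k * deriv T y.1 : ℝ) : ℂ) * h2 + α y * h1
  have hd := fun v b => contDiffAt_differentiableAt (contDiffAt_spatialDeriv hs v b)
  have hFd : ∀ a, DifferentiableAt ℝ (F a) z := fun a =>
    ((hd _ _).mul (hd _ _)).add ((hd _ _).mul (hd _ _))
  have hF : ∀ a c, fderiv ℝ (F a) z (eb c) = (D2 A z tb (eb c)).2 0 * spatialDeriv A (eb a) 0 z
      + (D2 A z tb (eb c)).2 1 * spatialDeriv A (eb a) 1 z := by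
    intro a c
    have := fderiv_dot (hd tb 0) (hd (eb a) 0) (hd tb 1) (hd (eb a) 1) (eb c)
    simp only [fderiv_spatialDeriv hs, spatial_second_zero hT hA, D2_symm hs (eb c) tb] at this
    rw [this]
    ring
  have hT1 := contDiffAt_differentiableAt (contDiffAt_deriv hT)
  have hαα : ∀ a c, 2 * ((k * deriv T z.1 : ℝ) : ℂ) * D2 α z (eb c) (eb a)
      = I * k * (((fderiv ℝ (F a) z (eb c) : ℝ) : ℂ) * α z + F a z * fderiv ℝ α z (eb c)) := by
    intro a c
    have h1 : (fun y : BaseSpace => 2 * ((k * deriv T y.1 : ℝ) : ℂ) * fderiv ℝ α y (eb a))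
        =ᶠ[𝓝 z] fun y => I * k * ((F a y : ℝ) : ℂ) * α y := hα1.mono fun y hy => hy a
    have h2 := congrArg (fun L => L (eb c)) (h1.fderiv_eq (𝕜 := ℝ))
    have d1 : HasFDerivAt (fun y : BaseSpace => 2 * ((k * deriv T y.1 : ℝ) : ℂ)
        * fderiv ℝ α y (eb a)) _ z :=
      ((hasFDerivAt_ofReal (hasFDerivAt_time (hT1.hasDerivAt.const_mul k))).const_mul 2).mul
        (((contDiffAt_differentiableAt (contDiffAt_fderiv hα)).clm_apply
          (differentiableAt_const (eb a))).hasFDerivAt)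
    have d2 : HasFDerivAt (fun y : BaseSpace => I * k * ((F a y : ℝ) : ℂ) * α y) _ z :=
      ((hasFDerivAt_ofReal (hFd a).hasFDerivAt).const_mul (I * k)).mul
        (contDiffAt_differentiableAt hα).hasFDerivAt
    simp only [d1.fderiv, d2.fderiv] at h2
    simp only [add_apply, smul_apply, ContinuousLinearMap.comp_apply, fderiv_fderiv_apply hα,
      smul_eq_mul, eb, Complex.ofRealCLM_apply] at h2
    have h0 : ((ContinuousLinearMap.fst ℝ ℝ (Fin 2 → ℝ)).smulRight (k * deriv (deriv T) z.1))
        ((0, Pi.single c 1) : BaseSpace) = 0 := by simp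
    rw [h0, Complex.ofReal_zero] at h2
    simp only [eb]
    linear_combination h2
  have hm0 : ((k * deriv T z.1 : ℝ) : ℂ) ≠ 0 := by exact_mod_cast hz.pos.ne'
  have hcurl : fderiv ℝ (F 0) z (eb 1) = fderiv ℝ (F 1) z (eb 0) := by
    have h1 := hαα 0 1
    have h2 := hαα 1 0
    rw [D2_symm hα (eb 1) (eb 0)] at h1
    have h3 := hα1.self_of_nhds 0
    have h4 := hα1.self_of_nhds 1
    have hkC : (k : ℂ) ≠ 0 := by rcases hk with h | h <;> rw [h] <;> norm_num
    have h5 : (I * k * α z * (2 * ((k * deriv T z.1 : ℝ) : ℂ)))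
        * ((fderiv ℝ (F 0) z (eb 1) : ℝ) : ℂ)
        = (I * k * α z * (2 * ((k * deriv T z.1 : ℝ) : ℂ)))
          * ((fderiv ℝ (F 1) z (eb 0) : ℝ) : ℂ) := by
      linear_combination (-(2 * ((k * deriv T z.1 : ℝ) : ℂ))) * h1
        + (2 * ((k * deriv T z.1 : ℝ) : ℂ)) * h2 + I * k * F 1 z * h3 - I * k * F 0 z * h4
    have h6 := mul_left_cancel₀ (mul_ne_zero (mul_ne_zero (mul_ne_zero I_ne_zero hkC) hα0)
      (mul_ne_zero two_ne_zero hm0)) h5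
    exact_mod_cast h6
  rw [hF, hF] at hcurl
  obtain ⟨a0, a1, a2⟩ := dot_deriv hT hA tb
  simp only [tb, one_mul] at a0 a1 a2 hcurl ⊢
  have sol := fun x y => eq_zero_of_dot (x := x) (y := y) hz.pos.ne' hz.row0 hz.row1 hz.row01
  change ∀ x y, spatialDeriv A (eb 0) 0 z * x + spatialDeriv A (eb 0) 1 z * y = 0 →
    spatialDeriv A (eb 1) 0 z * x + spatialDeriv A (eb 1) 1 z * y = 0 → _ at sol
  obtain ⟨c0, c1, c2⟩ := hz.columns
  have s := fun a => sol (2 * (k * deriv T z.1) * (D2 A z (1, 0) (eb a)).2 0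
      - k * deriv (deriv T) z.1 * spatialDeriv A (eb a) 0 z)
    (2 * (k * deriv T z.1) * (D2 A z (1, 0) (eb a)).2 1
      - k * deriv (deriv T) z.1 * spatialDeriv A (eb a) 1 z)
  have s0 := s 0
    (by linear_combination (k * deriv T z.1) * a0 - k * deriv (deriv T) z.1 * c0)
    (by linear_combination (k * deriv T z.1) * (a2 - hcurl) - k * deriv (deriv T) z.1 * c2)
  have s1 := s 1
    (by linear_combination (k * deriv T z.1) * (a2 + hcurl) - k * deriv (deriv T) z.1 * c2)
    (by linear_combination (k * deriv T z.1) * a1 - k * deriv (deriv T) z.1 * c1)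
  fin_cases a <;> fin_cases b <;>
    simp only [Fin.zero_eta, Fin.mk_one, Fin.isValue]
  · linarith [s0.1]
  · linarith [s0.2]
  · linarith [s1.1]
  · linarith [s1.2]

end BaseGeometry

theorem Coeffs.sign_eq {D : Coeffs} {t k : ℝ} (hk : k = 1 ∨ k = -1) (h : 0 < k * deriv D.T t) :
    Real.sign (deriv D.T t) = k ∧ |deriv D.T t| = k * deriv D.T t := by
  rcases hk with rfl | rfl
  · have h1 : 0 < deriv D.T t := by linarith
    exact ⟨Real.sign_of_pos h1, by rw [abs_of_pos h1]; ring⟩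
  · have h1 : deriv D.T t < 0 := by linarith
    exact ⟨Real.sign_of_neg h1, by rw [abs_of_neg h1]; ring⟩

theorem base_explicit {A : BaseSpace → BaseSpace} {c : BaseSpace} {r k : ℝ} {T : ℝ → ℝ}
    {C : BaseSpace → Fin 2 → ℂ} {α : BaseSpace → ℂ} (hr : 0 < r) (hk : k = 1 ∨ k = -1)
    (hT : ∀ t ∈ Metric.ball c.1 r, ContDiffAt ℝ ∞ T t ∧ 0 < k * deriv T t)
    (hA : ∀ z ∈ Metric.ball c r, BaseJet A z (k * deriv T z.1) k (C z))
    (hAT : ∀ z ∈ Metric.ball c r, (A z).1 = T z.1)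
    (hα : ∀ z ∈ Metric.ball c r, ContDiffAt ℝ ∞ α z ∧ α z ≠ 0 ∧
      ∀ a, 2 * fderiv ℝ α z (eb a) = C z a * α z) :
    ∃ (O : Matrix (Fin 2) (Fin 2) ℝ) (X : Fin 2 → ℝ → ℝ),
      (∀ t ∈ Metric.ball c.1 r, (Coeffs.mk T O X 0).ValidAt t) ∧
      ∀ z ∈ Metric.ball c r, A z = (Coeffs.mk T O X 0).base z := by
  let D : Coeffs := ⟨T, 1, fun _ _ => 0, 0⟩
  have hD : ∀ t ∈ Metric.ball c.1 r, D.ValidAt t := fun t ht =>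
    ⟨(hT t ht).1, fun _ => contDiffAt_const, contDiffAt_const, fun h0 => by
      have := (hT t ht).2
      rw [h0] at this
      simp at this, one_mem _⟩
  have hsc : ∀ t ∈ Metric.ball c.1 r, D.scale t ^ 2 = k * deriv T t := fun t ht => by
    rw [Coeffs.scale_sq]
    exact (Coeffs.sign_eq (D := D) hk (hT t ht).2).2
  have hT' : ∀ z ∈ Metric.ball c r, ∀ᶠ t in 𝓝 z.1, ContDiffAt ℝ ∞ T t := fun z hz =>
    eventually_ball (fun t ht => (hT t ht).1) (mem_ball_prod.1 hz).1
  let O : Matrix (Fin 2) (Fin 2) ℝ := Matrix.of fun b a => spatialDeriv A (eb a) b c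
    * (1 / D.scale c.1)
  have hF : ∀ z ∈ Metric.ball c r, ∀ a b, spatialDeriv A (eb a) b z = D.scale z.1 * O b a := by
    intro z hz a b
    have h1 : spatialDeriv A (eb a) b z * (1 / D.scale z.1) = O b a := by
      refine constant_on_ball (f := fun z => spatialDeriv A (eb a) b z * (1 / D.scale z.1))
        (fun z hz => ?_) hz
      have hzt := (mem_ball_prod.1 hz).1
      have hs := (hA z hz).smooth
      have hs0 := (Coeffs.scale_pos (hD _ hzt)).ne'
      have d1 := (contDiffAt_differentiableAt (contDiffAt_spatialDeriv hs (eb a) b)).hasFDerivAt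
      have d2 := hasFDerivAt_time (z := z) (φ := fun t => 1 / D.scale t)
        ((hasDerivAt_const z.1 (1 : ℝ)).div (Coeffs.hasDerivAt_scale (hD _ hzt)) hs0)
      refine (d1.mul d2).congr_fderiv (ContinuousLinearMap.ext fun u => ?_)
      have h2 : (D2 A z u (eb a)).2 b = u.1 * (D2 A z tb (eb a)).2 b := by
        rw [clm_decomp (D2 A z) u]
        simp [spatial_second_zero (hT' z hz).self_of_nhds (eventually_ball hA hz)]
      have h3 := time_second (hT' z hz) (eventually_ball hA hz) hk (hα z hz).1 (hα z hz).2.1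
        (eventually_ball (fun y hy => (hα y hy).2.2) hz) a b
      have h4 := (Coeffs.sign_eq (D := D) hk (hT _ hzt).2).1
      have h5 : (D2 A z tb (eb a)).2 b = k * deriv (deriv T) z.1 * spatialDeriv A (eb a) b z
          / (2 * D.scale z.1 ^ 2) := by
        rw [hsc _ hzt, ← h3]
        exact (mul_div_cancel_left₀ _ (mul_ne_zero two_ne_zero (hT _ hzt).2.ne')).symm
      simp only [add_apply, smul_apply, fderiv_spatialDeriv hs, h2, h5, h4, smul_eq_mul,
        ContinuousLinearMap.smulRight_apply, ContinuousLinearMap.coe_fst', zero_apply]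
      change spatialDeriv A (eb a) b z * (u.1 * ((0 * _ - 1 * (k * deriv (deriv T) z.1 / _)) / _))
        + _ = 0
      field_simp
      ring
    have := (Coeffs.scale_pos (hD _ (mem_ball_prod.1 hz).1)).ne'
    rw [← h1]
    field_simp
  have hc : c ∈ Metric.ball c r := Metric.mem_ball_self hr
  have hO : O ∈ Matrix.orthogonalGroup (Fin 2) ℝ := by
    have hs0 := (Coeffs.scale_pos (hD _ (mem_ball_prod.1 hc).1)).ne'
    have hss := hsc _ (mem_ball_prod.1 hc).1
    have r0 := (hA c hc).row0
    have r1 := (hA c hc).row1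
    have r01 := (hA c hc).row01
    simp only [← spatialDeriv.eq_def] at r0 r1 r01
    change spatialDeriv A (eb 0) 0 c ^ 2 + spatialDeriv A (eb 1) 0 c ^ 2 = _ at r0
    change spatialDeriv A (eb 0) 1 c ^ 2 + spatialDeriv A (eb 1) 1 c ^ 2 = _ at r1
    change spatialDeriv A (eb 0) 0 c * spatialDeriv A (eb 0) 1 c
      + spatialDeriv A (eb 1) 0 c * spatialDeriv A (eb 1) 1 c = _ at r01
    rw [← hss] at r0 r1
    simp only [hF c hc] at r0 r1 r01
    have q0 : O 0 0 * O 0 0 + O 0 1 * O 0 1 = 1 :=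
      mul_left_cancel₀ (pow_ne_zero 2 hs0) (by linear_combination r0)
    have q1 : O 1 0 * O 1 0 + O 1 1 * O 1 1 = 1 :=
      mul_left_cancel₀ (pow_ne_zero 2 hs0) (by linear_combination r1)
    have q01 : O 0 0 * O 1 0 + O 0 1 * O 1 1 = 0 :=
      mul_left_cancel₀ (pow_ne_zero 2 hs0) (by linear_combination r01)
    rw [Matrix.mem_orthogonalGroup_iff]
    ext i j
    fin_cases i <;> fin_cases j <;> simp [Matrix.mul_apply, Fin.sum_univ_two, q0, q1, q01]
    linarith
  let H : Fin 2 → BaseSpace → ℝ := fun b z => (A z).2 b - D.scale z.1 * (O b 0 * z.2 0 + O b 1 * z.2 1)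
  have hA2 : ∀ z ∈ Metric.ball c r, ∀ b, ContDiffAt ℝ ∞ (fun z => (A z).2 b) z := fun z hz b =>
    contDiffAt_pi.1 (hA z hz).smooth.snd b
  have hlin : ∀ z : BaseSpace, ∀ b, ContDiffAt ℝ ∞ (fun z : BaseSpace => O b 0 * z.2 0 + O b 1 * z.2 1) z :=
    fun z b => (contDiffAt_const.mul (contDiffAt_coord 0 z)).add
      (contDiffAt_const.mul (contDiffAt_coord 1 z))
  have hH : ∀ z ∈ Metric.ball c r, ∀ b, ContDiffAt ℝ ∞ (H b) z := fun z hz b =>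
    (hA2 z hz b).sub ((contDiffAt_time (Coeffs.contDiffAt_scale (hD _ (mem_ball_prod.1 hz).1))).mul
      (hlin z b))
  have hHx : ∀ z ∈ Metric.ball c r, ∀ b, H b z = H b (z.1, c.2) := by
    intro z hz b
    refine eq_of_partial_zero (fun z hz => contDiffAt_differentiableAt (hH z hz b))
      (fun z hz v => ?_) hz
    have hzt := (mem_ball_prod.1 hz).1
    have d1 : HasFDerivAt (fun z => (A z).2 b) _ z :=
      hasFDerivAt_pi'.1 (contDiffAt_differentiableAt (hA z hz).smooth).hasFDerivAt.snd b
    have d2 := hasFDerivAt_time (z := z) (Coeffs.hasDerivAt_scale (hD _ hzt))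
    have d3 := ((hasFDerivAt_coord 0 z).const_mul (O b 0)).add
      ((hasFDerivAt_coord 1 z).const_mul (O b 1))
    have d4 : HasFDerivAt (H b) _ z := d1.sub (d2.mul d3)
    have h1 : (fderiv ℝ A z (0, v)).2 b = D.scale z.1 * (O b 0 * v 0 + O b 1 * v 1) := by
      rw [clm_decomp]
      have e0 := hF z hz 0 b
      have e1 := hF z hz 1 b
      simp only [spatialDeriv] at e0 e1
      simp only [zero_smul, zero_add, Prod.snd_add, Prod.smul_snd, Pi.add_apply, Pi.smul_apply,
        smul_eq_mul, e0, e1]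
      ring
    rw [d4.fderiv]
    change (fderiv ℝ A z (0, v)).2 b - _ = 0
    rw [h1]
    simp [coordL_apply]
    ring
  refine ⟨O, fun b t => H b (t, c.2), fun t ht => ⟨(hT t ht).1, fun b => ?_, contDiffAt_const,
    (hD t ht).deriv_ne, hO⟩, fun z hz => ?_⟩
  · exact ContDiffAt.comp (g := H b) (f := fun t => (t, c.2)) t
      (hH (t, c.2) (mem_ball_prod.2 ⟨ht, Metric.mem_ball_self hr⟩) b)
      (contDiffAt_id.prodMk contDiffAt_const)
  · refine Prod.ext (hAT z hz) (funext fun b => ?_)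
    have h1 := hHx z hz b
    simp only [Coeffs.base, newX, Fin.sum_univ_two, ← h1]
    change _ = D.scale z.1 * _ + ((A z).2 b - D.scale z.1 * _)
    ring

/-- A smooth curve on the unit circle locally has a smooth phase. -/
theorem exists_phase {b : ℝ → ℂ} {t₀ r : ℝ} (hr : 0 < r)
    (hb : ∀ t ∈ Metric.ball t₀ r, ContDiffAt ℝ ∞ b t ∧ ‖b t‖ = 1) :
    ∃ (Ψ : ℝ → ℝ) (r' : ℝ), 0 < r' ∧ r' ≤ r ∧ ∀ t ∈ Metric.ball t₀ r', ContDiffAt ℝ ∞ Ψ t ∧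
      b t = Complex.exp (I * (Ψ t : ℂ)) := by
  have h0 := hb t₀ (Metric.mem_ball_self hr)
  have hb0 : b t₀ ≠ 0 := by
    rw [← norm_ne_zero_iff, h0.2]
    exact one_ne_zero
  have hev : ∀ᶠ t in 𝓝 t₀, b t / b t₀ ∈ Complex.slitPlane := by
    have hc : ContinuousAt (fun t => b t / b t₀) t₀ := h0.1.continuousAt.div_const _
    refine hc.eventually (Complex.isOpen_slitPlane.mem_nhds ?_)
    simp only [div_self hb0]
    exact Complex.one_mem_slitPlane
  obtain ⟨r1, hr1, hball⟩ := Metric.eventually_nhds_iff_ball.1 hev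
  refine ⟨fun t => (Complex.log (b t / b t₀)).im + (b t₀).arg, min r r1, lt_min hr hr1,
    min_le_left _ _, fun t ht => ?_⟩
  have ht0 := hb t (Metric.ball_subset_ball (min_le_left _ _) ht)
  have ht1 := hball t (Metric.ball_subset_ball (min_le_right _ _) ht)
  constructor
  · have h1 : ContDiffAt ℝ ∞ (fun t => Complex.log (b t / b t₀)) t :=
      ContDiffAt.comp (g := Complex.log) (f := fun t => b t / b t₀) t
        ((Complex.contDiffAt_log ht1).restrict_scalars ℝ) (ht0.1.div_const _)
    exact (Complex.imCLM.contDiff.contDiffAt.comp t h1).add contDiffAt_const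
  · have h1 : (Complex.log (b t / b t₀)).re = 0 := by
      rw [Complex.log_re, norm_div, ht0.2, h0.2]
      simp
    have h2 : I * ((Complex.log (b t / b t₀)).im : ℂ) = Complex.log (b t / b t₀) := by
      apply Complex.ext <;> simp [h1]
    have h3 : Complex.exp (I * ((b t₀).arg : ℂ)) = b t₀ := by
      have := Complex.norm_mul_exp_arg_mul_I (b t₀)
      rw [h0.2] at this
      rw [mul_comm I]
      simpa using this
    rw [Complex.ofReal_add, mul_add, Complex.exp_add, h2, h3,
      Complex.exp_log (Complex.slitPlane_ne_zero ht1), div_mul_cancel₀ _ hb0]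

theorem alpha_eq_mul_exp (T : ℝ → ℝ) (O : Matrix (Fin 2) (Fin 2) ℝ) (X : Fin 2 → ℝ → ℝ)
    (Ψ : ℝ → ℝ) (z : BaseSpace) : (Coeffs.mk T O X Ψ).alpha z
      = (Coeffs.mk T O X 0).alpha z * Complex.exp (I * (Ψ z.1 : ℂ)) := by
  simp only [Coeffs.alpha, phase, Pi.zero_apply, add_zero]
  rw [Complex.ofReal_add, mul_add, Complex.exp_add]
  ring

/-- Every admissible transformation locally has the explicit form. -/
theorem explicit_of_admissible {V V' : Potential} {e : OpenPartialHomeomorph VarSpace VarSpace}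
    (he : e ∈ admissible V V') {p : VarSpace} (hp : p ∈ e.source) :
    ∃ D, ExplicitNear e D p := by
  obtain ⟨r, k, T, A, C, hr, hk, hball, hT, hA, hAT, heA⟩ := exists_base he hp
  obtain ⟨α, hα, heα⟩ := exists_fibre he hr hk hball hA heA
  obtain ⟨O, X, hD, hAD⟩ := base_explicit hr hk hT hA hAT
    (fun z hz => ⟨(hα z hz).1, (hα z hz).2.1, (hα z hz).2.2.1⟩)
  let D0 : Coeffs := ⟨T, O, X, 0⟩
  have hv : ∀ z ∈ Metric.ball p.1 r, D0.ValidAt z.1 := fun z hz => hD _ (mem_ball_prod.1 hz).1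
  let β : BaseSpace → ℂ := fun z => α z / D0.alpha z
  have hβs : ∀ z ∈ Metric.ball p.1 r, ContDiffAt ℝ ∞ β z := fun z hz => by
    simp only [β, div_eq_mul_inv]
    exact (hα z hz).1.mul
      ((Coeffs.contDiffAt_alpha (hv z hz)).inv (Coeffs.alpha_ne_zero (hv z hz)))
  have hsign : ∀ z ∈ Metric.ball p.1 r, Real.sign (deriv T z.1) = k ∧
      |deriv T z.1| = k * deriv T z.1 := fun z hz =>
    Coeffs.sign_eq (D := D0) hk (hT _ (mem_ball_prod.1 hz).1).2
  have hαx : ∀ z ∈ Metric.ball p.1 r, ∀ a,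
      fderiv ℝ α z (eb a) = I * (D0.grad a z : ℂ) * α z := by
    intro z hz a
    have hAe : A =ᶠ[𝓝 z] D0.base := eventually_ball hAD hz
    have j1 := (hA z hz).coeff a
    have j2 := (Coeffs.baseJet (hv z hz)).coeff a
    rw [← hAe.fderiv_eq, ← D2_congr hAe, (hsign z hz).1, (hsign z hz).2, ← j1] at j2
    have hm : ((k * deriv T z.1 : ℝ) : ℂ) ≠ 0 := by exact_mod_cast (hA z hz).pos.ne'
    have h2 := (hα z hz).2.2.1 a
    rw [← mul_left_cancel₀ hm j2] at h2
    linear_combination h2 / 2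
  have hβx : ∀ z ∈ Metric.ball p.1 r, β z = β (z.1, p.1.2) := by
    intro z hz
    refine eq_of_partial_zero (fun z hz => contDiffAt_differentiableAt (hβs z hz))
      (fun z hz v => ?_) hz
    have d1 := contDiffAt_differentiableAt (hα z hz).1
    have d2 := contDiffAt_differentiableAt (Coeffs.contDiffAt_alpha (hv z hz))
    have h0 := Coeffs.alpha_ne_zero (hv z hz)
    have h1 : ∀ a, fderiv ℝ β z (eb a) = 0 := by
      intro a
      have h2 : fderiv ℝ (fun z => β z * D0.alpha z) z (eb a) = fderiv ℝ α z (eb a) := by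
        have : (fun z => β z * D0.alpha z) =ᶠ[𝓝 z] α :=
          eventually_ball (P := fun z => β z * D0.alpha z = α z)
            (fun y hy => div_mul_cancel₀ _ (Coeffs.alpha_ne_zero (hv y hy))) hz
        rw [this.fderiv_eq]
      have h3 : HasFDerivAt (fun z => β z * D0.alpha z) _ z :=
        (contDiffAt_differentiableAt (hβs z hz)).hasFDerivAt.mul d2.hasFDerivAt
      rw [h3.fderiv] at h2
      simp only [add_apply, smul_apply, smul_eq_mul, Coeffs.fderiv_alpha_eb (hv z hz),
        hαx z hz] at h2
      have h4 : β z * D0.alpha z = α z := div_mul_cancel₀ _ h0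
      refine mul_left_cancel₀ h0 ?_
      linear_combination h2 - I * (D0.grad a z : ℂ) * h4
    rw [clm_decomp]
    simp [h1]
  have hβn : ∀ z ∈ Metric.ball p.1 r, ‖β z‖ = 1 := by
    intro z hz
    have h1 := (hα z hz).2.2.2
    have h2 := Coeffs.norm_alpha_sq (hv z hz)
    have h3 : |deriv D0.T z.1| = k * deriv T z.1 := (hsign z hz).2
    rw [h3, ← h1] at h2
    have h4 := mul_left_cancel₀ (hA z hz).pos.ne' h2
    have h5 : ‖D0.alpha z‖ = ‖α z‖ := (pow_left_inj₀ (norm_nonneg _) (norm_nonneg _)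
      two_ne_zero).1 h4
    rw [norm_div, h5, div_self (norm_ne_zero_iff.2 (hα z hz).2.1)]
  have hx : ∀ t ∈ Metric.ball p.1.1 r, (t, p.1.2) ∈ Metric.ball p.1 r := fun t ht =>
    mem_ball_prod.2 ⟨ht, Metric.mem_ball_self hr⟩
  obtain ⟨Ψ, r', hr', hrr', hΨ⟩ := exists_phase (b := fun t => β (t, p.1.2)) hr fun t ht =>
    ⟨ContDiffAt.comp (g := β) (f := fun t => (t, p.1.2)) t (hβs _ (hx t ht))
      (contDiffAt_id.prodMk contDiffAt_const), hβn _ (hx t ht)⟩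
  refine ⟨⟨T, O, X, Ψ⟩, ⟨Metric.ball p.1.1 r', ⟨Metric.isOpen_ball, fun t ht => ?_⟩,
    Metric.mem_ball_self hr'⟩, ?_⟩
  · have h1 := hD t (Metric.ball_subset_ball hrr' ht)
    exact ⟨h1.smoothT, h1.smoothX, (hΨ t ht).1, h1.deriv_ne, h1.orth⟩
  · filter_upwards [Metric.ball_mem_nhds p hr'] with q hq
    have hq' := Metric.ball_subset_ball hrr' hq
    have hq1 := (mem_ball_prod.1 hq').1
    refine Prod.ext ((heA q hq').trans (hAD _ hq1)) ?_
    rw [heα q hq']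
    change _ = (Coeffs.mk T O X Ψ).alpha q.1 * hat (deriv T q.1.1) q.2
    rw [alpha_eq_mul_exp, ← (hΨ _ (mem_ball_prod.1 (mem_ball_prod.1 hq).1).1).2, ← hβx _ hq1]
    have h1 : D0.alpha q.1 * β q.1 = α q.1 := mul_div_cancel₀ _ (Coeffs.alpha_ne_zero (hv _ hq1))
    change _ = D0.alpha q.1 * β q.1 * _
    rw [h1]
    congr 1
    have h2 := (hT _ (mem_ball_prod.1 hq1).1).2
    simp only [hat]
    rcases hk with rfl | rfl
    · rw [if_pos one_pos, if_pos (by linarith)]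
    · rw [if_neg (by norm_num), if_neg (by linarith)]

theorem lhs_congr {V W : Potential} {f g : BaseSpace → ℂ} {z : BaseSpace}
    (hV : V.toFun z = W.toFun z) (h : f =ᶠ[𝓝 z] g) : lhs V f z = lhs W g z := by
  have h2 : ∀ a, dx a f =ᶠ[𝓝 z] dx a g := fun a =>
    (h.eventuallyEq_nhds.mono fun y hy => by simp only [dx, hy.fderiv_eq])
  have h3 : ∀ a, dx a (dx a f) z = dx a (dx a g) z := fun a => by
    rw [dx, (h2 a).fderiv_eq, ← dx]
  simp only [lhs, dt, h.fderiv_eq, h3, h.self_of_nhds, hV]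

theorem admissible_of_eqOn {V V' W W' : Potential}
    {e e' : OpenPartialHomeomorph VarSpace VarSpace} (he : e ∈ admissible V V')
    (hsub : e'.source ⊆ e.source) (heq : ∀ p ∈ e'.source, e' p = e p)
    (hW : ∀ p ∈ e'.source, p.1 ∈ W.domain ∧ W.toFun p.1 = V.toFun p.1)
    (hW' : ∀ p ∈ e'.source, (e p).1 ∈ W'.domain ∧ W'.toFun (e p).1 = V'.toFun (e p).1) :
    e' ∈ admissible W W' := by
  refine ⟨⟨(he.1.1.mono hsub).congr heq, ?_⟩, fun p hp => ⟨(hW p hp).1, ?_⟩, ?_⟩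
  · have h1 : ∀ q ∈ e'.target, q ∈ e.target ∧ e'.symm q = e.symm q := by
      intro q hq
      have h2 := e'.map_target hq
      have h3 := heq _ h2
      rw [e'.right_inv hq] at h3
      have h4 := e.map_source (hsub h2)
      rw [← h3] at h4
      refine ⟨h4, ?_⟩
      rw [h3, e.left_inv (hsub h2), ← h3]
    exact (he.1.2.mono fun q hq => (h1 q hq).1).congr fun q hq => (h1 q hq).2
  · rw [heq p hp]
    exact (hW' p hp).1
  · intro f g z w hf hg hm
    obtain ⟨hz, hw, hev⟩ := hm
    have hc : ContinuousAt (fun y => (y, f y)) z := continuousAt_id.prodMk hf.continuousAt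
    have hm' : MapsGraph e f g z w := by
      refine ⟨hsub hz, (heq _ hz).symm.trans hw, ?_⟩
      filter_upwards [hev, hc.eventually (e'.open_source.mem_nhds hz)] with y hy hys
      rw [← heq _ hys]
      exact hy
    have h1 := he.2.2 f g z w hf hg hm'
    have h2 := (hW _ hz).2
    have h3 := (hW' _ hz).2
    rw [hm'.2.1] at h3
    rwa [lhs_congr h2 (Filter.EventuallyEq.refl _ f), lhs_congr h3 (Filter.EventuallyEq.refl _ g)]

theorem injective_on_graph {V V' : Potential} {e : OpenPartialHomeomorph VarSpace VarSpace}
    (he : e ∈ admissible V V') {p : VarSpace} (hp : p ∈ e.source) (Q : BaseSpace →L[ℝ] ℂ) :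
    Function.Injective fun u => (fderiv ℝ e p (u, Q u)).1 := by
  obtain ⟨h1, h2, -⟩ := fibre_preserving he hp
  have h3 : ∀ u, (fderiv ℝ e p (u, Q u)).1 = (fderiv ℝ e p (u, 0)).1 := fun u => by
    have : ((u, Q u) : VarSpace) = (u, 0) + (0, Q u) := by simp
    rw [this, map_add, Prod.fst_add, h1, add_zero]
  intro u v huv
  simp only [h3] at huv
  exact h2 huv

theorem admissible_trans {V V' V'' : Potential} {e e' : OpenPartialHomeomorph VarSpace VarSpace}
    (he : e ∈ admissible V V') (he' : e' ∈ admissible V' V'') :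
    e.trans e' ∈ admissible V V'' := by
  have hsrc : ∀ p ∈ (e.trans e').source, p ∈ e.source ∧ e p ∈ e'.source := fun p hp => by
    rw [OpenPartialHomeomorph.trans_source] at hp
    exact hp
  refine ⟨⟨?_, ?_⟩, fun p hp => ?_, ?_⟩
  · intro p hp
    obtain ⟨h1, h2⟩ := hsrc p hp
    exact (ContDiffAt.comp (g := e') (f := e) p (he'.1.contDiffAt h2)
      (he.1.contDiffAt h1)).contDiffWithinAt
  · intro p hp
    rw [OpenPartialHomeomorph.trans_target] at hp
    exact (ContDiffAt.comp (g := e.symm) (f := e'.symm) p (he.1.symm.contDiffAt hp.2)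
      (he'.1.symm.contDiffAt hp.1)).contDiffWithinAt
  · obtain ⟨h1, h2⟩ := hsrc p hp
    exact ⟨(he.2.1 p h1).1, (he'.2.1 _ h2).2⟩
  · intro f h z w hf hh hm
    obtain ⟨hz, hw, hev⟩ := hm
    obtain ⟨h1, h2⟩ := hsrc _ hz
    obtain ⟨g, n, hg, hmg, hn, hnz, hng, -⟩ :=
      exists_image he.1 hf h1 (injective_on_graph he h1 (fderiv ℝ f z))
    refine (he.2.2 f g z _ hf hg hmg).trans (he'.2.2 g h _ w hg hh ⟨?_, ?_, ?_⟩)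
    · rw [← hmg.2.1]
      exact h2
    · rw [← hmg.2.1]
      exact hw
    · rw [← hnz] at hev
      filter_upwards [hn.eventually hev, hng] with y hy1 hy2
      rw [← hy2]
      exact hy1

theorem admissible_symm {V V' : Potential} {e : OpenPartialHomeomorph VarSpace VarSpace}
    (he : e ∈ admissible V V') : e.symm ∈ admissible V' V := by
  refine ⟨he.1.symm, fun p hp => ?_, ?_⟩
  · have h1 := he.2.1 _ (e.map_target hp)
    rw [e.right_inv hp] at h1
    exact ⟨h1.2, h1.1⟩
  · intro f g z w hf hg hm
    obtain ⟨hz, hw, hev⟩ := hm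
    have hs : (w, g w) ∈ e.source := hw ▸ e.map_target hz
    have hew : e (w, g w) = (z, f z) := by rw [← hw, e.right_inv hz]
    have hinj : Function.Injective fun u => (fderiv ℝ e.symm (z, f z) (u, fderiv ℝ f z u)).1 := by
      intro u v huv
      have h1 : ∀ q, fderiv ℝ e (w, g w) (fderiv ℝ e.symm (z, f z) q) = q := fun q => by
        have := he.1.symm.leftInverse hz q
        rwa [OpenPartialHomeomorph.symm_symm, hw] at this
      have h2 := (fibre_preserving he hs).1 (fderiv ℝ e.symm (z, f z) (u, fderiv ℝ f z u)
        - fderiv ℝ e.symm (z, f z) (v, fderiv ℝ f z v)).2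
      have h3 : ((0 : BaseSpace), (fderiv ℝ e.symm (z, f z) (u, fderiv ℝ f z u)
          - fderiv ℝ e.symm (z, f z) (v, fderiv ℝ f z v)).2)
          = fderiv ℝ e.symm (z, f z) (u, fderiv ℝ f z u)
            - fderiv ℝ e.symm (z, f z) (v, fderiv ℝ f z v) :=
        Prod.ext (sub_eq_zero.2 huv).symm rfl
      rw [h3, map_sub, h1, h1] at h2
      exact sub_eq_zero.1 h2
    obtain ⟨g', n, -, hmg, hn, hnz, hng, -⟩ := exists_image he.1.symm hf hz hinj
    rw [hw] at hn hnz hng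
    simp only at hn hnz hng
    have hm' : MapsGraph e g f w z := by
      refine ⟨hs, hew, ?_⟩
      have hc : ContinuousAt (fun y => (y, f y)) (n w) := by
        rw [hnz]
        exact continuousAt_id.prodMk hf.continuousAt
      have hc' : ContinuousAt (fun y => (n y, f (n y))) w := hc.comp hn
      have hev' : ∀ᶠ z' in 𝓝 (n w), (e.symm (z', f z')).2 = g (e.symm (z', f z')).1 := by
        rwa [hnz]
      have hsrc : ∀ᶠ y in 𝓝 w, (n y, f (n y)) ∈ e.target :=
        hc'.eventually (e.open_target.mem_nhds (by simp only [hnz]; exact hz))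
      filter_upwards [hng, hn.eventually hev', hsrc] with y h1 h2 h3
      rw [h1] at h2
      simp only at h2
      have h4 := e.right_inv h3
      rw [h1, h2] at h4
      rw [h4]
    exact (he.2.2 g f w z hg hf hm').symm

/-- The potential `v`, constant on the whole space. -/
noncomputable def constPotential (v : ℂ) : Potential :=
  ⟨Set.univ, fun _ => v, isOpen_univ, contDiffOn_const⟩

theorem refl_mem_admissible (v : ℂ) :
    OpenPartialHomeomorph.refl VarSpace ∈ admissible (constPotential v) (constPotential v) := by
  refine ⟨⟨contDiffOn_id, contDiffOn_id⟩, fun p _ => ⟨trivial, trivial⟩, ?_⟩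
  intro f g z w hf hg hm
  obtain ⟨-, hw, hev⟩ := hm
  simp only [OpenPartialHomeomorph.refl_apply, id_eq, Prod.mk.injEq] at hw hev
  obtain ⟨rfl, -⟩ := hw
  rw [lhs_congr rfl hev]

/-- The union of two potentials with disjoint domains. -/
noncomputable def unionPotential (V W : Potential) (h : Disjoint V.domain W.domain) :
    Potential := by
  classical
  exact
  { domain := V.domain ∪ W.domain
    toFun := fun z => if z ∈ V.domain then V.toFun z else W.toFun z
    isOpen_domain := V.isOpen_domain.union W.isOpen_domain
    smooth := by
      rintro z (hz | hz)
      · have h1 := V.smooth.contDiffAt (V.isOpen_domain.mem_nhds hz)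
        refine (h1.congr_of_eventuallyEq ?_).contDiffWithinAt
        filter_upwards [V.isOpen_domain.mem_nhds hz] with y hy
        rw [if_pos hy]
      · have h1 := W.smooth.contDiffAt (W.isOpen_domain.mem_nhds hz)
        refine (h1.congr_of_eventuallyEq ?_).contDiffWithinAt
        filter_upwards [W.isOpen_domain.mem_nhds hz] with y hy
        rw [if_neg (Set.disjoint_right.1 h hy)] }

theorem unionPotential_left {V W : Potential} (h : Disjoint V.domain W.domain) {z : BaseSpace}
    (hz : z ∈ V.domain) : z ∈ (unionPotential V W h).domain ∧
      (unionPotential V W h).toFun z = V.toFun z :=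
  ⟨Or.inl hz, if_pos hz⟩

theorem unionPotential_right {V W : Potential} (h : Disjoint V.domain W.domain) {z : BaseSpace}
    (hz : z ∈ W.domain) : z ∈ (unionPotential V W h).domain ∧
      (unionPotential V W h).toFun z = W.toFun z :=
  ⟨Or.inr hz, if_neg (Set.disjoint_right.1 h hz)⟩

theorem contDiffAt_pot {D : Coeffs} {J : Set ℝ} (hJ : D.ValidOn J) {z : BaseSpace} (hz : z.1 ∈ J)
    {f : BaseSpace → ℂ} (hf : ContDiffAt ℝ ∞ f z) :
    ContDiffAt ℝ ∞ (fun y => D.pot y (f y)) z := by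
  have h := hJ.valid _ hz
  have ht : Filter.Tendsto (fun y : BaseSpace => y.1) (𝓝 z) (𝓝 z.1) := continuous_fst.continuousAt
  have h1 : ContDiffAt ℝ ∞ (fun y => (((|deriv D.T y.1|)⁻¹ : ℝ) : ℂ)
      * hat (Real.sign (deriv D.T z.1)) (f y) + D.shift y) z :=
    ((contDiffAt_ofReal (contDiffAt_time (Coeffs.contDiffAt_inv_abs h))).mul
      (contDiffAt_hat hf _)).add (Coeffs.contDiffAt_shift h)
  refine h1.congr_of_eventuallyEq ?_
  filter_upwards [ht.eventually (Coeffs.eventually_hat h), ht.eventually (hJ.isOpen.mem_nhds hz)]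
    with y hy1 hy2
  rw [Coeffs.pot_eq' (hJ.valid _ hy2), hy1]

/-- The image of potentials under an explicit transformation, near a point. -/
theorem exists_push {D : Coeffs} {J : Set ℝ} (hJ : D.ValidOn J) {z₀ : BaseSpace}
    (hz₀ : z₀.1 ∈ J) : ∃ s : Set BaseSpace, IsOpen s ∧ z₀ ∈ s ∧ (∀ z ∈ s, z.1 ∈ J) ∧
      ∀ V : Potential, ∃ V' : Potential, ∀ z ∈ s, z ∈ V.domain → D.base z ∈ V'.domain ∧
        V'.toFun (D.base z) = D.pot z (V.toFun z) := by
  obtain ⟨b', hb'0, hb'⟩ := exists_local_homeo (Coeffs.contDiffAt_base (hJ.valid _ hz₀))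
    (Coeffs.injective_fderiv_base (hJ.valid _ hz₀))
  let b := b'.restr {z | z.1 ∈ J}
  have hJo : IsOpen {z : BaseSpace | z.1 ∈ J} := hJ.isOpen.preimage continuous_fst
  have hbs : ∀ z, z ∈ b.source ↔ z ∈ b'.source ∧ z.1 ∈ J := fun z => by
    rw [OpenPartialHomeomorph.restr_source, hJo.interior_eq]
    rfl
  have hb : ∀ z, b z = D.base z := hb'
  refine ⟨b.source, b.open_source, (hbs _).2 ⟨hb'0, hz₀⟩, fun z hz => ((hbs z).1 hz).2,
    fun V => ?_⟩
  have hopen : IsOpen (b.target ∩ b.symm ⁻¹' V.domain) :=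
    b.symm.isOpen_inter_preimage V.isOpen_domain
  refine ⟨⟨b.target ∩ b.symm ⁻¹' V.domain, fun w => D.pot (b.symm w) (V.toFun (b.symm w)),
    hopen, ?_⟩, fun z hz hzV => ?_⟩
  · rintro w ⟨hw, hwV⟩
    have h1 := b.map_target hw
    have h2 := ((hbs _).1 h1).2
    have h3 := contDiffAt_symm_of_immersion h1 (Filter.Eventually.of_forall hb)
      (Coeffs.contDiffAt_base (hJ.valid _ h2)) (Coeffs.injective_fderiv_base (hJ.valid _ h2))
    rw [b.right_inv hw] at h3
    exact (ContDiffAt.comp (g := fun z => D.pot z (V.toFun z)) (f := b.symm) w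
      (contDiffAt_pot hJ h2 (V.smooth.contDiffAt (V.isOpen_domain.mem_nhds hwV)))
      h3).contDiffWithinAt
  · rw [← hb z]
    refine ⟨⟨b.map_source hz, ?_⟩, ?_⟩
    · rw [Set.mem_preimage, b.left_inv hz]
      exact hzV
    · simp only [b.left_inv hz]

/-- The transformation has the explicit form near each point of its domain. -/
def LocallyExplicit (e : OpenPartialHomeomorph VarSpace VarSpace) : Prop :=
  ∀ p ∈ e.source, ∃ D, ExplicitNear e D p

theorem ExplicitNear.congr {e e' : OpenPartialHomeomorph VarSpace VarSpace} {D : Coeffs}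
    {p : VarSpace} (h : ExplicitNear e D p) (he : ∀ᶠ q in 𝓝 p, e' q = e q) :
    ExplicitNear e' D p :=
  ⟨h.1, by filter_upwards [h.2, he] with q h1 h2; rw [h2, h1]⟩

theorem mem_restr_source {X Y : Type*} [TopologicalSpace X] [TopologicalSpace Y]
    {e : OpenPartialHomeomorph X Y} {s : Set X} (hs : IsOpen s) {p : X} :
    p ∈ (e.restr s).source ↔ p ∈ e.source ∧ p ∈ s := by
  rw [OpenPartialHomeomorph.restr_source, hs.interior_eq]
  rfl

/-- Near a point where it has the explicit form, a transformation is admissible from each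
equation to a suitable equation. -/
theorem exists_push_admissible {e : OpenPartialHomeomorph VarSpace VarSpace} {D : Coeffs}
    {p : VarSpace} (hD : ExplicitNear e D p) : ∃ s : Set VarSpace, IsOpen s ∧ p ∈ s ∧
      ∀ V : Potential, ∃ V' : Potential, ∀ s' : Set VarSpace, IsOpen s' → s' ⊆ s →
        (∀ q ∈ s', q.1 ∈ V.domain) → e.restr s' ∈ admissible V V' := by
  obtain ⟨J, hJ, hp⟩ := hD.1
  obtain ⟨s0, hs0, hps0, -, hpush⟩ := exists_push hJ hp
  obtain ⟨s1, hs1, hs1o, hps1⟩ := eventually_nhds_iff.1 hD.eventually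
  refine ⟨s1 ∩ Prod.fst ⁻¹' s0, hs1o.inter (hs0.preimage continuous_fst), ⟨hps1, hps0⟩, fun V => ?_⟩
  obtain ⟨V', hV'⟩ := hpush V
  refine ⟨V', fun s' hs' hsub hV => admissible_of_explicit (fun q hq => ?_) fun q hq => ?_⟩
  · have hq2 := ((mem_restr_source hs').1 hq).2
    refine ⟨hV q hq2, ?_⟩
    have h1 := (hV' q.1 (hsub hq2).2 (hV q hq2)).1
    have h2 : e q = D.map q := (hs1 q (hsub hq2).1).2.self_of_nhds
    rw [OpenPartialHomeomorph.restr_apply, h2]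
    exact h1
  · have hq2 := ((mem_restr_source hs').1 hq).2
    exact ⟨D, hs1 q (hsub hq2).1, (hV' q.1 (hsub hq2).2 (hV q hq2)).2⟩

/-- The transformation of the potential is determined by the transformation of `(t, x, ψ)`. -/
theorem pot_unique {e : OpenPartialHomeomorph VarSpace VarSpace} {D D' : Coeffs} {p : VarSpace}
    (hp : p ∈ e.source) (hD : ExplicitNear e D p) (hD' : ExplicitNear e D' p) (v : ℂ) :
    D.pot p.1 v = D'.pot p.1 v := by
  obtain ⟨s, hs, hps, h⟩ := exists_push_admissible hD
  obtain ⟨V', hV'⟩ := h (constPotential v)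
  have h1 := hV' s hs subset_rfl fun _ _ => trivial
  have hp' : p ∈ (e.restr s).source := (mem_restr_source hs).2 ⟨hp, hps⟩
  exact (potential_eq h1 hp' (hD.congr (Filter.Eventually.of_forall fun _ => rfl))).symm.trans
    (potential_eq h1 hp' (hD'.congr (Filter.Eventually.of_forall fun _ => rfl)))

theorem locallyExplicit_trans {e e' : OpenPartialHomeomorph VarSpace VarSpace}
    (he : LocallyExplicit e) (he' : LocallyExplicit e') : LocallyExplicit (e.trans e') := by
  intro p hp
  rw [OpenPartialHomeomorph.trans_source] at hp
  obtain ⟨D, hD⟩ := he p hp.1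
  obtain ⟨D', hD'⟩ := he' _ hp.2
  obtain ⟨s, hs, hps, h⟩ := exists_push_admissible hD
  obtain ⟨V1, hV1⟩ := h (constPotential 0)
  have h1 := hV1 s hs subset_rfl fun _ _ => trivial
  have hp1 : p ∈ (e.restr s).source := (mem_restr_source hs).2 ⟨hp.1, hps⟩
  obtain ⟨s', hs', hps', h'⟩ := exists_push_admissible hD'
  obtain ⟨V2, hV2⟩ := h' V1
  have hop : IsOpen (s' ∩ {q | q.1 ∈ V1.domain}) :=
    hs'.inter (V1.isOpen_domain.preimage continuous_fst)
  have h2 := hV2 _ hop Set.inter_subset_left fun q hq => hq.2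
  have hp2 : p ∈ ((e.restr s).trans (e'.restr (s' ∩ {q | q.1 ∈ V1.domain}))).source := by
    rw [OpenPartialHomeomorph.trans_source]
    exact ⟨hp1, (mem_restr_source hop).2 ⟨hp.2, hps', (h1.2.1 p hp1).2⟩⟩
  obtain ⟨D'', hD''⟩ := explicit_of_admissible (admissible_trans h1 h2) hp2
  exact ⟨D'', hD''.congr (Filter.Eventually.of_forall fun _ => rfl)⟩

theorem locallyExplicit_symm {e : OpenPartialHomeomorph VarSpace VarSpace}
    (he : LocallyExplicit e) : LocallyExplicit e.symm := by
  intro p hp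
  have hp0 := e.map_target hp
  obtain ⟨D, hD⟩ := he _ hp0
  obtain ⟨s, hs, hps, h⟩ := exists_push_admissible hD
  obtain ⟨V1, hV1⟩ := h (constPotential 0)
  have h1 := hV1 s hs subset_rfl fun _ _ => trivial
  have hp1 : e.symm p ∈ (e.restr s).source := (mem_restr_source hs).2 ⟨hp0, hps⟩
  have hp2 : p ∈ (e.restr s).symm.source := by
    have := (e.restr s).map_source hp1
    rwa [OpenPartialHomeomorph.restr_apply, e.right_inv hp] at this
  obtain ⟨D', hD'⟩ := explicit_of_admissible (admissible_symm h1) hp2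
  exact ⟨D', hD'.congr (Filter.Eventually.of_forall fun _ => rfl)⟩

/-- The pseudogroup of the transformations which locally have the explicit form. -/
def explicitGroupoid : StructureGroupoid VarSpace where
  members := {e | LocallyExplicit e}
  trans' _ _ he he' := locallyExplicit_trans he he'
  symm' _ he := locallyExplicit_symm he
  id_mem' _ hp := explicit_of_admissible (refl_mem_admissible 0) hp
  locality' e h p hp := by
    obtain ⟨s, hs, hps, h1⟩ := h p hp
    obtain ⟨D, hD⟩ := h1 p ((mem_restr_source hs).2 ⟨hp, hps⟩)
    exact ⟨D, hD.congr (Filter.Eventually.of_forall fun _ => rfl)⟩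
  mem_of_eqOnSource' e e' he h p hp := by
    obtain ⟨D, hD⟩ := he p (h.1 ▸ hp)
    refine ⟨D, hD.congr ?_⟩
    filter_upwards [e'.open_source.mem_nhds hp] with q hq
    exact h.2 hq

/-- The translation of time by `c`. -/
noncomputable def translation (c : ℝ) : Coeffs := ⟨fun t => t + c, 1, fun _ _ => 0, 0⟩

theorem translation_validOn (c : ℝ) : (translation c).ValidOn Set.univ := by
  refine ⟨isOpen_univ, fun t _ => ⟨contDiffAt_id.add contDiffAt_const, fun _ => contDiffAt_const,
    contDiffAt_const, ?_, one_mem _⟩⟩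
  simp [translation]

theorem translation_pot (c : ℝ) (z : BaseSpace) : (translation c).pot z 0 = 0 := by
  have h1 : deriv (fun t : ℝ => t + c) = fun _ => 1 := by
    ext t
    simp
  simp [translation, Coeffs.pot, newV, iteratedDeriv_succ, h1, hat]

theorem exists_translation (c : ℝ) (p : VarSpace) :
    ∃ τ ∈ pointSymmetries (constPotential 0), p ∈ τ.source ∧ ∀ q, (τ q).1.1 = q.1.1 + c := by
  have hv := (translation_validOn c).valid p.1.1 trivial
  obtain ⟨τ, hτp, hτ⟩ := exists_local_homeo (Coeffs.map_immersion hv).1 (Coeffs.map_immersion hv).2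
  refine ⟨τ, admissible_of_explicit (fun _ _ => ⟨trivial, trivial⟩) fun q _ =>
    ⟨translation c, ⟨⟨Set.univ, translation_validOn c, trivial⟩, Filter.Eventually.of_forall hτ⟩,
      (translation_pot c q.1).symm⟩, hτp, fun q => ?_⟩
  rw [hτ]
  rfl

/-- The restriction of a potential to an open set. -/
def restrPotential (V : Potential) (U : Set BaseSpace) (hU : IsOpen U) : Potential :=
  ⟨V.domain ∩ U, V.toFun, V.isOpen_domain.inter hU, V.smooth.mono Set.inter_subset_left⟩

theorem locallyExplicit_mem_of_symmetries {G : StructureGroupoid VarSpace}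
    (hG : ∀ V : Potential, ∀ e ∈ pointSymmetries V, e ∈ G)
    {e : OpenPartialHomeomorph VarSpace VarSpace} (he : LocallyExplicit e) : e ∈ G := by
  refine G.locality fun p hp => ?_
  obtain ⟨τ, hτ, hτp, hτt⟩ := exists_translation (p.1.1 - (e p).1.1 + 2) (e p)
  have hτG := hG _ τ hτ
  have hτe : LocallyExplicit τ := fun q hq => explicit_of_admissible hτ hq
  let e' := e.trans τ
  have hp' : p ∈ e'.source := by
    rw [OpenPartialHomeomorph.trans_source]
    exact ⟨hp, hτp⟩
  obtain ⟨D, hD⟩ := locallyExplicit_trans he hτe p hp'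
  obtain ⟨s, hs, hps, h⟩ := exists_push_admissible hD
  obtain ⟨V', hV'⟩ := h (constPotential 0)
  have h1 := hV' s hs subset_rfl fun _ _ => trivial
  let a := p.1.1 + 1
  have hc : ContinuousAt (fun q : VarSpace => q.1.1) p :=
    (continuous_fst.comp continuous_fst).continuousAt
  have hc' : ContinuousAt (fun q : VarSpace => (e' q).1.1) p :=
    ContinuousAt.comp (g := fun q : VarSpace => q.1.1)
      (continuous_fst.comp continuous_fst).continuousAt (e'.continuousAt hp')
  have hev : ∀ᶠ q in 𝓝 p, q ∈ s ∧ q ∈ e'.source ∧ q.1.1 < a ∧ a < (e' q).1.1 := by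
    refine (hs.eventually_mem hps).and ((e'.open_source.eventually_mem hp').and
      ((hc.eventually (gt_mem_nhds (lt_add_one _))).and (hc'.eventually (lt_mem_nhds ?_))))
    change p.1.1 + 1 < (τ (e p)).1.1
    rw [hτt]
    linarith
  obtain ⟨s', hs'P, hs', hps'⟩ := eventually_nhds_iff.1 hev
  have hU1 : IsOpen {z : BaseSpace | z.1 < a} := isOpen_lt continuous_fst continuous_const
  have hU2 : IsOpen {z : BaseSpace | a < z.1} := isOpen_lt continuous_const continuous_fst
  let V1 := restrPotential (constPotential 0) _ hU1
  let V2 := restrPotential V' _ hU2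
  have hdisj : Disjoint V1.domain V2.domain := Set.disjoint_left.2 fun z h1 h2 =>
    not_lt_of_gt (show a < z.1 from h2.2) (show z.1 < a from h1.2)
  have h2 : e'.restr s' ∈ pointSymmetries (unionPotential V1 V2 hdisj) := by
    refine admissible_of_eqOn h1 (fun q hq => ?_) (fun _ _ => rfl) (fun q hq => ?_) fun q hq => ?_
    · obtain ⟨hq1, hq2⟩ := (mem_restr_source hs').1 hq
      exact (mem_restr_source hs).2 ⟨hq1, (hs'P q hq2).1⟩
    · obtain ⟨hq1, hq2⟩ := (mem_restr_source hs').1 hq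
      exact unionPotential_left hdisj (V := V1) ⟨trivial, (hs'P q hq2).2.2.1⟩
    · obtain ⟨hq1, hq2⟩ := (mem_restr_source hs').1 hq
      exact unionPotential_right hdisj (W := V2)
        ⟨(h1.2.1 q ((mem_restr_source hs).2 ⟨hq1, (hs'P q hq2).1⟩)).2, (hs'P q hq2).2.2.2⟩
  refine ⟨s', hs', hps', G.mem_of_eqOnSource (G.trans (hG _ _ h2) (G.symm hτG)) ⟨?_, ?_⟩⟩
  · ext q
    rw [mem_restr_source hs', OpenPartialHomeomorph.trans_source]
    constructor
    · rintro ⟨h3, h4⟩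
      have h5 := (hs'P q h4).2.1
      refine ⟨(mem_restr_source hs').2 ⟨h5, h4⟩, ?_⟩
      rw [OpenPartialHomeomorph.trans_source] at h5
      exact τ.map_source h5.2
    · rintro ⟨h3, -⟩
      obtain ⟨h4, h5⟩ := (mem_restr_source hs').1 h3
      rw [OpenPartialHomeomorph.trans_source] at h4
      exact ⟨h4.1, h5⟩
  · intro q hq
    have h5 := (hs'P q ((mem_restr_source hs').1 hq).2).2.1
    rw [OpenPartialHomeomorph.trans_source] at h5
    exact (τ.left_inv h5.2).symm

theorem mem_generatedBySymmetries {e : OpenPartialHomeomorph VarSpace VarSpace} :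
    e ∈ generatedBySymmetries ↔ LocallyExplicit e := by
  constructor
  · intro h
    exact Set.mem_iInter₂.1 h explicitGroupoid fun V e he p hp => explicit_of_admissible he hp
  · intro h
    exact Set.mem_iInter₂.2 fun G hG => locallyExplicit_mem_of_symmetries hG h

/-- `Φ` coincides with the explicit transformation `D.ext` near `q`. -/
def ExtExplicitNear (Φ : OpenPartialHomeomorph ExtSpace ExtSpace) (D : Coeffs) (q : ExtSpace) :
    Prop :=
  (∃ J, D.ValidOn J ∧ q.1.1.1 ∈ J) ∧ ∀ᶠ q' in 𝓝 q, Φ q' = D.ext q'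

theorem continuous_time : Continuous fun q : ExtSpace => q.1.1.1 :=
  continuous_fst.comp (continuous_fst.comp continuous_fst)

theorem explicit_of_equivalence {Φ : OpenPartialHomeomorph ExtSpace ExtSpace}
    (hΦ : Φ ∈ equivalenceGroup) {q : ExtSpace} (hq : q ∈ Φ.source) :
    ∃ D, ExtExplicitNear Φ D q := by
  obtain ⟨s, hs, hqs, -, e, ⟨hes, hep⟩, hV⟩ := hΦ q hq
  have hq' : q ∈ (Φ.restr s).source := (mem_restr_source hs).2 ⟨hq, hqs⟩
  have key : ∀ q' ∈ (Φ.restr s).source, ∃ V' e', (∀ p, e' p = e p) ∧ q'.1 ∈ e'.source ∧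
      e' ∈ admissible (constPotential q'.2) V' ∧ (Φ q').2 = V'.toFun (Φ q').1.1 := by
    intro q' hq'
    obtain ⟨V', hm, ha⟩ := hV (constPotential q'.2)
    have h1 : q'.1 ∈ applyDomain (Φ.restr s) (constPotential q'.2) := ⟨trivial, hq'⟩
    have h2 : IsOpen (applyDomain (Φ.restr s) (constPotential q'.2)) := by
      have h3 : Continuous fun p : VarSpace => (p, q'.2) := continuous_id.prodMk continuous_const
      have h4 : applyDomain (Φ.restr s) (constPotential q'.2)
          = (fun p : VarSpace => (p, q'.2)) ⁻¹' (Φ.restr s).source :=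
        Set.ext fun p => and_iff_right trivial
      rw [h4]
      exact (Φ.restr s).open_source.preimage h3
    refine ⟨V', e.restr (applyDomain (Φ.restr s) (constPotential q'.2)), fun _ => rfl, (mem_restr_source h2).2 ⟨?_, h1⟩, ha, (hm q'.1 h1).2⟩
    rw [hes]
    exact Set.mem_image_of_mem _ hq'
  obtain ⟨V₀, e₀, he₀, hq₀, ha₀, -⟩ := key q hq'
  obtain ⟨D, hD⟩ := explicit_of_admissible ha₀ hq₀
  refine ⟨D, hD.1, ?_⟩
  have hfst : Filter.Tendsto (Prod.fst : ExtSpace → VarSpace) (𝓝 q) (𝓝 q.1) :=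
    continuous_fst.continuousAt
  filter_upwards [hfst.eventually hD.eventually, (Φ.restr s).open_source.mem_nhds hq']
    with q' h1 h2
  obtain ⟨V', e', he', hq'', ha', hpot⟩ := key q' h2
  have h3 : (Φ q').1 = e q'.1 := hep q' h2
  have h4 : e q'.1 = D.map q'.1 := by rw [← he₀, h1.2.self_of_nhds]
  have h5 := potential_eq ha' hq'' (h1.congr (Filter.Eventually.of_forall fun p => by
    rw [he', he₀]))
  rw [he', ← h3, ← hpot] at h5
  exact Prod.ext (h3.trans h4) h5

theorem equivalence_of_explicit {Φ : OpenPartialHomeomorph ExtSpace ExtSpace}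
    (h : ∀ q ∈ Φ.source, ∃ D, ExtExplicitNear Φ D q) : Φ ∈ equivalenceGroup := by
  intro q hq
  obtain ⟨D, ⟨J, hJ, hqJ⟩, hev⟩ := h q hq
  obtain ⟨s1, hs1P, hs1, hqs1⟩ := eventually_nhds_iff.1 hev
  obtain ⟨s0, hs0, hqs0, hs0J, hpush⟩ := exists_push hJ hqJ
  obtain ⟨b, hqb, hb⟩ := exists_local_homeo (Coeffs.map_immersion (hJ.valid _ hqJ)).1
    (Coeffs.map_immersion (hJ.valid _ hqJ)).2
  let s : Set ExtSpace := s1 ∩ Prod.fst ⁻¹' (b.source ∩ Prod.fst ⁻¹' s0)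
  have hs : IsOpen s := hs1.inter ((b.open_source.inter
    (hs0.preimage continuous_fst)).preimage continuous_fst)
  have hS : ∀ q' ∈ (Φ.restr s).source, Φ q' = D.ext q' ∧ q'.1 ∈ b.source ∧ q'.1.1 ∈ s0 ∧
      ∀ᶠ y in 𝓝 q', Φ y = D.ext y := by
    intro q' hq'
    have h1 := ((mem_restr_source hs).1 hq').2
    exact ⟨hs1P _ h1.1, h1.2.1, h1.2.2, Filter.mem_of_superset (hs1.mem_nhds h1.1) hs1P⟩
  have hopen : IsOpen (Prod.fst '' (Φ.restr s).source) := isOpenMap_fst _ (Φ.restr s).open_source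
  have hmem : ∀ p, p ∈ (b.restr (Prod.fst '' (Φ.restr s).source)).source ↔
      p ∈ Prod.fst '' (Φ.restr s).source := by
    intro p
    rw [mem_restr_source hopen]
    refine and_iff_right_of_imp ?_
    rintro ⟨q', hq', rfl⟩
    exact (hS q' hq').2.1
  refine ⟨s, hs, ⟨hqs1, hqb, hqs0⟩, isPointTransformation_of_immersion fun q' hq' =>
    ⟨D.ext, (hS q' hq').2.2.2, Coeffs.ext_immersion hJ (hs0J _ (hS q' hq').2.2.1)⟩,
    b.restr (Prod.fst '' (Φ.restr s).source), ⟨Set.ext hmem, fun q' hq' => ?_⟩, fun V => ?_⟩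
  · change (Φ q').1 = b q'.1
    rw [hb, (hS q' hq').1]
    rfl
  · obtain ⟨V', hV'⟩ := hpush V
    have hmap : ∀ p ∈ applyDomain (Φ.restr s) V, D.base p.1 ∈ V'.domain ∧
        V'.toFun (D.base p.1) = D.pot p.1 (V.toFun p.1) := fun p hp =>
      hV' p.1 (hS _ hp.2).2.2.1 hp.1
    refine ⟨V', fun p hp => ?_, admissible_of_explicit (fun p hp => ?_) fun p hp => ?_⟩
    · have h1 : Φ.restr s (p, V.toFun p.1) = D.ext (p, V.toFun p.1) := (hS _ hp.2).1
      rw [h1]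
      exact ⟨(hmap p hp).1, (hmap p hp).2.symm⟩
    · have h1 := interior_subset hp.2
      refine ⟨h1.1, ?_⟩
      change (b p).1 ∈ _
      rw [hb]
      exact (hmap p h1).1
    · have h1 := interior_subset hp.2
      exact ⟨D, ⟨⟨J, hJ, hs0J _ (hS _ h1.2).2.2.1⟩, Filter.Eventually.of_forall hb⟩, (hmap p h1).2⟩

open Classical in
/-- The lift of a transformation of `(t, x, ψ)` to `(t, x, ψ, V)`. -/
noncomputable def liftFun (e : OpenPartialHomeomorph VarSpace VarSpace) (q : ExtSpace) : ExtSpace :=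
  (e q.1, if h : ∃ D, ExplicitNear e D q.1 then h.choose.pot q.1.1 q.2 else q.2)

theorem liftFun_eq {e : OpenPartialHomeomorph VarSpace VarSpace} {q : ExtSpace} {D : Coeffs}
    (hq : q.1 ∈ e.source) (hD : ExplicitNear e D q.1) : liftFun e q = D.ext q := by
  have h : ∃ D, ExplicitNear e D q.1 := ⟨D, hD⟩
  rw [liftFun, dif_pos h, pot_unique hq h.choose_spec hD, hD.2.self_of_nhds, Coeffs.ext]

theorem eventually_liftFun_eq {e : OpenPartialHomeomorph VarSpace VarSpace} {q : ExtSpace}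
    {D : Coeffs} (hq : q.1 ∈ e.source) (hD : ExplicitNear e D q.1) :
    ∀ᶠ q' in 𝓝 q, liftFun e q' = D.ext q' := by
  have hfst : Filter.Tendsto (Prod.fst : ExtSpace → VarSpace) (𝓝 q) (𝓝 q.1) :=
    continuous_fst.continuousAt
  filter_upwards [hfst.eventually hD.eventually, hfst.eventually (e.open_source.mem_nhds hq)]
    with q' h1 h2
  exact liftFun_eq h2 h1

theorem continuousOn_liftFun {e : OpenPartialHomeomorph VarSpace VarSpace}
    (he : LocallyExplicit e) : ContinuousOn (liftFun e) (Prod.fst ⁻¹' e.source) := by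
  intro q hq
  obtain ⟨D, hD⟩ := he q.1 hq
  obtain ⟨J, hJ, hqJ⟩ := hD.1
  exact ((Coeffs.ext_immersion hJ hqJ).1.continuousAt.congr
    (Filter.EventuallyEq.symm (eventually_liftFun_eq hq hD))).continuousWithinAt

theorem liftFun_symm {e : OpenPartialHomeomorph VarSpace VarSpace} (he : LocallyExplicit e)
    {q : ExtSpace} (hq : q.1 ∈ e.source) : liftFun e.symm (liftFun e q) = q := by
  obtain ⟨D, hD⟩ := he q.1 hq
  obtain ⟨D', hD'⟩ := locallyExplicit_symm he _ (e.map_source hq)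
  obtain ⟨s, hs, hps, h⟩ := exists_push_admissible hD
  obtain ⟨V', hV'⟩ := h (constPotential q.2)
  have h1 := hV' s hs subset_rfl fun _ _ => trivial
  have hp1 : q.1 ∈ (e.restr s).source := (mem_restr_source hs).2 ⟨hq, hps⟩
  have h2 : V'.toFun (e q.1).1 = D.pot q.1.1 q.2 :=
    potential_eq h1 hp1 (hD.congr (Filter.Eventually.of_forall fun _ => rfl))
  have h3 : (constPotential q.2).toFun _ = D'.pot (e q.1).1 (V'.toFun (e q.1).1) :=
    potential_eq (admissible_symm h1) ((e.restr s).map_source hp1)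
      (hD'.congr (Filter.Eventually.of_forall fun _ => rfl))
  have h4 : liftFun e q = (e q.1, D.pot q.1.1 q.2) := by
    rw [liftFun_eq hq hD, Coeffs.ext, hD.2.self_of_nhds]
  have h5 : liftFun e.symm (e q.1, D.pot q.1.1 q.2) = _ := liftFun_eq (e.map_source hq) hD'
  rw [h4, h5, Coeffs.ext, ← hD'.2.self_of_nhds, e.left_inv hq, ← h2, ← h3]
  rfl

/-- The lift of a locally explicit transformation of `(t, x, ψ)` to `(t, x, ψ, V)`. -/
noncomputable def lift (e : OpenPartialHomeomorph VarSpace VarSpace) (he : LocallyExplicit e) :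
    OpenPartialHomeomorph ExtSpace ExtSpace where
  toFun := liftFun e
  invFun := liftFun e.symm
  source := Prod.fst ⁻¹' e.source
  target := Prod.fst ⁻¹' e.target
  map_source' _ hq := e.map_source hq
  map_target' _ hq := e.map_target hq
  left_inv' _ hq := liftFun_symm he hq
  right_inv' _ hq := liftFun_symm (locallyExplicit_symm he) hq
  open_source := e.open_source.preimage continuous_fst
  open_target := e.open_target.preimage continuous_fst
  continuousOn_toFun := continuousOn_liftFun he
  continuousOn_invFun := continuousOn_liftFun (locallyExplicit_symm he)

theorem lift_mem {e : OpenPartialHomeomorph VarSpace VarSpace} (he : LocallyExplicit e) :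
    lift e he ∈ equivalenceGroup :=
  equivalence_of_explicit fun q hq => by
    obtain ⟨D, hD⟩ := he q.1 hq
    exact ⟨D, hD.1, eventually_liftFun_eq hq hD⟩

theorem lift_projectsTo {e : OpenPartialHomeomorph VarSpace VarSpace} (he : LocallyExplicit e) :
    ProjectsTo (lift e he) e :=
  ⟨(Set.image_preimage_eq _ Prod.fst_surjective).symm, fun _ _ => rfl⟩

theorem isNormalized : IsNormalized := by
  intro V V' e he
  have hle : LocallyExplicit e := fun p hp => explicit_of_admissible he hp
  refine ⟨lift e hle, lift_mem hle, lift_projectsTo hle, fun p hp => ⟨(he.2.1 p hp).1, hp⟩,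
    fun p hp => ⟨(he.2.1 p hp.2).2, ?_⟩⟩
  obtain ⟨D, hD⟩ := hle p hp.2
  have h1 : lift e hle (p, V.toFun p.1) = D.ext (p, V.toFun p.1) := liftFun_eq hp.2 hD
  change _ = V'.toFun (e p).1
  rw [h1, potential_eq he hp.2 hD]
  rfl

theorem projected_eq : projectedEquivalenceGroup = {e | e ∈ generatedBySymmetries} := by
  ext e
  rw [Set.mem_ofPred_eq, mem_generatedBySymmetries]
  constructor
  · rintro ⟨Φ, hΦ, hs, he⟩ p hp
    rw [hs] at hp
    obtain ⟨q, hq, rfl⟩ := hp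
    obtain ⟨D, h1, h2⟩ := explicit_of_equivalence hΦ hq
    refine ⟨D, h1, ?_⟩
    have hc : Filter.Tendsto (fun p : VarSpace => ((p, q.2) : ExtSpace)) (𝓝 q.1) (𝓝 q) :=
      (continuous_id.prodMk continuous_const).continuousAt
    filter_upwards [hc.eventually h2, hc.eventually (Φ.open_source.mem_nhds hq)] with p h3 h4
    rw [← he _ h4, h3]
    rfl
  · intro h
    exact ⟨lift e h, lift_mem h, lift_projectsTo h⟩

theorem isStronglyNormalized : IsStronglyNormalized := ⟨isNormalized, projected_eq⟩

theorem hasExplicitForm_of_validOn {Φ : OpenPartialHomeomorph ExtSpace ExtSpace} {D : Coeffs}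
    {J : Set ℝ} (hJ : D.ValidOn J) (hc : J.OrdConnected)
    (hO : D.O ∈ Matrix.orthogonalGroup (Fin 2) ℝ)
    (h : ∀ q ∈ Φ.source, q.1.1.1 ∈ J ∧ Φ q = D.ext q) : HasExplicitForm Φ :=
  ⟨J, D.T, D.O, D.X, D.Ψ, hJ.isOpen, hc,
    fun t ht => (hJ.valid t ht).smoothT.contDiffWithinAt,
    fun a t ht => ((hJ.valid t ht).smoothX a).contDiffWithinAt,
    fun t ht => (hJ.valid t ht).smoothΨ.contDiffWithinAt,
    fun t ht => (hJ.valid t ht).deriv_ne, hO, fun _ _ _ _ hq => h _ hq⟩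

theorem HasExplicitForm.exists_coeffs {Φ : OpenPartialHomeomorph ExtSpace ExtSpace}
    (h : HasExplicitForm Φ) : ∃ (D : Coeffs) (J : Set ℝ), D.ValidOn J ∧
      ∀ q ∈ Φ.source, q.1.1.1 ∈ J ∧ Φ q = D.ext q := by
  obtain ⟨J, T, O, X, Ψ, hJ, -, hT, hX, hΨ, hT0, hO, hΦ⟩ := h
  exact ⟨⟨T, O, X, Ψ⟩, J, ⟨hJ, fun t ht => ⟨hT.contDiffAt (hJ.mem_nhds ht),
    fun a => (hX a).contDiffAt (hJ.mem_nhds ht), hΨ.contDiffAt (hJ.mem_nhds ht), hT0 t ht, hO⟩⟩,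
    fun q hq => hΦ _ _ _ _ hq⟩

theorem HasExplicitForm.extExplicitNear {Φ : OpenPartialHomeomorph ExtSpace ExtSpace}
    (h : HasExplicitForm Φ) {q : ExtSpace} (hq : q ∈ Φ.source) : ∃ D, ExtExplicitNear Φ D q := by
  obtain ⟨D, J, hJ, hΦ⟩ := h.exists_coeffs
  exact ⟨D, ⟨J, hJ, (hΦ q hq).1⟩, Filter.mem_of_superset (Φ.open_source.mem_nhds hq)
    fun q' hq' => (hΦ q' hq').2⟩

theorem mem_equivalenceGroup_iff {Φ : OpenPartialHomeomorph ExtSpace ExtSpace} :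
    Φ ∈ equivalenceGroup ↔ ∀ q ∈ Φ.source, ∃ s : Set ExtSpace, IsOpen s ∧ q ∈ s ∧
      HasExplicitForm (Φ.restr s) := by
  constructor
  · intro hΦ q hq
    obtain ⟨D, ⟨J, hJ, hqJ⟩, hev⟩ := explicit_of_equivalence hΦ hq
    obtain ⟨s, hsP, hs, hqs⟩ := eventually_nhds_iff.1 hev
    obtain ⟨r, hr, hrJ⟩ := Metric.isOpen_iff.1 hJ.isOpen _ hqJ
    have hop : IsOpen (s ∩ (fun q : ExtSpace => q.1.1.1) ⁻¹' Metric.ball q.1.1.1 r) :=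
      hs.inter (Metric.isOpen_ball.preimage continuous_time)
    refine ⟨_, hop, ⟨hqs, Metric.mem_ball_self hr⟩,
      hasExplicitForm_of_validOn ⟨Metric.isOpen_ball, fun t ht => hJ.valid t (hrJ ht)⟩
        (convex_ball _ _).ordConnected (hJ.valid _ hqJ).orth fun q' hq' => ?_⟩
    have h1 := ((mem_restr_source hop).1 hq').2
    exact ⟨h1.2, hsP _ h1.1⟩
  · intro h
    refine equivalence_of_explicit fun q hq => ?_
    obtain ⟨s, hs, hqs, h1⟩ := h q hq
    obtain ⟨D, hD⟩ := h1.extExplicitNear ((mem_restr_source hs).2 ⟨hq, hqs⟩)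
    exact ⟨D, hD.1, hD.2⟩

section Congr

variable {T T' : ℝ → ℝ} {O : Matrix (Fin 2) (Fin 2) ℝ} {X X' : Fin 2 → ℝ → ℝ} {Ψ Ψ' : ℝ → ℝ}

theorem alpha_congr {z : BaseSpace} (hT : T =ᶠ[𝓝 z.1] T') (hX : ∀ b, X b =ᶠ[𝓝 z.1] X' b) :
    (Coeffs.mk T O X 0).alpha z = (Coeffs.mk T' O X' 0).alpha z := by
  have h2 := hT.iteratedDeriv_eq 2
  have h3 := fun b => (hX b).deriv_eq
  simp only [Coeffs.alpha, phase, hT.deriv_eq, h2, h3]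

theorem ext_congr {q : ExtSpace} (hT : T =ᶠ[𝓝 q.1.1.1] T') (hX : ∀ b, X b =ᶠ[𝓝 q.1.1.1] X' b)
    (hΨ : deriv Ψ q.1.1.1 = deriv Ψ' q.1.1.1)
    (hE : Complex.exp (I * (Ψ q.1.1.1 : ℂ)) = Complex.exp (I * (Ψ' q.1.1.1 : ℂ))) :
    (Coeffs.mk T O X Ψ).ext q = (Coeffs.mk T' O X' Ψ').ext q := by
  have h2 := hT.iteratedDeriv_eq 2
  have h3 := hT.iteratedDeriv_eq 3
  have h4 := fun b => (hX b).deriv_eq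
  have h5 := fun b => ((hX b).deriv.div hT.deriv).deriv_eq (𝕜 := ℝ)
  have h6 := fun b => (hX b).self_of_nhds
  have h7 : ∀ b, deriv (fun s => deriv (X b) s / deriv T s) q.1.1.1
      = deriv (fun s => deriv (X' b) s / deriv T' s) q.1.1.1 := h5
  refine Prod.ext (Prod.ext (Prod.ext hT.self_of_nhds ?_) ?_) ?_
  · change newX T O X q.1.1.1 q.1.1.2 = newX T' O X' q.1.1.1 q.1.1.2
    funext b
    simp only [newX, hT.deriv_eq, h6]
  · change (Coeffs.mk T O X Ψ).alpha q.1.1 * hat (deriv T q.1.1.1) q.1.2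
      = (Coeffs.mk T' O X' Ψ').alpha q.1.1 * hat (deriv T' q.1.1.1) q.1.2
    rw [alpha_eq_mul_exp, alpha_eq_mul_exp T', alpha_congr hT hX, hE, hT.deriv_eq]
  · simp only [Coeffs.ext, Coeffs.pot, newV, hT.deriv_eq, h2, h3, h4, h7, hΨ]

end Congr

theorem base_unique {D D' : Coeffs} {z : BaseSpace} (hv : D.ValidAt z.1) (hv' : D'.ValidAt z.1)
    (hbase : D.base =ᶠ[𝓝 z] D'.base) :
    D.T =ᶠ[𝓝 z.1] D'.T ∧ (∀ b, D.X b =ᶠ[𝓝 z.1] D'.X b) ∧ D.O = D'.O := by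
  have hct : Filter.Tendsto (fun s : ℝ => ((s, z.2) : BaseSpace)) (𝓝 z.1) (𝓝 z) :=
    (continuous_id.prodMk continuous_const).continuousAt
  have hT : D.T =ᶠ[𝓝 z.1] D'.T := by
    filter_upwards [hct.eventually hbase] with s hs
    exact congrArg Prod.fst hs
  have hsc : D.scale z.1 = D'.scale z.1 := by
    rw [Coeffs.scale, Coeffs.scale, hT.deriv_eq]
  have hO : D.O = D'.O := by
    ext b a
    have h1 : (fderiv ℝ D.base z (eb a)).2 b = (fderiv ℝ D'.base z (eb a)).2 b := by
      rw [hbase.fderiv_eq]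
    have h2 : ∀ {E : Coeffs}, E.ValidAt z.1 → (fderiv ℝ E.base z (eb a)).2 b
        = E.scale z.1 * E.O b a := fun {E} hE => by
      rw [Coeffs.fderiv_base (contDiffAt_differentiableAt hE.smoothT).hasDerivAt
        (Coeffs.hasDerivAt_scale hE)
        (fun b => (contDiffAt_differentiableAt (hE.smoothX b)).hasDerivAt)]
      fin_cases a <;> simp [eb]
    rw [h2 hv, h2 hv', ← hsc] at h1
    exact mul_left_cancel₀ (Coeffs.scale_pos hv).ne' h1
  refine ⟨hT, fun b => ?_, hO⟩
  filter_upwards [hct.eventually hbase, hT.deriv] with s h1 h2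
  have h3 := congrFun (congrArg Prod.snd h1) b
  simp only [Coeffs.base, newX, h2, hO] at h3
  exact add_left_cancel h3

theorem phase_unique {D D' : Coeffs} {J : Set ℝ} (hJ : D.ValidOn J) {p : VarSpace}
    (hp : p.1.1 ∈ J) (hψ : p.2 ≠ 0) (hT : D.T =ᶠ[𝓝 p.1.1] D'.T)
    (hX : ∀ b, D.X b =ᶠ[𝓝 p.1.1] D'.X b) (hO : D.O = D'.O)
    (h : ∀ᶠ y in 𝓝 p, D.map y = D'.map y) : ∀ᶠ s in 𝓝 p.1.1,
      Complex.exp (I * (D.Ψ s : ℂ)) = Complex.exp (I * (D'.Ψ s : ℂ)) := by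
  have hc3 : Filter.Tendsto (fun s : ℝ => (((s, p.1.2), p.2) : VarSpace)) (𝓝 p.1.1) (𝓝 p) :=
    ((continuous_id.prodMk continuous_const).prodMk continuous_const).continuousAt
  filter_upwards [hc3.eventually h, hT.eventuallyEq_nhds, (hX 0).eventuallyEq_nhds,
    (hX 1).eventuallyEq_nhds, hJ.isOpen.mem_nhds hp] with s h1 h2 h3 h4 h5
  have hvs := hJ.valid _ h5
  have h6 : (Coeffs.mk D.T D.O D.X D.Ψ).alpha (s, p.1.2) * hat (deriv D.T s) p.2
      = (Coeffs.mk D'.T D'.O D'.X D'.Ψ).alpha (s, p.1.2) * hat (deriv D'.T s) p.2 :=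
    congrArg Prod.snd h1
  have h0 : (Coeffs.mk D.T D.O D.X 0).alpha (s, p.1.2) ≠ 0 :=
    Coeffs.alpha_ne_zero (D := ⟨D.T, D.O, D.X, 0⟩) (z := (s, p.1.2))
      ⟨hvs.smoothT, hvs.smoothX, contDiffAt_const, hvs.deriv_ne, hvs.orth⟩
  rw [alpha_eq_mul_exp, alpha_eq_mul_exp D'.T, ← hO, ← h2.deriv_eq,
    ← alpha_congr (z := (s, p.1.2)) h2 (Fin.forall_fin_two.2 ⟨h3, h4⟩)] at h6
  exact mul_left_cancel₀ h0 (mul_right_cancel₀ (fun h => hψ (hat_eq_zero.1 h)) h6)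

theorem hasDerivAt_exp_phase {Ψ : ℝ → ℝ} {t Ψ' : ℝ} (h : HasDerivAt Ψ Ψ' t) :
    HasDerivAt (fun s => Complex.exp (I * (Ψ s : ℂ)))
      (Complex.exp (I * (Ψ t : ℂ)) * (I * (Ψ' : ℂ))) t :=
  (h.ofReal_comp.const_mul I).cexp

/-- The parameters of an explicit transformation are determined by the transformation, except that
`Ψ` is determined up to multiples of `2π`. -/
theorem coeffs_unique {D D' : Coeffs} {J J' : Set ℝ} (hJ : D.ValidOn J) (hJ' : D'.ValidOn J')
    {q : ExtSpace} (hq : q.1.1.1 ∈ J) (hq' : q.1.1.1 ∈ J') (h : ∀ᶠ y in 𝓝 q, D.ext y = D'.ext y) :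
    D.T =ᶠ[𝓝 q.1.1.1] D'.T ∧ (∀ b, D.X b =ᶠ[𝓝 q.1.1.1] D'.X b) ∧ D.O = D'.O ∧
      deriv D.Ψ q.1.1.1 = deriv D'.Ψ q.1.1.1 ∧
      Complex.exp (I * (D.Ψ q.1.1.1 : ℂ)) = Complex.exp (I * (D'.Ψ q.1.1.1 : ℂ)) := by
  have hv := hJ.valid _ hq
  have hv' := hJ'.valid _ hq'
  have hc1 : Filter.Tendsto (fun z : BaseSpace => (((z, q.1.2), q.2) : ExtSpace)) (𝓝 q.1.1)
      (𝓝 q) :=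
    ((continuous_id.prodMk continuous_const).prodMk continuous_const).continuousAt
  have hc : Filter.Tendsto (fun p : VarSpace => ((p, q.2) : ExtSpace)) (𝓝 q.1) (𝓝 q) :=
    (continuous_id.prodMk continuous_const).continuousAt
  have hmap : ∀ᶠ p in 𝓝 q.1, D.map p = D'.map p :=
    (hc.eventually h).mono fun p hp => congrArg Prod.fst hp
  have hbase : D.base =ᶠ[𝓝 q.1.1] D'.base :=
    (hc1.eventually h).mono fun z hz => congrArg (fun q : ExtSpace => q.1.1) hz
  obtain ⟨hT, hX, hO⟩ := base_unique hv hv' hbase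
  have hE : ∀ᶠ s in 𝓝 q.1.1.1,
      Complex.exp (I * (D.Ψ s : ℂ)) = Complex.exp (I * (D'.Ψ s : ℂ)) := by
    have hc2 : Filter.Tendsto (fun ψ : ℂ => ((q.1.1, ψ) : VarSpace)) (𝓝 q.1.2) (𝓝 q.1) :=
      (continuous_const.prodMk continuous_id).continuousAt
    have hfr : ∃ᶠ ψ in 𝓝 q.1.2, ψ ∈ ({0} : Set ℂ)ᶜ :=
      mem_closure_iff_frequently.1 (dense_compl_singleton (0 : ℂ) q.1.2)
    obtain ⟨ψ, hψ, hev⟩ := (hfr.and_eventually (hc2.eventually hmap.eventually_nhds)).exists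
    exact phase_unique hJ (p := (q.1.1, ψ)) hq hψ hT hX hO hev
  refine ⟨hT, hX, hO, ?_, hE.self_of_nhds⟩
  have h1 := (hasDerivAt_exp_phase (contDiffAt_differentiableAt hv.smoothΨ).hasDerivAt).unique
    ((hasDerivAt_exp_phase
      (contDiffAt_differentiableAt hv'.smoothΨ).hasDerivAt).congr_of_eventuallyEq hE)
  rw [hE.self_of_nhds] at h1
  have h2 := mul_left_cancel₀ I_ne_zero (mul_left_cancel₀ (Complex.exp_ne_zero _) h1)
  exact_mod_cast h2

theorem eq_of_locally_eq {E β : Type*} [TopologicalSpace E] {S : Set E} (hS : IsPreconnected S)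
    {F : E → β} (h : ∀ q ∈ S, ∀ᶠ q' in 𝓝[S] q, F q' = F q) {q q' : E} (hq : q ∈ S)
    (hq' : q' ∈ S) : F q = F q' :=
  hS.induction₂ (fun q q' => F q = F q') (fun q hq => (h q hq).mono fun _ h => h.symm)
    (fun _ _ _ _ _ _ h1 h2 => h1.trans h2) (fun _ _ _ _ h => h.symm) hq hq'

/-- The values at `t` of the parameters of an explicit transformation. -/
noncomputable def Coeffs.data (D : Coeffs) (t : ℝ) :
    ℝ × (Fin 2 → ℝ) × Matrix (Fin 2) (Fin 2) ℝ × ℝ × ℂ :=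
  (D.T t, fun b => D.X b t, D.O, deriv D.Ψ t, Complex.exp (I * (D.Ψ t : ℂ)))

theorem ExtExplicitNear.eventually {Φ : OpenPartialHomeomorph ExtSpace ExtSpace} {D : Coeffs}
    {q : ExtSpace} (h : ExtExplicitNear Φ D q) : ∀ᶠ q' in 𝓝 q, ExtExplicitNear Φ D q' := by
  obtain ⟨⟨J, hJ, hq⟩, hev⟩ := h
  filter_upwards [hev.eventually_nhds,
    continuous_time.continuousAt.eventually (hJ.isOpen.mem_nhds hq)] with q' h1 h2
  exact ⟨⟨J, hJ, h2⟩, h1⟩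

theorem ExtExplicitNear.data_eq {Φ : OpenPartialHomeomorph ExtSpace ExtSpace} {D D' : Coeffs}
    {q : ExtSpace} (h : ExtExplicitNear Φ D q) (h' : ExtExplicitNear Φ D' q) :
    D.data q.1.1.1 = D'.data q.1.1.1 := by
  obtain ⟨⟨J, hJ, hq⟩, hev⟩ := h
  obtain ⟨⟨J', hJ', hq'⟩, hev'⟩ := h'
  obtain ⟨h1, h2, h3, h4, h5⟩ := coeffs_unique hJ hJ' hq hq'
    (by filter_upwards [hev, hev'] with y h1 h2; rw [← h1, h2])
  rw [Coeffs.data, Coeffs.data, h1.self_of_nhds, h3, h4, h5]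
  simp only [fun b => (h2 b).self_of_nhds]

theorem exists_primitive {f : ℝ → ℝ} {J : Set ℝ} (hJ : IsOpen J) (hc : J.OrdConnected)
    (hf : ContinuousOn f J) {t₀ : ℝ} (ht₀ : t₀ ∈ J) (c : ℝ) :
    ∃ P : ℝ → ℝ, P t₀ = c ∧ ∀ t ∈ J, HasDerivAt P (f t) t := by
  refine ⟨fun t => c + ∫ s in t₀..t, f s, by simp, fun t ht => ?_⟩
  have h1 := intervalIntegral.integral_hasDerivAt_right
    ((hf.mono (hc.uIcc_subset ht₀ ht)).intervalIntegrable)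
    (hf.stronglyMeasurableAtFilter hJ t ht) (hf.continuousAt (hJ.mem_nhds ht))
  exact h1.const_add c

/-- Two functions with the same derivative near a point locally differ by a constant. -/
theorem eventually_eq_add_const {f g h : ℝ → ℝ} {t : ℝ} (hf : ∀ᶠ s in 𝓝 t, HasDerivAt f (h s) s)
    (hg : ∀ᶠ s in 𝓝 t, HasDerivAt g (h s) s) : ∃ κ, ∀ᶠ s in 𝓝 t, f s = g s + κ := by
  obtain ⟨r, hr, hball⟩ := Metric.eventually_nhds_iff_ball.1 (hf.and hg)
  refine ⟨f t - g t, eventually_ball (p := t) (r := r) (fun s hs => ?_) (Metric.mem_ball_self hr)⟩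
  have h1 : f s - g s = f t - g t := constant_on_ball (f := fun s => f s - g s) (fun y hy => by
    have h2 := ((hball y hy).1.sub (hball y hy).2).hasFDerivAt
    refine h2.congr_fderiv (ContinuousLinearMap.ext fun u => ?_)
    simp) hs
  linarith

/-- A transformation with convex domain which locally has the explicit form has it globally. -/
theorem hasExplicitForm_of_convex {Φ : OpenPartialHomeomorph ExtSpace ExtSpace}
    (hΦ : Convex ℝ Φ.source) (h : ∀ q ∈ Φ.source, ∃ D, ExtExplicitNear Φ D q) :
    HasExplicitForm Φ := by
  rcases Φ.source.eq_empty_or_nonempty with he | ⟨q₀, hq₀⟩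
  · exact hasExplicitForm_of_validOn (translation_validOn 0) Set.ordConnected_univ (one_mem _)
      fun q hq => by simp [he] at hq
  have : Nonempty Coeffs := ⟨translation 0⟩
  choose! D hD using h
  let F : ExtSpace → ℝ × (Fin 2 → ℝ) × Matrix (Fin 2) (Fin 2) ℝ × ℝ × ℂ :=
    fun q => (D q).data q.1.1.1
  have hF : ∀ q ∈ Φ.source, ∀ᶠ q' in 𝓝 q, q' ∈ Φ.source ∧ F q' = (D q).data q'.1.1.1 := by
    intro q hq
    filter_upwards [(hD q hq).eventually, Φ.open_source.mem_nhds hq] with q' h1 h2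
    exact ⟨h2, (hD q' h2).data_eq h1⟩
  let τ : ExtSpace →L[ℝ] ℝ := (ContinuousLinearMap.fst ℝ ℝ (Fin 2 → ℝ)).comp
    ((ContinuousLinearMap.fst ℝ BaseSpace ℂ).comp (ContinuousLinearMap.fst ℝ VarSpace ℂ))
  have hslice : ∀ q ∈ Φ.source, ∀ q' ∈ Φ.source, τ q = τ q' → F q = F q' := by
    intro q hq q' hq' hqq'
    have hconv : Convex ℝ (Φ.source ∩ τ ⁻¹' {τ q}) :=
      hΦ.inter ((convex_singleton (τ q)).linear_preimage τ.toLinearMap)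
    refine eq_of_locally_eq hconv.isPreconnected (fun y hy => ?_) ⟨hq, rfl⟩ ⟨hq', hqq'.symm⟩
    have h1 : ∀ᶠ y' in 𝓝[Φ.source ∩ τ ⁻¹' {τ q}] y, y' ∈ Φ.source ∩ τ ⁻¹' {τ q} :=
      eventually_mem_nhdsWithin
    filter_upwards [h1, (hF y hy.1).filter_mono nhdsWithin_le_nhds] with y' h2 h3
    have h4 : y'.1.1.1 = y.1.1.1 := Eq.trans (b := τ q) h2.2 (Eq.symm hy.2)
    rw [h3.2, h4]
  have hO : ∀ q ∈ Φ.source, (D q).O = (D q₀).O := fun q hq =>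
    eq_of_locally_eq hΦ.isPreconnected (F := fun q => (D q).O) (fun y hy =>
      ((hF y hy).filter_mono nhdsWithin_le_nhds).mono fun y' h1 =>
        congrArg (fun d => d.2.2.1) h1.2) hq hq₀
  let J : Set ℝ := τ '' Φ.source
  have hJo : IsOpen J := by
    have h1 : IsOpenMap τ := isOpenMap_fst.comp (isOpenMap_fst.comp isOpenMap_fst)
    exact h1 _ Φ.open_source
  have hJc : Convex ℝ J := hΦ.linear_image τ.toLinearMap
  choose! Q hQ hQτ using fun (t : ℝ) (ht : t ∈ J) => ht
  let G : ℝ → ℝ × (Fin 2 → ℝ) × Matrix (Fin 2) (Fin 2) ℝ × ℝ × ℂ := fun t => F (Q t)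
  have hG : ∀ q ∈ Φ.source, ∀ᶠ t in 𝓝 q.1.1.1, t ∈ J ∧ G t = (D q).data t := by
    intro q hq
    have hc : Filter.Tendsto (fun t : ℝ => ((((t, q.1.1.2), q.1.2), q.2) : ExtSpace)) (𝓝 q.1.1.1)
        (𝓝 q) := (((continuous_id.prodMk continuous_const).prodMk continuous_const).prodMk
          continuous_const).continuousAt
    filter_upwards [hc.eventually (hF q hq)] with t h1
    have htJ : t ∈ J := ⟨_, h1.1, rfl⟩
    exact ⟨htJ, (hslice _ (hQ t htJ) _ h1.1 (hQτ t htJ)).trans h1.2⟩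
  let T : ℝ → ℝ := fun t => (G t).1
  let X : Fin 2 → ℝ → ℝ := fun b t => (G t).2.1 b
  let f : ℝ → ℝ := fun t => (G t).2.2.2.1
  let E : ℝ → ℂ := fun t => (G t).2.2.2.2
  have hT : ∀ q ∈ Φ.source, T =ᶠ[𝓝 q.1.1.1] (D q).T := fun q hq =>
    (hG q hq).mono fun t h1 => congrArg (fun d => d.1) h1.2
  have hX : ∀ q ∈ Φ.source, ∀ b, X b =ᶠ[𝓝 q.1.1.1] (D q).X b := fun q hq b =>
    (hG q hq).mono fun t h1 => congrArg (fun d => d.2.1 b) h1.2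
  have hf : ∀ q ∈ Φ.source, f =ᶠ[𝓝 q.1.1.1] deriv (D q).Ψ := fun q hq =>
    (hG q hq).mono fun t h1 => congrArg (fun d => d.2.2.2.1) h1.2
  have hE : ∀ q ∈ Φ.source, E =ᶠ[𝓝 q.1.1.1] fun t => Complex.exp (I * ((D q).Ψ t : ℂ)) :=
    fun q hq => (hG q hq).mono fun t h1 => congrArg (fun d => d.2.2.2.2) h1.2
  have hv : ∀ q ∈ Φ.source, ∀ᶠ t in 𝓝 q.1.1.1, (D q).ValidAt t := by
    intro q hq
    obtain ⟨J', hJ', hqJ'⟩ := (hD q hq).1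
    exact Filter.mem_of_superset (hJ'.isOpen.mem_nhds hqJ') hJ'.valid
  have hfs : ∀ q ∈ Φ.source, ContDiffAt ℝ ∞ f q.1.1.1 := fun q hq =>
    (contDiffAt_deriv (hv q hq).self_of_nhds.smoothΨ).congr_of_eventuallyEq (hf q hq)
  have hfJ : ContinuousOn f J := by
    rintro _ ⟨q, hq, rfl⟩
    exact (hfs q hq).continuousAt.continuousWithinAt
  obtain ⟨P, hP0, hP⟩ := exists_primitive hJo hJc.ordConnected hfJ ⟨q₀, hq₀, rfl⟩
    ((D q₀).Ψ q₀.1.1.1)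
  have hPκ : ∀ q ∈ Φ.source, ∃ κ, ∀ᶠ t in 𝓝 q.1.1.1, P t = (D q).Ψ t + κ := by
    intro q hq
    refine eventually_eq_add_const (h := f) ?_ ?_
    · exact Filter.mem_of_superset (hJo.mem_nhds ⟨q, hq, rfl⟩) hP
    · filter_upwards [hf q hq, hv q hq] with t h1 h2
      rw [h1]
      exact (contDiffAt_differentiableAt h2.smoothΨ).hasDerivAt
  have hPE : ∀ q ∈ Φ.source, Complex.exp (I * (P q.1.1.1 : ℂ)) = E q.1.1.1 := by
    intro q hq
    have h1 : E q.1.1.1 * Complex.exp (-(I * (P q.1.1.1 : ℂ)))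
        = E q₀.1.1.1 * Complex.exp (-(I * (P q₀.1.1.1 : ℂ))) := by
      refine eq_of_locally_eq hJc.isPreconnected
        (F := fun t => E t * Complex.exp (-(I * (P t : ℂ)))) ?_ ⟨q, hq, rfl⟩ ⟨q₀, hq₀, rfl⟩
      rintro _ ⟨y, hy, rfl⟩
      obtain ⟨κ, hκ⟩ := hPκ y hy
      have h2 : ∀ᶠ t in 𝓝 y.1.1.1, E t * Complex.exp (-(I * (P t : ℂ)))
          = Complex.exp (-(I * (κ : ℂ))) := by
        filter_upwards [hE y hy, hκ] with t h3 h4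
        rw [h3, h4, ← Complex.exp_add]
        congr 1
        push_cast
        ring
      exact (h2.mono fun t h3 => h3.trans h2.self_of_nhds.symm).filter_mono nhdsWithin_le_nhds
    have h2 : P q₀.1.1.1 = (D q₀).Ψ q₀.1.1.1 := hP0
    rw [(hE q₀ hq₀).self_of_nhds, h2, ← Complex.exp_add, add_neg_cancel, Complex.exp_zero,
      Complex.exp_neg] at h1
    exact (eq_of_mul_inv_eq_one h1).symm
  refine hasExplicitForm_of_validOn (D := ⟨T, (D q₀).O, X, P⟩) (J := J) ⟨hJo, ?_⟩
    hJc.ordConnected (hv q₀ hq₀).self_of_nhds.orth fun q hq => ⟨⟨q, hq, rfl⟩, ?_⟩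
  · rintro _ ⟨q, hq, rfl⟩
    have h1 := (hv q hq).self_of_nhds
    obtain ⟨κ, hκ⟩ := hPκ q hq
    refine ⟨h1.smoothT.congr_of_eventuallyEq (hT q hq),
      fun b => (h1.smoothX b).congr_of_eventuallyEq (hX q hq b),
      (h1.smoothΨ.add contDiffAt_const).congr_of_eventuallyEq hκ, ?_,
      (hv q₀ hq₀).self_of_nhds.orth⟩
    change deriv T q.1.1.1 ≠ 0
    rw [(hT q hq).deriv_eq]
    exact h1.deriv_ne
  · rw [(hD q hq).2.self_of_nhds]
    have h1 : D q = ⟨(D q).T, (D q₀).O, (D q).X, (D q).Ψ⟩ := by rw [← hO q hq]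
    rw [h1]
    refine (ext_congr (hT q hq) (hX q hq) ?_ ?_).symm
    · exact (hP _ ⟨q, hq, rfl⟩).deriv.trans (hf q hq).self_of_nhds
    · rw [hPE q hq, (hE q hq).self_of_nhds]

end CubicNLS

theorem mainTheorem11 :
    CubicNLS.IsStronglyNormalized ∧
    (∀ Φ : OpenPartialHomeomorph CubicNLS.ExtSpace CubicNLS.ExtSpace,
      Φ ∈ CubicNLS.equivalenceGroup ↔
        ∀ q ∈ Φ.source, ∃ s : Set CubicNLS.ExtSpace, IsOpen s ∧ q ∈ s ∧
          CubicNLS.HasExplicitForm (Φ.restr s)) ∧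
    (∀ Φ : OpenPartialHomeomorph CubicNLS.ExtSpace CubicNLS.ExtSpace,
      Convex ℝ Φ.source →
        (Φ ∈ CubicNLS.equivalenceGroup ↔ CubicNLS.HasExplicitForm Φ)) := by
  open CubicNLS in
  exact ⟨isStronglyNormalized, fun Φ => mem_equivalenceGroup_iff, fun Φ hΦ =>
    ⟨fun h => hasExplicitForm_of_convex hΦ fun _ hq => explicit_of_equivalence h hq,
      fun h => equivalence_of_explicit fun _ hq => h.extExplicitNear hq⟩⟩
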